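/- **Conjoining Bipartite Matching (CBM).** An instance consists of a finite bipartite graph $G=(V_1\uplus V_2,E)$, a maximum weight $\omega_{\max}\in[0,\infty)$, a weight function $\omega:E\to[0,\omega_{\max}]\cup\{\infty\}$, a partition $P=\{C_1,\dots,C_k\}$ of the vertices into pairwise disjoint cells, and a join set $J\subseteq\{\{i,j\}:1\le i<j\le k\}$. A join $\{i,j\}$ is satisfied by a matching $M$ of $G$ if some edge $e\in M$ has $e\cap C_i\neq\emptyset$ and $e\cap C_j\neq\emptyset$; $M$ is conjoining if it satisfies all joins in $J$. The question is whether $G$ has a perfect conjoining matching $M$ of weight $\sum_{e\in M}\omega(e)\le\omega_{\max}$. **Theorem.** There is an algorithm that decides every CBM instance in which each vertex of $V_1$ has degree at most two, in time $O(2^{c(c+1)}n+n^3)$, where $n\ge 1$ is the number of vertices and $c=|J|$ is the size of the join set (for $n=0$ it takes time $O(1)$). The constant in the $O$ is independent of the instance. Here the instance is given by the bipartition, by lists of the edges with their weights and of the joins, each in arbitrary order, by the cell index of each vertex, and by $\omega_{\max}$. An algorithm is a program for a unit-cost random access machine which adds, subtracts (truncated at $0$) and compares natural numbers, adds and compares weights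 in $[0,\infty]$, and has indirect addressing; time is the number of operations executed. -/

import Mathlib

open scoped ENNReal NNReal

/-! ## Conjoining Bipartite Matching -/

/-- An instance of Conjoining Bipartite Matching: a bipartite graph `G = (V₁ ⊎ V₂, E)` on the
vertices `0, …, n - 1` (with `V₂` the complement of `V₁`), a weight function
`ω : E → [0, ω_max] ∪ {∞}`, a partition of the vertices into cells `C_0, …, C_{k-1}` and a join
set `J`. -/
structure CBMInstance where
  /-- the number of vertices -/
  n : ℕ
  /-- the number of cells of the vertex partition -/
  k : ℕ
  /-- the graph -/
  G : SimpleGraph (Fin n)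
  /-- the first side of the bipartition -/
  V₁ : Finset (Fin n)
  bipartite : G.IsBipartiteWith (V₁ : Set (Fin n)) (V₁ : Set (Fin n))ᶜ
  /-- the maximum weight -/
  ωmax : ℝ≥0
  /-- the weight function; only its values on the edges of `G` matter -/
  ω : Sym2 (Fin n) → ℝ≥0∞
  ω_range : ∀ e ∈ G.edgeSet, ω e ≤ ωmax ∨ ω e = ∞
  /-- the index of the cell that contains a vertex -/
  cellOf : Fin n → Fin k
  /-- the join set: unordered pairs of distinct cell indices -/
  J : Finset (Sym2 (Fin k))
  J_not_diag : ∀ j ∈ J, ¬ j.IsDiag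

namespace CBMInstance

/-- The cell `C_i` of the vertex partition. -/
def cell (I : CBMInstance) (i : Fin I.k) : Set (Fin I.n) := {v | I.cellOf v = i}

/-- The join `j = {i, i'}` is satisfied by `M`: some edge of `M` meets every one of the two cells
`C_i` and `C_i'`. -/
def Satisfies (I : CBMInstance) (M : I.G.Subgraph) (j : Sym2 (Fin I.k)) : Prop :=
  ∃ e ∈ M.edgeSet, ∀ i ∈ j, ∃ v ∈ e, v ∈ I.cell i

/-- `M` satisfies all joins. -/
def IsConjoining (I : CBMInstance) (M : I.G.Subgraph) : Prop :=
  ∀ j ∈ I.J, I.Satisfies M j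

/-- The sum of the weights of the edges of `M`. -/
noncomputable def weight (I : CBMInstance) (M : I.G.Subgraph) : ℝ≥0∞ :=
  ∑' e : M.edgeSet, I.ω e

/-- The question asked: is there a perfect conjoining matching of weight at most `ω_max`? -/
def IsYes (I : CBMInstance) : Prop :=
  ∃ M : I.G.Subgraph, M.IsPerfectMatching ∧ I.IsConjoining M ∧ I.weight M ≤ I.ωmax

/-- A listing of the edges and of the joins of an instance, each exactly once, in any order and
with the two ends of each pair in any order. -/
structure Listing (I : CBMInstance) where
  edges : List (Fin I.n × Fin I.n)
  edges_nodup : (edges.map fun p => s(p.1, p.2)).Nodup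
  mem_edges : ∀ e, e ∈ edges.map (fun p => s(p.1, p.2)) ↔ e ∈ I.G.edgeSet
  joins : List (Fin I.k × Fin I.k)
  joins_nodup : (joins.map fun p => s(p.1, p.2)).Nodup
  mem_joins : ∀ j, j ∈ joins.map (fun p => s(p.1, p.2)) ↔ j ∈ I.J

end CBMInstance

/-! ## Random access machines

A unit-cost random access machine. It has registers and arrays for natural numbers, on which it
can add, subtract (truncated) and compare, and registers and arrays for weights in `[0, ∞]`, which
it can only add and compare. Arrays are indexed by computed natural numbers (indirect addressing).
Control flow is structured (conditionals and loops). -/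

namespace RAM

/-- Memory contents: `reg r` and `wreg r` are the registers, `arr A i` and `warr A i` the array
cells. -/
structure State where
  reg : ℕ → ℕ
  arr : ℕ → ℕ → ℕ
  wreg : ℕ → ℝ≥0∞
  warr : ℕ → ℕ → ℝ≥0∞

/-- Expressions for natural numbers. -/
inductive NExp where
  | lit (a : ℕ)
  | reg (r : ℕ)
  | arr (A : ℕ) (i : NExp)
  | add (x y : NExp)
  | sub (x y : NExp)

/-- Expressions for weights. -/
inductive WExp where
  | zero
  | infty
  | reg (r : ℕ)
  | arr (A : ℕ) (i : NExp)
  | add (x y : WExp)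

/-- Tests. -/
inductive Test where
  | lt (x y : NExp)
  | eq (x y : NExp)
  | wle (x y : WExp)

/-- Programs. -/
inductive Prog where
  | skip
  | setReg (r : ℕ) (x : NExp)
  | setArr (A : ℕ) (i x : NExp)
  | setWReg (r : ℕ) (x : WExp)
  | setWArr (A : ℕ) (i : NExp) (x : WExp)
  | seq (P Q : Prog)
  | cond (b : Test) (P Q : Prog)
  | loop (b : Test) (P : Prog)

/-- The value of an expression. -/
def NExp.eval (s : State) : NExp → ℕ
  | lit a => a
  | reg r => s.reg r
  | arr A i => s.arr A (i.eval s)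
  | add x y => x.eval s + y.eval s
  | sub x y => x.eval s - y.eval s

/-- The number of operations needed to evaluate an expression. -/
def NExp.cost : NExp → ℕ
  | lit _ => 1
  | reg _ => 1
  | arr _ i => i.cost + 1
  | add x y => x.cost + y.cost + 1
  | sub x y => x.cost + y.cost + 1

/-- The value of an expression. -/
noncomputable def WExp.eval (s : State) : WExp → ℝ≥0∞
  | zero => 0
  | infty => ∞
  | reg r => s.wreg r
  | arr A i => s.warr A (i.eval s)
  | add x y => x.eval s + y.eval s

/-- The number of operations needed to evaluate an expression. -/
def WExp.cost : WExp → ℕ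
  | zero => 1
  | infty => 1
  | reg _ => 1
  | arr _ i => i.cost + 1
  | add x y => x.cost + y.cost + 1

/-- The outcome of a test. -/
def Test.Holds (s : State) : Test → Prop
  | lt x y => x.eval s < y.eval s
  | eq x y => x.eval s = y.eval s
  | wle x y => x.eval s ≤ y.eval s

/-- The number of operations needed to perform a test. -/
def Test.cost : Test → ℕ
  | lt x y => x.cost + y.cost + 1
  | eq x y => x.cost + y.cost + 1
  | wle x y => x.cost + y.cost + 1

/-- Overwrite one entry of an array. -/
def State.putArr (s : State) (A i a : ℕ) : State :=
  { s with arr := Function.update s.arr A (Function.update (s.arr A) i a) }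

/-- Overwrite one entry of a weight array. -/
def State.putWArr (s : State) (A i : ℕ) (a : ℝ≥0∞) : State :=
  { s with warr := Function.update s.warr A (Function.update (s.warr A) i a) }

/-- `Exec P s t s'`: started in the state `s`, the program `P` halts after exactly `t` steps in the
state `s'`. -/
inductive Exec : Prog → State → ℕ → State → Prop
  | skip (s : State) : Exec Prog.skip s 1 s
  | setReg (s : State) (r : ℕ) (x : NExp) :
      Exec (Prog.setReg r x) s (x.cost + 1)
        { s with reg := Function.update s.reg r (x.eval s) }
  | setArr (s : State) (A : ℕ) (i x : NExp) :
      Exec (Prog.setArr A i x) s (i.cost + x.cost + 1) (s.putArr A (i.eval s) (x.eval s))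
  | setWReg (s : State) (r : ℕ) (x : WExp) :
      Exec (Prog.setWReg r x) s (x.cost + 1)
        { s with wreg := Function.update s.wreg r (x.eval s) }
  | setWArr (s : State) (A : ℕ) (i : NExp) (x : WExp) :
      Exec (Prog.setWArr A i x) s (i.cost + x.cost + 1) (s.putWArr A (i.eval s) (x.eval s))
  | seq {P Q : Prog} {s s' s'' : State} {t t' : ℕ} :
      Exec P s t s' → Exec Q s' t' s'' → Exec (Prog.seq P Q) s (t + t') s''
  | cond_true {b : Test} {P Q : Prog} {s s' : State} {t : ℕ} :
      b.Holds s → Exec P s t s' → Exec (Prog.cond b P Q) s (b.cost + t) s'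
  | cond_false {b : Test} {P Q : Prog} {s s' : State} {t : ℕ} :
      ¬ b.Holds s → Exec Q s t s' → Exec (Prog.cond b P Q) s (b.cost + t) s'
  | loop_true {b : Test} {P : Prog} {s s' s'' : State} {t t' : ℕ} :
      b.Holds s → Exec P s t s' → Exec (Prog.loop b P) s' t' s'' →
        Exec (Prog.loop b P) s (b.cost + t + t') s''
  | loop_false {b : Test} {P : Prog} {s : State} :
      ¬ b.Holds s → Exec (Prog.loop b P) s b.cost s

end RAM

/-- The initial memory for an instance whose edges and joins are given by a listing. Registers
`0, 1, 2, 3` hold the numbers of vertices, edges, cells and joins. Array `0` marks the vertices of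
`V₁`, arrays `1` and `2` hold the ends of the edges, array `3` the cell of each vertex, arrays `4`
and `5` the ends of the joins. Weight register `0` holds `ω_max`, weight array `0` the weights of
the edges. All other memory is zero. -/
def CBMInstance.Listing.initialState {I : CBMInstance} (L : I.Listing) : RAM.State where
  reg r :=
    match r with
    | 0 => I.n
    | 1 => L.edges.length
    | 2 => I.k
    | 3 => L.joins.length
    | _ => 0
  arr A i :=
    match A with
    | 0 => if h : i < I.n then (if (⟨i, h⟩ : Fin I.n) ∈ I.V₁ then 1 else 0) else 0
    | 1 => if h : i < L.edges.length then (L.edges[i].1 : ℕ) else 0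
    | 2 => if h : i < L.edges.length then (L.edges[i].2 : ℕ) else 0
    | 3 => if h : i < I.n then (I.cellOf ⟨i, h⟩ : ℕ) else 0
    | 4 => if h : i < L.joins.length then (L.joins[i].1 : ℕ) else 0
    | 5 => if h : i < L.joins.length then (L.joins[i].2 : ℕ) else 0
    | _ => 0
  wreg r :=
    match r with
    | 0 => (I.ωmax : ℝ≥0∞)
    | _ => 0
  warr A i :=
    match A with
    | 0 => if h : i < L.edges.length then I.ω s(L.edges[i].1, L.edges[i].2) else 0
    | _ => 0

/-- The program `P` decides the instance `I` within `T` steps: on every listing of `I` it halts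
after at most `T` steps, with `1` in register `0` if `I` is a yes-instance and with `0` in register
`0` otherwise. -/
def RAM.Prog.DecidesWithin (P : RAM.Prog) (I : CBMInstance) (T : ℕ) : Prop :=
  ∀ L : I.Listing, ∃ (t : ℕ) (s : RAM.State), RAM.Exec P L.initialState t s ∧ t ≤ T ∧
    (I.IsYes → s.reg 0 = 1) ∧ (¬ I.IsYes → s.reg 0 = 0)

/-! ## A program logic for random access machines -/

/-! Since a vertex u of V₁ has at most two neighbours a u and b u, a perfect matching is an
injective choice of one of them for every u in V₁, together with |V₁| = |V₂|. A partial matching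
determines a map g on V₂ (`step`): from v pass to the other neighbour of the vertex matched to v,
and stay at v if v is unmatched. There is no branching, so an alternating path is forced once its
first edge is chosen.

To match one more vertex u, follow g from a u and from b u. If one of the walks meets an unmatched
vertex, shift the matching along it. Otherwise all points of both walks are matched; if L is the set
of these points, then u and the vertices matched to L are |L| + 1 vertices whose neighbours all lie
in L, so no perfect matching exists (`IsMatching.not_injOn`). A fixed number of steps of g suffices
by the pigeonhole principle.

Relative to one perfect matching, any other is given by the set T of those v whose partner moves to
g v. Injectivity makes T a union of cycles of g, and conversely every union of cycles yields a
perfect matching (`exists_solution_iff`). The cycles are disjoint and are switched independently,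
and points off the cycles never move. This is a knapsack-like problem, solved by a table indexed by
the sets S of joins: the least weight of the edges treated so far that satisfy S. A new component
with weights w₀, w₁ and satisfied joins A₀, A₁ before and after switching replaces the entry at S by
the minimum of dp (S \ A₀) + w₀ and dp (S \ A₁) + w₁ (`IsTable.extend`). The entry for the full set
of joins is finally compared with the maximum weight.

Reading the input and finding a matching take O(n²) steps. There are at most n components, each of
cost O(n + nc + c 2^c). The total lies within the claimed bound, because c 2^c ≤ 2^(c(c+1)) and nc ≤
n² + c² (`CBMProgram.time_le`).

All loops of the program are counted loops. Correctness and running time are therefore proved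
together from an invariant per loop (`Runs.forLoop`), weakest preconditions for loop-free code
(`Runs.of_wp`), and syntactic write sets for everything left unchanged (`Exec.frame`). -/

namespace RAM

/-- Overwrite a register. -/
def State.putReg (s : State) (r a : ℕ) : State :=
  { s with reg := Function.update s.reg r a }

/-- Overwrite a weight register. -/
def State.putWReg (s : State) (r : ℕ) (a : ℝ≥0∞) : State :=
  { s with wreg := Function.update s.wreg r a }

namespace State

variable (s : State) (r r' A B i j a : ℕ) (w : ℝ≥0∞)

@[simp] theorem putReg_reg : (s.putReg r a).reg r' = if r' = r then a else s.reg r' := by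
  simp [putReg, Function.update_apply]
@[simp] theorem putReg_arr : (s.putReg r a).arr = s.arr := rfl
@[simp] theorem putReg_wreg : (s.putReg r a).wreg = s.wreg := rfl
@[simp] theorem putReg_warr : (s.putReg r a).warr = s.warr := rfl
@[simp] theorem putWReg_reg : (s.putWReg r w).reg = s.reg := rfl
@[simp] theorem putWReg_arr : (s.putWReg r w).arr = s.arr := rfl
@[simp] theorem putWReg_wreg : (s.putWReg r w).wreg r' = if r' = r then w else s.wreg r' := by
  simp [putWReg, Function.update_apply]
@[simp] theorem putWReg_warr : (s.putWReg r w).warr = s.warr := rfl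
@[simp] theorem putArr_reg : (s.putArr A i a).reg = s.reg := rfl
@[simp] theorem putArr_arr : (s.putArr A i a).arr B =
    if B = A then Function.update (s.arr A) i a else s.arr B := by
  simp only [putArr, Function.update_apply]
@[simp] theorem putArr_wreg : (s.putArr A i a).wreg = s.wreg := rfl
@[simp] theorem putArr_warr : (s.putArr A i a).warr = s.warr := rfl
@[simp] theorem putWArr_reg : (s.putWArr A i w).reg = s.reg := rfl
@[simp] theorem putWArr_arr : (s.putWArr A i w).arr = s.arr := rfl
@[simp] theorem putWArr_wreg : (s.putWArr A i w).wreg = s.wreg := rfl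
@[simp] theorem putWArr_warr : (s.putWArr A i w).warr B =
    if B = A then Function.update (s.warr A) i w else s.warr B := by
  simp only [putWArr, Function.update_apply]

end State

namespace Prog

/-- The registers that a program may write. -/
def regs : Prog → List ℕ
  | setReg r _ => [r]
  | seq P Q => P.regs ++ Q.regs
  | cond _ P Q => P.regs ++ Q.regs
  | loop _ P => P.regs
  | _ => []

/-- The arrays that a program may write. -/
def arrs : Prog → List ℕ
  | setArr A _ _ => [A]
  | seq P Q => P.arrs ++ Q.arrs
  | cond _ P Q => P.arrs ++ Q.arrs
  | loop _ P => P.arrs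
  | _ => []

/-- The weight registers that a program may write. -/
def wregs : Prog → List ℕ
  | setWReg r _ => [r]
  | seq P Q => P.wregs ++ Q.wregs
  | cond _ P Q => P.wregs ++ Q.wregs
  | loop _ P => P.wregs
  | _ => []

/-- The weight arrays that a program may write. -/
def warrs : Prog → List ℕ
  | setWArr A _ _ => [A]
  | seq P Q => P.warrs ++ Q.warrs
  | cond _ P Q => P.warrs ++ Q.warrs
  | loop _ P => P.warrs
  | _ => []

/-- A bound on the running time of a program without loops. -/
def bound : Prog → ℕ
  | skip => 1
  | setReg _ x => x.cost + 1
  | setArr _ i x => i.cost + x.cost + 1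
  | setWReg _ x => x.cost + 1
  | setWArr _ i x => i.cost + x.cost + 1
  | seq P Q => P.bound + Q.bound
  | cond b P Q => b.cost + max P.bound Q.bound
  | loop _ _ => 0

/-- The weakest precondition of a program without loops. -/
def wp : Prog → (State → Prop) → State → Prop
  | skip, R, s => R s
  | setReg r x, R, s => R (s.putReg r (x.eval s))
  | setArr A i x, R, s => R (s.putArr A (i.eval s) (x.eval s))
  | setWReg r x, R, s => R (s.putWReg r (x.eval s))
  | setWArr A i x, R, s => R (s.putWArr A (i.eval s) (x.eval s))
  | seq P Q, R, s => P.wp (Q.wp R) s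
  | cond b P Q, R, s => (b.Holds s → P.wp R s) ∧ (¬ b.Holds s → Q.wp R s)
  | loop _ _, _, _ => False

/-- `for r < bound` where the bound is held by the register `N`. -/
def forLoop (r N : ℕ) (P : Prog) : Prog :=
  seq (setReg r (.lit 0))
    (loop (.lt (.reg r) (.reg N)) (seq P (setReg r (.add (.reg r) (.lit 1)))))

end Prog

/-- `s'` agrees with `s` except on what `P` may write. -/
structure Frame (P : Prog) (s s' : State) : Prop where
  reg : ∀ r, r ∉ P.regs → s'.reg r = s.reg r
  arr : ∀ A, A ∉ P.arrs → s'.arr A = s.arr A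
  wreg : ∀ r, r ∉ P.wregs → s'.wreg r = s.wreg r
  warr : ∀ A, A ∉ P.warrs → s'.warr A = s.warr A

theorem Frame.refl (P : Prog) (s : State) : Frame P s s :=
  ⟨fun _ _ => rfl, fun _ _ => rfl, fun _ _ => rfl, fun _ _ => rfl⟩

theorem Frame.trans {P : Prog} {s s' s'' : State} (h : Frame P s s') (h' : Frame P s' s'') :
    Frame P s s'' :=
  ⟨fun r hr => (h'.reg r hr).trans (h.reg r hr), fun r hr => (h'.arr r hr).trans (h.arr r hr),
    fun r hr => (h'.wreg r hr).trans (h.wreg r hr), fun r hr => (h'.warr r hr).trans (h.warr r hr)⟩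

theorem Frame.mono {P Q : Prog} {s s' : State} (h : Frame P s s') (h1 : P.regs ⊆ Q.regs)
    (h2 : P.arrs ⊆ Q.arrs) (h3 : P.wregs ⊆ Q.wregs) (h4 : P.warrs ⊆ Q.warrs) : Frame Q s s' :=
  ⟨fun r hr => h.reg r fun h => hr (h1 h), fun r hr => h.arr r fun h => hr (h2 h),
    fun r hr => h.wreg r fun h => hr (h3 h), fun r hr => h.warr r fun h => hr (h4 h)⟩

/-- The write sets are computed from the program text, so for a concrete program `decide` shows
which parts of the memory survive its execution. -/
theorem Exec.frame {P : Prog} {s s' : State} {t : ℕ} (h : Exec P s t s') : Frame P s s' := by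
  induction h with
  | skip s => exact Frame.refl _ _
  | setReg s r x =>
    refine ⟨fun r' hr => ?_, fun _ _ => rfl, fun _ _ => rfl, fun _ _ => rfl⟩
    simp only [Prog.regs, List.mem_singleton] at hr
    simp [hr]
  | setArr s A i x =>
    refine ⟨fun _ _ => rfl, fun B hB => ?_, fun _ _ => rfl, fun _ _ => rfl⟩
    simp only [Prog.arrs, List.mem_singleton] at hB
    simp [hB]
  | setWReg s r x =>
    refine ⟨fun _ _ => rfl, fun _ _ => rfl, fun r' hr => ?_, fun _ _ => rfl⟩
    simp only [Prog.wregs, List.mem_singleton] at hr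
    simp [hr]
  | setWArr s A i x =>
    refine ⟨fun _ _ => rfl, fun _ _ => rfl, fun _ _ => rfl, fun B hB => ?_⟩
    simp only [Prog.warrs, List.mem_singleton] at hB
    simp [hB]
  | seq _ _ h h' =>
    exact (h.mono (by simp [Prog.regs]) (by simp [Prog.arrs]) (by simp [Prog.wregs])
      (by simp [Prog.warrs])).trans (h'.mono (by simp [Prog.regs]) (by simp [Prog.arrs])
      (by simp [Prog.wregs]) (by simp [Prog.warrs]))
  | cond_true _ _ h =>
    exact h.mono (by simp [Prog.regs]) (by simp [Prog.arrs]) (by simp [Prog.wregs])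
      (by simp [Prog.warrs])
  | cond_false _ _ h =>
    exact h.mono (by simp [Prog.regs]) (by simp [Prog.arrs]) (by simp [Prog.wregs])
      (by simp [Prog.warrs])
  | loop_true _ _ _ h h' =>
    exact (h.mono (by simp [Prog.regs]) (by simp [Prog.arrs]) (by simp [Prog.wregs])
      (by simp [Prog.warrs])).trans h'
  | loop_false _ => exact Frame.refl _ _

/-- `Runs P s T R`: started in `s`, the program `P` halts within `T` steps in a state that
satisfies `R`. -/
def Runs (P : Prog) (s : State) (T : ℕ) (R : State → Prop) : Prop :=
  ∃ t s', Exec P s t s' ∧ t ≤ T ∧ R s'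

namespace Runs

variable {P Q : Prog} {s : State} {T T' : ℕ} {R R' : State → Prop}

theorem mono (h : Runs P s T R) (hT : T ≤ T') (hR : ∀ s', Frame P s s' → R s' → R' s') :
    Runs P s T' R' := by
  obtain ⟨t, s', he, ht, hs⟩ := h
  exact ⟨t, s', he, ht.trans hT, hR s' he.frame hs⟩

theorem seq (h : Runs P s T R) (h' : ∀ s', Frame P s s' → R s' → Runs Q s' T' R') :
    Runs (P.seq Q) s (T + T') R' := by
  obtain ⟨t, s', he, ht, hs⟩ := h
  obtain ⟨t', s'', he', ht', hs'⟩ := h' s' he.frame hs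
  exact ⟨t + t', s'', .seq he he', by omega, hs'⟩

theorem of_wp (hP : P.wp R s) : Runs P s P.bound R := by
  induction P generalizing s R with
  | skip => exact ⟨_, _, .skip s, le_rfl, hP⟩
  | setReg r x => exact ⟨_, _, .setReg s r x, le_rfl, hP⟩
  | setArr A i x => exact ⟨_, _, .setArr s A i x, le_rfl, hP⟩
  | setWReg r x => exact ⟨_, _, .setWReg s r x, le_rfl, hP⟩
  | setWArr A i x => exact ⟨_, _, .setWArr s A i x, le_rfl, hP⟩
  | seq P Q ihP ihQ => exact (ihP hP).seq fun s' _ h => ihQ h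
  | cond b P Q ihP ihQ =>
    by_cases hb : b.Holds s
    · obtain ⟨t, s', he, ht, hs⟩ := ihP (hP.1 hb)
      exact ⟨_, s', .cond_true hb he, Nat.add_le_add_left (ht.trans (le_max_left _ _)) _, hs⟩
    · obtain ⟨t, s', he, ht, hs⟩ := ihQ (hP.2 hb)
      exact ⟨_, s', .cond_false hb he, Nat.add_le_add_left (ht.trans (le_max_right _ _)) _, hs⟩
  | loop b P _ => exact hP.elim

theorem cond {b : Test} (hP : b.Holds s → Runs P s T R) (hQ : ¬ b.Holds s → Runs Q s T R) :
    Runs (.cond b P Q) s (b.cost + T) R := by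
  by_cases hb : b.Holds s
  · obtain ⟨t, s', he, ht, hs⟩ := hP hb
    exact ⟨_, s', .cond_true hb he, by omega, hs⟩
  · obtain ⟨t, s', he, ht, hs⟩ := hQ hb
    exact ⟨_, s', .cond_false hb he, by omega, hs⟩

theorem skip (h : R s) (hT : 1 ≤ T) : Runs .skip s T R :=
  ⟨1, s, .skip s, hT, h⟩

/-- The rule for bounded loops: the invariant `Inv k` holds before round `k`. -/
theorem forLoop {r N : ℕ} (hr : r ∉ P.regs) (hN : N ∉ P.regs) (hrN : N ≠ r)
    (Inv : ℕ → State → Prop) (h0 : Inv 0 (s.putReg r 0))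
    (hstep : ∀ k < s.reg N, ∀ s', Frame (.forLoop r N P) s s' → s'.reg r = k → Inv k s' →
      Runs P s' T fun s'' => Inv (k + 1) (s''.putReg r (k + 1))) :
    Runs (.forLoop r N P) s (s.reg N * (T + 7) + 5) (Inv (s.reg N)) := by
  set W : Prog := .forLoop r N P with hW
  have hPW : ∀ {s s'}, Frame P s s' → Frame W s s' := fun h =>
    h.mono (by simp [hW, Prog.forLoop, Prog.regs]) (by simp [hW, Prog.forLoop, Prog.arrs])
      (by simp [hW, Prog.forLoop, Prog.wregs]) (by simp [hW, Prog.forLoop, Prog.warrs])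
  have hrW : ∀ s a, Frame W s (s.putReg r a) := by
    refine fun s a => ⟨fun r' hr' => ?_, fun _ _ => rfl, fun _ _ => rfl, fun _ _ => rfl⟩
    have : r' ≠ r := by
      rintro rfl
      exact hr' (by simp [hW, Prog.forLoop, Prog.regs])
    simp [this]
  have hNW : ∀ {s'}, Frame W s s' → s'.reg N = s.reg N := fun h =>
    h.reg N (by simp [hW, Prog.forLoop, Prog.regs, hrN, hN])
  -- Induction on the number d of rounds left. The overhead 7 per round is the test (3) and the
  -- increment (4); the final 3 is the failing test.
  have main : ∀ d k s', k + d = s.reg N → Frame W s s' → s'.reg r = k → Inv k s' →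
      Runs (.loop (.lt (.reg r) (.reg N)) (.seq P (.setReg r (.add (.reg r) (.lit 1))))) s'
        (d * (T + 7) + 3) (Inv (s.reg N)) := by
    intro d
    induction d with
    | zero =>
      intro k s' hk hF hrk hI
      obtain rfl : k = s.reg N := by omega
      refine ⟨_, s', .loop_false ?_, ?_, hI⟩
      · simp [Test.Holds, NExp.eval, hNW hF, hrk]
      · simp [Test.cost, NExp.cost]
    | succ d ih =>
      intro k s' hk hF hrk hI
      obtain ⟨t, s'', he, ht, hs⟩ := hstep k (by omega) s' hF hrk hI
      have hrk' : s''.reg r = k := by rw [he.frame.reg r hr, hrk]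
      obtain ⟨t', s3, he', ht', hs'⟩ := ih (k + 1) (s''.putReg r (k + 1)) (by omega)
        ((hF.trans (hPW he.frame)).trans (hrW _ _)) (by simp) hs
      have hinc : Exec (.setReg r (.add (.reg r) (.lit 1))) s'' 4 (s''.putReg r (k + 1)) := by
        have := Exec.setReg s'' r (.add (.reg r) (.lit 1))
        rwa [NExp.eval, NExp.eval, NExp.eval, hrk'] at this
      refine ⟨_, s3, .loop_true ?_ (.seq he hinc) he', ?_, hs'⟩
      · simp only [Test.Holds, NExp.eval, hNW hF, hrk]
        omega
      · simp only [Test.cost, NExp.cost]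
        rw [Nat.succ_mul]
        omega
  obtain ⟨t, s', he, ht, hs⟩ := main (s.reg N) 0 (s.putReg r 0) (by omega) (hrW _ _) (by simp) h0
  refine ⟨_, s', .seq (.setReg s r (.lit 0)) he, ?_, hs⟩
  simp only [NExp.cost]
  omega

end Runs

end RAM

/-! ## Matchings in graphs with two candidate partners per vertex

A vertex `u` of the first side has the neighbours `a u` and `b u` (possibly equal). A partial
matching is an array `occ` with `occ v = u + 1` if `v` is matched to `u` and `occ v = 0` if `v` is
unmatched. -/

namespace TwoChoice

/-- From `v` go to the other neighbour of the vertex that is matched to `v`. -/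
def step (a b occ : ℕ → ℕ) (v : ℕ) : ℕ :=
  if occ v = 0 then v else a (occ v - 1) + b (occ v - 1) - v

/-- `occ` is a matching of the vertices in `U`. -/
structure IsMatching (a b occ : ℕ → ℕ) (U : Set ℕ) : Prop where
  mem : ∀ {v u}, occ v = u + 1 → u ∈ U
  adj : ∀ {v u}, occ v = u + 1 → v = a u ∨ v = b u
  inj : ∀ {v v' u}, occ v = u + 1 → occ v' = u + 1 → v = v'
  cover : ∀ {u}, u ∈ U → ∃ v, occ v = u + 1

/-- An orbit in a finite set enters its cycle early, so walking for n steps already sees every point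
that will ever be reached. -/
theorem exists_iterate_eq {V : Finset ℕ} {f : ℕ → ℕ} (hf : ∀ v ∈ V, f v ∈ V) {n : ℕ}
    (hn : V.card ≤ n) {x : ℕ} (hx : x ∈ V) (k : ℕ) : ∃ i ≤ n, f^[k] x = f^[i] x := by
  have hmem : ∀ i, f^[i] x ∈ V := by
    intro i
    induction i with
    | zero => exact hx
    | succ i ih => rw [Function.iterate_succ_apply']; exact hf _ ih
  induction k using Nat.strong_induction_on with
  | _ k ih =>
    by_cases hk : k ≤ n
    · exact ⟨k, hk, rfl⟩
    obtain ⟨i, hi, j, hj, hij, he⟩ := Finset.exists_ne_map_eq_of_card_lt_of_maps_to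
      (s := Finset.range (n + 1)) (t := V) (f := fun i => f^[i] x) (by simp; omega)
      (fun i _ => hmem i)
    simp only [Finset.mem_range] at hi hj
    wlog hlt : i < j generalizing i j
    · exact this j i hij.symm he.symm hj hi (by omega)
    -- Cut out the segment between the equal iterates i < j ≤ n, which shortens the walk.
    obtain ⟨l, hl, h⟩ := ih (k - j + i) (by omega)
    refine ⟨l, hl, ?_⟩
    rw [← h, Function.iterate_add_apply]
    have : k = k - j + j := by omega
    conv_lhs => rw [this, Function.iterate_add_apply]
    exact congrArg _ he.symm

/-! ### Augmenting paths along the forced walk. -/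

section Augment

variable {a b occ : ℕ → ℕ} {U : Set ℕ} {V : Finset ℕ}

theorem step_of_eq_zero {v : ℕ} (h : occ v = 0) : step a b occ v = v := if_pos h

theorem step_of_ne_zero {v : ℕ} (h : occ v ≠ 0) :
    step a b occ v = a (occ v - 1) + b (occ v - 1) - v := if_neg h

/-- The value a u + b u - v is the other neighbour since v is one of the two; it is v itself if both
coincide. -/
theorem IsMatching.step_eq (h : IsMatching a b occ U) {v u : ℕ} (hv : occ v = u + 1) :
    (v = a u ∧ step a b occ v = b u) ∨ (v = b u ∧ step a b occ v = a u) := by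
  rw [step_of_ne_zero (by omega), hv]
  rcases h.adj hv with h | h
  · left; simp [h]
  · right; simp [h]

theorem IsMatching.step_mem (h : IsMatching a b occ U) (haV : ∀ u ∈ U, a u ∈ V ∧ b u ∈ V)
    {v : ℕ} (hv : v ∈ V) : step a b occ v ∈ V := by
  rcases hz : occ v with _ | u
  · rwa [step_of_eq_zero hz]
  · have := haV u (h.mem hz)
    rcases h.step_eq hz with h | h <;> rw [h.2]
    exacts [this.2, this.1]

theorem iterate_step_of_eq_zero {v : ℕ} (h : occ v = 0) (i : ℕ) : (step a b occ)^[i] v = v :=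
  Function.iterate_fixed (step_of_eq_zero h) i

/-- Moving the unmatched vertex `x` to its neighbour `l`, from which the matched vertex is
displaced. -/
theorem IsMatching.displace {x l u : ℕ} (h : IsMatching a b occ (U \ {x})) (hx : x ∈ U)
    (hl : l = a x ∨ l = b x) (hu : occ l = u + 1) :
    IsMatching a b (Function.update occ l (x + 1)) (U \ {u}) ∧ u ∈ U ∧
      (step a b occ l = a u ∨ step a b occ l = b u) := by
  have hux := h.mem hu
  refine ⟨⟨?_, ?_, ?_, ?_⟩, hux.1, ?_⟩
  · intro v w hv
    rw [Function.update_apply] at hv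
    split_ifs at hv with hvl
    · obtain rfl : x = w := by omega
      exact ⟨hx, fun h => hux.2 h.symm⟩
    · refine ⟨(h.mem hv).1, ?_⟩
      rintro rfl
      exact hvl (h.inj hv hu)
  · intro v w hv
    rw [Function.update_apply] at hv
    split_ifs at hv with hvl
    · obtain rfl : x = w := by omega
      rwa [hvl]
    · exact h.adj hv
  · intro v v' w hv hv'
    rw [Function.update_apply] at hv hv'
    split_ifs at hv hv' with h1 h2 h2
    · rw [h1, h2]
    · obtain rfl : x = w := by omega
      exact absurd rfl (h.mem hv').2
    · obtain rfl : x = w := by omega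
      exact absurd rfl (h.mem hv).2
    · exact h.inj hv hv'
  · intro w hw
    by_cases hwx : w = x
    · exact ⟨l, by simp [hwx]⟩
    · obtain ⟨v, hv⟩ := h.cover (u := w) ⟨hw.1, hwx⟩
      refine ⟨v, ?_⟩
      rw [Function.update_of_ne, hv]
      rintro rfl
      exact hw.2 (by simp only [Set.mem_singleton_iff]; omega)
  · rcases h.step_eq hu with h | h
    exacts [Or.inr h.2, Or.inl h.2]

theorem IsMatching.place {x l : ℕ} (h : IsMatching a b occ (U \ {x})) (hx : x ∈ U)
    (hl : l = a x ∨ l = b x) (hu : occ l = 0) :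
    IsMatching a b (Function.update occ l (x + 1)) U := by
  refine ⟨?_, ?_, ?_, ?_⟩
  · intro v w hv
    rw [Function.update_apply] at hv
    split_ifs at hv with hvl
    · obtain rfl : x = w := by omega
      exact hx
    · exact (h.mem hv).1
  · intro v w hv
    rw [Function.update_apply] at hv
    split_ifs at hv with hvl
    · obtain rfl : x = w := by omega
      rwa [hvl]
    · exact h.adj hv
  · intro v v' w hv hv'
    rw [Function.update_apply] at hv hv'
    split_ifs at hv hv' with h1 h2 h2
    · rw [h1, h2]
    · obtain rfl : x = w := by omega
      exact absurd rfl (h.mem hv').2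
    · obtain rfl : x = w := by omega
      exact absurd rfl (h.mem hv).2
    · exact h.inj hv hv'
  · intro w hw
    by_cases hwx : w = x
    · exact ⟨l, by simp [hwx]⟩
    · obtain ⟨v, hv⟩ := h.cover (u := w) ⟨hw, hwx⟩
      refine ⟨v, ?_⟩
      rw [Function.update_of_ne, hv]
      rintro rfl
      omega

/-- After a displacement the walk to an unmatched vertex continues unchanged. -/
theorem iterate_step_update {l m y : ℕ} (hl : occ l ≠ 0)
    (hfree : occ ((step a b occ)^[m + 1] l) = 0) :
    Function.update occ l y ((step a b (Function.update occ l y))^[m] (step a b occ l)) = 0 := by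
  -- The walk cannot return to l: then l would lie on a cycle, while the walk also gets stuck at an
  -- unmatched fixed point. Comparing both at the time (m + 1)(k + 1) makes l unmatched.
  have hne : ∀ k, (step a b occ)^[k] (step a b occ l) ≠ l := by
    intro k hk
    rw [← Function.iterate_succ_apply] at hk
    have h1 : (step a b occ)^[(m + 1) * (k + 1)] l = l := by
      rw [mul_comm, Function.iterate_mul]
      exact Function.iterate_fixed hk _
    have h2 : (step a b occ)^[(m + 1) * (k + 1)] l = (step a b occ)^[m + 1] l := by
      have : (m + 1) * (k + 1) = (m + 1) * k + (m + 1) := by ring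
      rw [this, Function.iterate_add_apply, iterate_step_of_eq_zero hfree]
    rw [← h2, h1] at hfree
    exact hl hfree
  have heq : ∀ k, (step a b (Function.update occ l y))^[k] (step a b occ l) =
      (step a b occ)^[k] (step a b occ l) := by
    intro k
    induction k with
    | zero => rfl
    | succ k ih =>
      rw [Function.iterate_succ_apply', Function.iterate_succ_apply', ih]
      have := hne k
      generalize (step a b occ)^[k] (step a b occ l) = v at this ⊢
      simp only [step, Function.update_of_ne this]
  rw [heq, Function.update_of_ne (hne m), ← Function.iterate_succ_apply]
  exact hfree

/-- If neither walk that starts at a neighbour of `u` reaches an unmatched vertex, then `u` cannot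
be matched in addition. -/
theorem IsMatching.not_injOn {u n : ℕ} (h : IsMatching a b occ U) (hu : u ∉ U)
    (haV : ∀ w ∈ insert u U, a w ∈ V ∧ b w ∈ V) (hn : V.card ≤ n)
    (hfa : occ ((step a b occ)^[n] (a u)) ≠ 0) (hfb : occ ((step a b occ)^[n] (b u)) ≠ 0)
    (x : ℕ → ℕ) (hx : ∀ w ∈ insert u U, x w = a w ∨ x w = b w) :
    ¬ Set.InjOn x (insert u U) := by
  intro hinj
  set f := step a b occ with hf
  have hfV : ∀ v ∈ V, f v ∈ V := fun v hv =>
    h.step_mem (fun w hw => haV w (Set.mem_insert_of_mem _ hw)) hv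
  have hau := haV u (Set.mem_insert _ _)
  -- An unmatched point met at any time is met by time n, and the walk then stays there until time
  -- n.
  have hocc : ∀ v ∈ V, occ (f^[n] v) ≠ 0 → ∀ k, occ (f^[k] v) ≠ 0 := by
    intro v hv hne k hk
    obtain ⟨i, hi, he⟩ := exists_iterate_eq hfV hn hv k
    rw [he] at hk
    apply hne
    have : n = (n - i) + i := by omega
    rw [this, Function.iterate_add_apply, hf, iterate_step_of_eq_zero hk]
    exact hk
  classical
  set L : Finset ℕ := V.filter fun v => ∃ k, v = f^[k] (a u) ∨ v = f^[k] (b u) with hL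
  have hLocc : ∀ v ∈ L, occ v ≠ 0 := by
    intro v hv
    obtain ⟨-, k, rfl | rfl⟩ := Finset.mem_filter.1 hv
    · exact hocc _ hau.1 hfa k
    · exact hocc _ hau.2 hfb k
  have hLf : ∀ v ∈ L, f v ∈ L := by
    intro v hv
    obtain ⟨hvV, k, hk⟩ := Finset.mem_filter.1 hv
    refine Finset.mem_filter.2 ⟨hfV v hvV, k + 1, ?_⟩
    rw [Function.iterate_succ_apply', Function.iterate_succ_apply']
    rcases hk with rfl | rfl <;> simp
  have hocc' : ∀ v ∈ L, occ v = (occ v - 1) + 1 := fun v hv => by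
    have := hLocc v hv
    omega
  -- `K` is the Hall violator: u and the vertices matched to `L`. Their neighbours lie in `L`,
  -- because `L` contains both neighbours of u and is closed under the step map.
  set K : Finset ℕ := insert u (L.image fun v => occ v - 1) with hK
  have hKU : ∀ w ∈ K, w ∈ insert u U := by
    intro w hw
    rcases Finset.mem_insert.1 hw with rfl | hw
    · exact Set.mem_insert _ _
    · obtain ⟨v, hv, rfl⟩ := Finset.mem_image.1 hw
      exact Set.mem_insert_of_mem _ (h.mem (hocc' v hv))
  have hcard : K.card = L.card + 1 := by
    rw [hK, Finset.card_insert_of_notMem, Finset.card_image_of_injOn]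
    · intro v hv w hw hvw
      have h1 := hocc' v hv
      have h2 := hocc' w hw
      simp only at hvw
      rw [← hvw] at h2
      exact h.inj h1 h2
    · intro hmem
      obtain ⟨v, hv, rfl⟩ := Finset.mem_image.1 hmem
      exact hu (h.mem (hocc' v hv))
  have hle : K.card ≤ L.card := by
    refine Finset.card_le_card_of_injOn x ?_ (hinj.mono fun w hw => hKU w hw)
    intro w hw
    have hxw := hx w (hKU w hw)
    rcases Finset.mem_insert.1 hw with rfl | hw
    · rcases hxw with h | h <;> rw [h]
      · exact Finset.mem_filter.2 ⟨hau.1, 0, Or.inl rfl⟩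
      · exact Finset.mem_filter.2 ⟨hau.2, 0, Or.inr rfl⟩
    · obtain ⟨v, hv, rfl⟩ := Finset.mem_image.1 hw
      rcases h.step_eq (hocc' v hv) with h | h <;> rcases hxw with h' | h' <;> rw [h']
      · rw [← h.1]; exact hv
      · rw [← h.2]; exact hLf v hv
      · rw [← h.2]; exact hLf v hv
      · rw [← h.1]; exact hv
  omega

end Augment

end TwoChoice

namespace TwoChoice

/-! ### Switching along cycles

Relative to a perfect matching, every perfect matching arises by moving the partners of the
vertices in a union `T` of cycles of `g` from `v` to `g v`. -/

/-- The new partner of the vertex that was matched to `v`. -/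
def moved (g : ℕ → ℕ) (T : Finset ℕ) (v : ℕ) : ℕ := if v ∈ T then g v else v

/-- `T ⊆ D` is a union of cycles of `g`. -/
structure IsSwitch (g : ℕ → ℕ) (D T : Finset ℕ) : Prop where
  subset : T ⊆ D
  periodic : ∀ v ∈ T, v ∈ Function.periodicPts g
  map : ∀ v ∈ T, g v ∈ T

/-- The switched matching satisfies the joins in `S` (a set given by its binary digits) by edges
at `D`. -/
def Covers (sat : ℕ → ℕ → ℕ → Prop) (g : ℕ → ℕ) (D T : Finset ℕ) (S : ℕ) : Prop :=
  ∀ j, S.testBit j = true → ∃ v ∈ D, sat v (moved g T v) j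

/-- `dp S` is the least weight of a switch on `D` that satisfies the joins in `S`. -/
structure IsTable (g : ℕ → ℕ) (q : ℕ → ℕ → ℝ≥0∞) (sat : ℕ → ℕ → ℕ → Prop) (c : ℕ) (D : Finset ℕ)
    (dp : ℕ → ℝ≥0∞) : Prop where
  le : ∀ S < 2 ^ c, ∀ T, IsSwitch g D T → Covers sat g D T S → dp S ≤ ∑ v ∈ D, q v (moved g T v)
  attained : ∀ S < 2 ^ c, dp S = ∞ ∨
    ∃ T, IsSwitch g D T ∧ Covers sat g D T S ∧ ∑ v ∈ D, q v (moved g T v) = dp S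

/-- `f S` is the set `S` without the elements of `A`. -/
def IsSDiff (c : ℕ) (A : ℕ → Prop) (f : ℕ → ℕ) : Prop :=
  ∀ S < 2 ^ c, f S ≤ S ∧ ∀ j, (f S).testBit j = true ↔ S.testBit j = true ∧ ¬ A j

section Table

variable {g : ℕ → ℕ} {q : ℕ → ℕ → ℝ≥0∞} {sat : ℕ → ℕ → ℕ → Prop} {c : ℕ} {D C T : Finset ℕ}
  {dp dp' : ℕ → ℝ≥0∞}

theorem isTable_empty (h0 : dp 0 = 0) (h : ∀ S < 2 ^ c, S ≠ 0 → dp S = ∞) :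
    IsTable g q sat c ∅ dp := by
  constructor
  · intro S hS T hT hC
    have : S = 0 := by
      by_contra hS0
      obtain ⟨j, hj⟩ := Nat.exists_testBit_of_ne_zero hS0
      obtain ⟨v, hv, -⟩ := hC j hj
      simp at hv
    simp [this, h0]
  · intro S hS
    by_cases hS0 : S = 0
    · refine Or.inr ⟨∅, ⟨le_rfl, by simp, by simp⟩, ?_, by simp [hS0, h0]⟩
      intro j hj
      simp [hS0] at hj
    · exact Or.inl (h S hS hS0)

theorem moved_union_left {T' : Finset ℕ} (hDC : Disjoint D C) (hT' : T' ⊆ C) {v : ℕ} (hv : v ∈ D) :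
    moved g (T ∪ T') v = moved g T v := by
  have : v ∉ T' := fun h => Finset.disjoint_left.1 hDC hv (hT' h)
  simp [moved, this]

theorem moved_of_mem {v : ℕ} (hv : v ∈ T) : moved g T v = g v := if_pos hv

theorem moved_of_notMem {v : ℕ} (hv : v ∉ T) : moved g T v = v := if_neg hv

/-- Extending the table by a component `C` which is a cycle or a point outside all cycles. -/
theorem IsTable.extend (h : IsTable g q sat c D dp) (hDC : Disjoint D C)
    (hD : ∀ v ∈ D, v ∈ Function.periodicPts g → g v ∈ D) {w₀ w₁ : ℝ≥0∞} {f₀ f₁ : ℕ → ℕ}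
    (hw₀ : w₀ = ∑ v ∈ C, q v v)
    (hC : (w₁ = ∑ v ∈ C, q v (g v) ∧ IsSwitch g C C ∧
        ∀ T, IsSwitch g (D ∪ C) T → Disjoint T C ∨ C ⊆ T) ∨
      (w₁ = ∞ ∧ ∀ T, IsSwitch g (D ∪ C) T → Disjoint T C))
    (hf₀ : IsSDiff c (fun j => ∃ v ∈ C, sat v v j) f₀)
    (hf₁ : IsSDiff c (fun j => ∃ v ∈ C, sat v (g v) j) f₁)
    (hdp : ∀ S < 2 ^ c, dp' S = min (dp (f₀ S) + w₀) (dp (f₁ S) + w₁)) :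
    IsTable g q sat c (D ∪ C) dp' := by
  constructor
  · intro S hS T hT hcov
    -- A switch on the union restricts to `D`, since every point of `T` is periodic and `D` is
    -- closed under g at periodic points.
    have hT' : IsSwitch g D (T ∩ D) := by
      refine ⟨Finset.inter_subset_right, fun v hv => hT.periodic v (Finset.mem_inter.1 hv).1, ?_⟩
      intro v hv
      obtain ⟨h1, h2⟩ := Finset.mem_inter.1 hv
      exact Finset.mem_inter.2 ⟨hT.map v h1, hD v h2 (hT.periodic v h1)⟩
    have hm : ∀ v ∈ D, moved g (T ∩ D) v = moved g T v := by
      intro v hv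
      simp [moved, hv]
    -- The map m is the identity if `C` stays and g if `C` is switched. Joins not provided by `C`
    -- have to come from `D`.
    have key : ∀ (f : ℕ → ℕ) (m : ℕ → ℕ) (w : ℝ≥0∞), w = ∑ v ∈ C, q v (m v) →
        IsSDiff c (fun j => ∃ v ∈ C, sat v (m v) j) f → (∀ v ∈ C, moved g T v = m v) →
        dp (f S) + w ≤ ∑ v ∈ D ∪ C, q v (moved g T v) := by
      intro f m w hw hf hm'
      rw [Finset.sum_union hDC, hw]
      refine add_le_add ?_ (le_of_eq (Finset.sum_congr rfl fun v hv => by rw [hm' v hv]))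
      refine (h.le _ ((hf S hS).1.trans_lt hS) _ hT' ?_).trans
        (le_of_eq (Finset.sum_congr rfl fun v hv => by rw [hm v hv]))
      intro j hj
      obtain ⟨h1, h2⟩ := ((hf S hS).2 j).1 hj
      obtain ⟨v, hv, hs⟩ := hcov j h1
      rcases Finset.mem_union.1 hv with hv | hv
      · exact ⟨v, hv, by rwa [hm v hv]⟩
      · exact absurd ⟨v, hv, by rwa [← hm' v hv]⟩ h2
    have key₀ : Disjoint T C → dp' S ≤ ∑ v ∈ D ∪ C, q v (moved g T v) := by
      intro hTC
      rw [hdp S hS]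
      exact (min_le_left _ _).trans (key f₀ id w₀ hw₀ hf₀ fun v hv =>
        moved_of_notMem fun h => Finset.disjoint_left.1 hTC h hv)
    rcases hC with ⟨hw₁, -, hC⟩ | ⟨-, hC⟩
    · rcases hC T hT with hTC | hTC
      · exact key₀ hTC
      · rw [hdp S hS]
        exact (min_le_right _ _).trans (key f₁ g w₁ hw₁ hf₁ fun v hv => moved_of_mem (hTC hv))
    · exact key₀ (hC T hT)
  · intro S hS
    -- Conversely, glue an optimal switch on `D` to the choice `T'` on `C`, which is empty or all of
    -- `C`.
    have key : ∀ (f : ℕ → ℕ) (m : ℕ → ℕ) (w : ℝ≥0∞) (T' : Finset ℕ), w = ∑ v ∈ C, q v (m v) →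
        IsSDiff c (fun j => ∃ v ∈ C, sat v (m v) j) f → IsSwitch g C T' →
        (∀ v ∈ C, moved g T' v = m v) → dp' S = dp (f S) + w →
        dp' S = ∞ ∨ ∃ T, IsSwitch g (D ∪ C) T ∧ Covers sat g (D ∪ C) T S ∧
          ∑ v ∈ D ∪ C, q v (moved g T v) = dp' S := by
      intro f m w T' hw hf hT' hm hd
      rcases h.attained (f S) ((hf S hS).1.trans_lt hS) with hi | ⟨T, hT, hcov, hsum⟩
      · left
        rw [hd, hi, top_add]
      right
      have hm₁ : ∀ v ∈ D, moved g (T ∪ T') v = moved g T v := fun v hv =>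
        moved_union_left hDC hT'.subset hv
      have hm₂ : ∀ v ∈ C, moved g (T ∪ T') v = m v := fun v hv => by
        rw [Finset.union_comm, moved_union_left hDC.symm hT.subset hv, hm v hv]
      refine ⟨T ∪ T', ⟨Finset.union_subset_union hT.subset hT'.subset, ?_, ?_⟩, ?_, ?_⟩
      · intro v hv
        rcases Finset.mem_union.1 hv with hv | hv
        exacts [hT.periodic v hv, hT'.periodic v hv]
      · intro v hv
        rcases Finset.mem_union.1 hv with hv | hv
        exacts [Finset.mem_union_left _ (hT.map v hv), Finset.mem_union_right _ (hT'.map v hv)]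
      · intro j hj
        by_cases hA : ∃ v ∈ C, sat v (m v) j
        · obtain ⟨v, hv, hs⟩ := hA
          exact ⟨v, Finset.mem_union_right _ hv, by rwa [hm₂ v hv]⟩
        · obtain ⟨v, hv, hs⟩ := hcov j (((hf S hS).2 j).2 ⟨hj, hA⟩)
          exact ⟨v, Finset.mem_union_left _ hv, by rwa [hm₁ v hv]⟩
      · rw [Finset.sum_union hDC, hd, hw, ← hsum]
        exact congrArg₂ _ (Finset.sum_congr rfl fun v hv => by rw [hm₁ v hv])
          (Finset.sum_congr rfl fun v hv => by rw [hm₂ v hv])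
    rcases min_choice (dp (f₀ S) + w₀) (dp (f₁ S) + w₁) with hmin | hmin
    · exact key f₀ id w₀ ∅ hw₀ hf₀ ⟨by simp, by simp, by simp⟩
        (fun v _ => moved_of_notMem (by simp)) ((hdp S hS).trans hmin)
    · rcases hC with ⟨hw₁, hCC, -⟩ | ⟨hw₁, -⟩
      · exact key f₁ g w₁ C hw₁ hf₁ hCC (fun v hv => moved_of_mem hv) ((hdp S hS).trans hmin)
      · left
        rw [hdp S hS, hmin, hw₁, add_top]

/-! ### Cycles of the step map as components. -/

/-- The first `p` points of the orbit of `v`. -/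
def orbit (g : ℕ → ℕ) (v p : ℕ) : Finset ℕ := (Finset.range p).image fun i => g^[i] v

theorem orbit_one (v : ℕ) : orbit g v 1 = {v} := by simp [orbit]

theorem mem_orbit {v p x : ℕ} : x ∈ orbit g v p ↔ ∃ i < p, g^[i] v = x := by simp [orbit]

theorem isSwitch_cycle {v : ℕ} (hv : v ∈ Function.periodicPts g) :
    IsSwitch g (orbit g v (Function.minimalPeriod g v))
      (orbit g v (Function.minimalPeriod g v)) := by
  have hp := Function.minimalPeriod_pos_of_mem_periodicPts hv
  refine ⟨le_rfl, ?_, ?_⟩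
  · intro x hx
    obtain ⟨i, -, rfl⟩ := mem_orbit.1 hx
    refine ⟨_, hp, ?_⟩
    exact (Function.isPeriodicPt_minimalPeriod g v).apply_iterate i
  · intro x hx
    obtain ⟨i, -, rfl⟩ := mem_orbit.1 hx
    refine mem_orbit.2 ⟨(i + 1) % Function.minimalPeriod g v, Nat.mod_lt _ hp, ?_⟩
    rw [Function.iterate_mod_minimalPeriod_eq, Function.iterate_succ_apply']

/-- A set closed under g that contains one point of a cycle contains the whole cycle, so each cycle
is a single binary decision. -/
theorem IsSwitch.cycle_subset {v : ℕ} {E : Finset ℕ}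
    (hT : IsSwitch g E T) : Disjoint T (orbit g v (Function.minimalPeriod g v)) ∨
      orbit g v (Function.minimalPeriod g v) ⊆ T := by
  by_cases hdis : Disjoint T (orbit g v (Function.minimalPeriod g v))
  · exact Or.inl hdis
  obtain ⟨x, hxT, hx⟩ := Finset.not_disjoint_iff.1 hdis
  obtain ⟨i, hi, rfl⟩ := mem_orbit.1 hx
  right
  intro y hy
  obtain ⟨k, -, rfl⟩ := mem_orbit.1 hy
  have hit : ∀ m, g^[m] (g^[i] v) ∈ T := by
    intro m
    induction m with
    | zero => exact hxT
    | succ m ih => rw [Function.iterate_succ_apply']; exact hT.map _ ih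
  -- From the i-th point complete the period to return to v, then go k steps further.
  have := hit (k + (Function.minimalPeriod g v - i))
  rw [← Function.iterate_add_apply] at this
  have he : k + (Function.minimalPeriod g v - i) + i = k + Function.minimalPeriod g v := by omega
  rwa [he, Function.iterate_add_apply, Function.iterate_minimalPeriod] at this

/-- If `D` met the cycle, following g around it inside `D` would lead to v. Closure at periodic
points is enough, and that is all that holds once `D` contains points off the cycles. -/
theorem disjoint_cycle {v : ℕ} (hv : v ∈ Function.periodicPts g)
    (hD : ∀ v ∈ D, v ∈ Function.periodicPts g → g v ∈ D) (hvD : v ∉ D) :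
    Disjoint D (orbit g v (Function.minimalPeriod g v)) := by
  rw [Finset.disjoint_right]
  intro x hx hxD
  obtain ⟨i, hi, rfl⟩ := mem_orbit.1 hx
  have hit : ∀ m, g^[m] (g^[i] v) ∈ D ∧ g^[m] (g^[i] v) ∈ Function.periodicPts g := by
    intro m
    induction m with
    | zero => exact ⟨hxD, (isSwitch_cycle hv).periodic _ hx⟩
    | succ m ih =>
      rw [Function.iterate_succ_apply']
      refine ⟨hD _ ih.1 ih.2, ?_⟩
      obtain ⟨n, hn, hp⟩ := ih.2
      exact ⟨n, hn, hp.apply⟩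
  have := (hit (Function.minimalPeriod g v - i)).1
  rw [← Function.iterate_add_apply, Nat.sub_add_cancel hi.le, Function.iterate_minimalPeriod] at this
  exact hvD this

/-- For these p the listed orbit points are distinct, so weights accumulated along the walk count
every vertex once. -/
theorem sum_orbit {v p : ℕ} (hp : p = 1 ∨ p = Function.minimalPeriod g v) (F : ℕ → ℝ≥0∞) :
    ∑ x ∈ orbit g v p, F x = ∑ i ∈ Finset.range p, F (g^[i] v) := by
  refine Finset.sum_image ?_
  intro i hi j hj h
  simp only [Finset.coe_range, Set.mem_Iio] at hi hj
  rcases hp with rfl | rfl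
  · omega
  · exact Function.iterate_injOn_Iio_minimalPeriod hi hj h

theorem minimalPeriod_le_card {V : Finset ℕ} (hg : ∀ v ∈ V, g v ∈ V) {v : ℕ} (hv : v ∈ V) :
    Function.minimalPeriod g v ≤ V.card := by
  have := Finset.card_le_card_of_injOn (s := Finset.range (Function.minimalPeriod g v)) (t := V)
    (fun i => g^[i] v) ?_ ?_
  · simpa using this
  · intro i _
    induction i with
    | zero => exact hv
    | succ i ih =>
      simp only [Function.iterate_succ_apply']
      exact hg _ (ih (by simp_all; omega))
  · intro i hi j hj h
    simp only [Finset.coe_range, Set.mem_Iio] at hi hj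
    exact Function.iterate_injOn_Iio_minimalPeriod hi hj h

end Table

/-! ### Perfect matchings correspond to unions of cycles. -/

section Solutions

variable {a b occ : ℕ → ℕ} {V₁ V₂ : Finset ℕ}

/-- The matching is an injection between finite sets of equal size, hence onto. -/
theorem IsMatching.occ_ne_zero (h : IsMatching a b occ V₁) (hV : ∀ u ∈ V₁, a u ∈ V₂ ∧ b u ∈ V₂)
    (hcard : V₁.card = V₂.card) {v : ℕ} (hv : v ∈ V₂) : occ v ≠ 0 := by
  have hcov : ∀ u, ∃ v, u ∈ V₁ → occ v = u + 1 := by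
    intro u
    by_cases hu : u ∈ V₁
    · obtain ⟨v, hv⟩ := h.cover hu
      exact ⟨v, fun _ => hv⟩
    · exact ⟨0, fun h => absurd h hu⟩
  choose p hp using hcov
  have hpm : ∀ u ∈ V₁, p u ∈ V₂ := fun u hu => by
    rcases h.adj (hp u hu) with h | h <;> rw [h]
    exacts [(hV u hu).1, (hV u hu).2]
  obtain ⟨u, hu, rfl⟩ := Finset.surj_on_of_inj_on_of_card_le (s := V₁) (t := V₂)
    (fun u _ => p u) hpm (fun u u' hu hu' he => by
      have h1 := hp u hu
      have h2 := hp u' hu'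
      rw [he] at h1
      omega) hcard.ge v hv
  rw [hp u hu]
  omega

/-- The vertices of V₁ are indexed by their partners in V₂ under `occ`; a choice x then either keeps
v or replaces it by the image of v under the step map. The number 2^c - 1 has the binary digits of
the set of all joins. -/
theorem exists_solution_iff (h : IsMatching a b occ V₁) (hV : ∀ u ∈ V₁, a u ∈ V₂ ∧ b u ∈ V₂)
    (hcard : V₁.card = V₂.card) (wt : ℕ → ℕ → ℝ≥0∞) (sat : ℕ → ℕ → ℕ → Prop) (c : ℕ) (y : ℝ≥0∞) :
    (∃ x : ℕ → ℕ, (∀ u ∈ V₁, x u = a u ∨ x u = b u) ∧ Set.InjOn x V₁ ∧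
      (∀ j < c, ∃ u ∈ V₁, sat u (x u) j) ∧ ∑ u ∈ V₁, wt u (x u) ≤ y) ↔
    ∃ T, IsSwitch (step a b occ) V₂ T ∧
      Covers (fun v => sat (occ v - 1)) (step a b occ) V₂ T (2 ^ c - 1) ∧
      ∑ v ∈ V₂, wt (occ v - 1) (moved (step a b occ) T v) ≤ y := by
  set g := step a b occ with hg
  have hocc : ∀ v ∈ V₂, occ v = (occ v - 1) + 1 := fun v hv => by
    have := h.occ_ne_zero hV hcard hv
    omega
  have hmem : ∀ v ∈ V₂, occ v - 1 ∈ V₁ := fun v hv => h.mem (hocc v hv)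
  have hinj : ∀ v ∈ V₂, ∀ w ∈ V₂, occ v - 1 = occ w - 1 → v = w := fun v hv w hw he =>
    h.inj (hocc v hv) (by rw [he]; exact hocc w hw)
  have hsurj : ∀ u ∈ V₁, ∃ v ∈ V₂, occ v - 1 = u := by
    intro u hu
    obtain ⟨v, hv⟩ := h.cover hu
    refine ⟨v, ?_, by omega⟩
    rcases h.adj hv with rfl | rfl
    exacts [(hV u hu).1, (hV u hu).2]
  have hgV : ∀ v ∈ V₂, g v ∈ V₂ := fun v hv => h.step_mem hV hv
  have transfer : ∀ (x m : ℕ → ℕ), (∀ v ∈ V₂, x (occ v - 1) = m v) →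
      ((∀ j < c, ∃ u ∈ V₁, sat u (x u) j) ↔
        ∀ j, (2 ^ c - 1).testBit j = true → ∃ v ∈ V₂, sat (occ v - 1) (m v) j) ∧
      ∑ u ∈ V₁, wt u (x u) = ∑ v ∈ V₂, wt (occ v - 1) (m v) := by
    intro x m hxm
    refine ⟨?_, ?_⟩
    · simp only [Nat.testBit_two_pow_sub_one, decide_eq_true_eq]
      refine forall₂_congr fun j _ => ⟨?_, ?_⟩
      · rintro ⟨u, hu, hs⟩
        obtain ⟨v, hv, rfl⟩ := hsurj u hu
        exact ⟨v, hv, by rwa [← hxm v hv]⟩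
      · rintro ⟨v, hv, hs⟩
        exact ⟨_, hmem v hv, by rwa [hxm v hv]⟩
    · symm
      refine Finset.sum_bij (fun v _ => occ v - 1) hmem (fun v hv w hw => hinj v hv w hw) ?_ ?_
      · intro u hu
        obtain ⟨v, hv, rfl⟩ := hsurj u hu
        exact ⟨v, hv, rfl⟩
      · intro v hv
        rw [hxm v hv]
  constructor
  · rintro ⟨x, hx, hxinj, hcov, hsum⟩
    -- The set of those v whose partner changes its mate.
    set T := V₂.filter fun v => x (occ v - 1) ≠ v with hT
    have hxm : ∀ v ∈ V₂, x (occ v - 1) = moved g T v := by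
      intro v hv
      by_cases hvT : v ∈ T
      · rw [moved_of_mem hvT]
        have hne := (Finset.mem_filter.1 hvT).2
        rcases h.step_eq (hocc v hv) with h | h <;>
          rcases hx _ (hmem v hv) with h' | h' <;> rw [hg]
        · exact absurd (h'.trans h.1.symm) hne
        · rw [h.2, h']
        · rw [h.2, h']
        · exact absurd (h'.trans h.1.symm) hne
      · rw [moved_of_notMem hvT]
        by_contra hne
        exact hvT (Finset.mem_filter.2 ⟨hv, hne⟩)
    have hminj : ∀ v ∈ V₂, ∀ w ∈ V₂, moved g T v = moved g T w → v = w := by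
      intro v hv w hw he
      rw [← hxm v hv, ← hxm w hw] at he
      exact hinj v hv w hw (hxinj (hmem v hv) (hmem w hw) he)
    have hTV : T ⊆ V₂ := Finset.filter_subset _ _
    -- If g v did not move, it would be used twice: by its old partner and by the vertex that leaves
    -- v.
    have hmap : ∀ v ∈ T, g v ∈ T := by
      intro v hv
      by_contra hgv
      have h1 := hminj v (hTV hv) (g v) (hgV v (hTV hv))
        (by rw [moved_of_mem hv, moved_of_notMem hgv])
      rw [← h1] at hgv
      exact hgv hv
    refine ⟨T, ⟨hTV, ?_, hmap⟩, ((transfer x _ hxm).1).1 hcov, ((transfer x _ hxm).2 ▸ hsum)⟩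
    intro v hv
    have hgT : Set.InjOn g T := fun v hv w hw he =>
      hminj v (hTV hv) w (hTV hw) (by rw [moved_of_mem hv, moved_of_mem hw, he])
    have hit : ∀ i, g^[i] v ∈ T := by
      intro i
      induction i with
      | zero => exact hv
      | succ i ih => rw [Function.iterate_succ_apply']; exact hmap _ ih
    obtain ⟨i, hi, j, hj, hij, he⟩ := Finset.exists_ne_map_eq_of_card_lt_of_maps_to
      (s := Finset.range (T.card + 1)) (t := T) (f := fun i => g^[i] v) (by simp)
      (fun i _ => hit i)
    -- On `T` the map g is injective, so a coincidence of two iterates can be pulled back to the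
    -- start of the orbit.
    have cancel : ∀ i j, i < j → g^[i] v = g^[j] v → v ∈ Function.periodicPts g := by
      intro i
      induction i with
      | zero => exact fun j hj he => ⟨j, hj, he.symm⟩
      | succ i ih =>
        intro j hj he
        obtain ⟨j, rfl⟩ : ∃ k, j = k + 1 := ⟨j - 1, by omega⟩
        rw [Function.iterate_succ_apply', Function.iterate_succ_apply'] at he
        exact ih j (by omega) (hgT (hit _) (hit _) he)
    rcases lt_or_gt_of_ne hij with hlt | hlt
    exacts [cancel i j hlt he, cancel j i hlt he.symm]
  · rintro ⟨T, hT, hcov, hsum⟩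
    have : ∀ u, ∃ v, u ∈ V₁ → v ∈ V₂ ∧ occ v - 1 = u := by
      intro u
      by_cases hu : u ∈ V₁
      · obtain ⟨v, hv⟩ := hsurj u hu
        exact ⟨v, fun _ => hv⟩
      · exact ⟨0, fun h => absurd h hu⟩
    choose p hp using this
    have hpo : ∀ v ∈ V₂, p (occ v - 1) = v := fun v hv =>
      hinj _ (hp _ (hmem v hv)).1 v hv (hp _ (hmem v hv)).2
    have hxm : ∀ v ∈ V₂, moved g T (p (occ v - 1)) = moved g T v := fun v hv => by rw [hpo v hv]
    refine ⟨fun u => moved g T (p u), ?_, ?_,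
      ((transfer (fun u => moved g T (p u)) _ hxm).1).2 hcov,
      ((transfer (fun u => moved g T (p u)) _ hxm).2.trans_le hsum)⟩
    · intro u hu
      obtain ⟨v, hv, rfl⟩ := hsurj u hu
      simp only [hpo v hv, moved]
      rcases h.step_eq (hocc v hv) with h | h <;> split_ifs
      exacts [Or.inr h.2, Or.inl h.1, Or.inl h.2, Or.inr h.1]
    · intro u hu u' hu' he
      obtain ⟨v, hv, rfl⟩ := hsurj u hu
      obtain ⟨w, hw, rfl⟩ := hsurj u' hu'
      simp only [hpo v hv, hpo w hw, moved] at he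
      congr 2
      -- Two periodic points have the common period mk; applying g another mk - 1 times recovers
      -- them from their equal images.
      have hper : ∀ v ∈ T, ∀ w ∈ T, g v = g w → v = w := by
        intro v hv w hw he
        obtain ⟨m, hm, hvm⟩ := hT.periodic v hv
        obtain ⟨k, hk, hwk⟩ := hT.periodic w hw
        have h1 : g^[m * k] v = v := (hvm.mul_const k)
        have h2 : g^[m * k] w = w := (hwk.const_mul m)
        obtain ⟨l, hl⟩ : ∃ l, m * k = l + 1 :=
          ⟨m * k - 1, by have := Nat.mul_pos hm hk; omega⟩
        rw [hl, Function.iterate_succ_apply] at h1 h2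
        rw [← h1, ← h2, he]
      split_ifs at he with h1 h2 h2
      · exact hper v h1 w h2 he
      · exact absurd (he ▸ hT.map v h1) h2
      · exact absurd (he ▸ hT.map w h2) h1
      · exact he

/-- The bound has to be finite because an infinite table entry need not come from a switch. -/
theorem IsTable.le_iff {g : ℕ → ℕ} {q : ℕ → ℕ → ℝ≥0∞} {sat : ℕ → ℕ → ℕ → Prop} {c : ℕ}
    {D : Finset ℕ} {dp : ℕ → ℝ≥0∞} (h : IsTable g q sat c D dp) {S : ℕ} (hS : S < 2 ^ c)
    {y : ℝ≥0∞} (hy : y ≠ ∞) : dp S ≤ y ↔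
      ∃ T, IsSwitch g D T ∧ Covers sat g D T S ∧ ∑ v ∈ D, q v (moved g T v) ≤ y := by
  constructor
  · intro hle
    rcases h.attained S hS with hi | ⟨T, hT, hc, he⟩
    · rw [hi, top_le_iff] at hle
      exact absurd hle hy
    · exact ⟨T, hT, hc, he.trans_le hle⟩
  · rintro ⟨T, hT, hc, hle⟩
    exact (h.le S hS T hT hc).trans hle

end Solutions

end TwoChoice

theorem RAM.Runs.of_wp_le {P : RAM.Prog} {s : RAM.State} {T : ℕ} {R : RAM.State → Prop}
    (hT : P.bound ≤ T) (h : P.wp R s) : RAM.Runs P s T R :=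
  (RAM.Runs.of_wp h).mono hT fun _ _ h => h

/-! ## The program

Besides the input, the memory is used as follows.

* Registers `4`, `5`, `6` are loop counters, `7` holds `2 ^ c` for the number `c` of joins, `8` tells
  whether a perfect matching is still possible, `9` and `10` hold a vertex of the first and of the
  second side, `12` and `13` the size of a component and whether it is a cycle; `11`, `14`, `15` are
  auxiliary.
* Array `6` marks the vertices of the first side with a neighbour, `7` and `8` hold the neighbours,
  `9` is the matching, `10` marks the processed vertices of the second side, `11` and `12` flag the
  joins that a component satisfies before and after switching, `13` and `14` tabulate the removal of
  these joins from a set of joins.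
* Weight registers `1` and `2` hold the weight of a component before and after switching, weight
  arrays `1` and `2` the weights of the edges to the neighbours, and weight array `3` the table of
  least weights.
-/

namespace CBMProgram

open RAM TwoChoice

/-- The vertex matched to the vertex in register `10`. -/
def owner : NExp := .sub (.arr 9 (.reg 10)) (.lit 1)

/-- Its other neighbour. -/
def other : NExp := .sub (.add (.arr 7 owner) (.arr 8 owner)) (.reg 10)

/-- Walk from the vertex in register `10` to an unmatched vertex. -/
def walk : Prog := .forLoop 5 0 (.cond (.eq (.arr 9 (.reg 10)) (.lit 0)) .skip (.setReg 10 other))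

/-- Insert the vertex in register `9` at its neighbour in register `10`, and displace the vertices
on the way to an unmatched vertex. -/
def displaceAll : Prog :=
  .seq (.forLoop 5 0 (.cond (.eq (.arr 9 (.reg 10)) (.lit 0)) .skip
    (.seq (.setReg 11 owner) (.seq (.setArr 9 (.reg 10) (.add (.reg 9) (.lit 1)))
      (.seq (.setReg 9 (.reg 11))
        (.setReg 10 (.sub (.add (.arr 7 (.reg 9)) (.arr 8 (.reg 9))) (.reg 10))))))))
    (.setArr 9 (.reg 10) (.add (.reg 9) (.lit 1)))

/-- Match the vertex in register `4` in addition, or set register `8` to `0`. -/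
def augment : Prog :=
  .seq (.seq (.setReg 15 (.arr 7 (.reg 4))) (.setReg 10 (.reg 15)))
    (.seq walk
      (.seq (.seq (.cond (.eq (.arr 9 (.reg 10)) (.lit 0)) .skip (.setReg 15 (.arr 8 (.reg 4))))
          (.setReg 10 (.reg 15)))
        (.seq walk
          (.cond (.eq (.arr 9 (.reg 10)) (.lit 0))
            (.seq (.seq (.setReg 9 (.reg 4)) (.setReg 10 (.reg 15))) displaceAll)
            (.setReg 8 (.lit 0))))))

/-- Match all vertices of the first side, or set register `8` to `0`. -/
def augmentAll : Prog :=
  .forLoop 4 0 (.cond (.eq (.reg 8) (.lit 1))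
    (.cond (.eq (.arr 0 (.reg 4)) (.lit 1))
      (.cond (.eq (.arr 6 (.reg 4)) (.lit 1)) augment (.setReg 8 (.lit 0))) .skip) .skip)

theorem runs_walk (s : State) : Runs walk s (s.reg 0 * 50 + 5) fun s' =>
    s'.reg 10 = (step (s.arr 7) (s.arr 8) (s.arr 9))^[s.reg 0] (s.reg 10) := by
  refine (Runs.forLoop (T := 43) (by decide) (by decide) (by decide) (fun k s' =>
    s'.reg 10 = (step (s.arr 7) (s.arr 8) (s.arr 9))^[k] (s.reg 10)) (by simp) ?_).mono le_rfl
    fun _ _ h => h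
  intro k _ s' hF _ hI
  have h7 := hF.arr 7 (by decide)
  have h8 := hF.arr 8 (by decide)
  have h9 := hF.arr 9 (by decide)
  refine Runs.of_wp_le (by decide) ⟨fun h => ?_, fun h => ?_⟩
  · simp only [Test.Holds, NExp.eval, h9] at h
    simp [Prog.wp, Function.iterate_succ_apply', ← hI, step_of_eq_zero h]
  · simp only [Test.Holds, NExp.eval, h9] at h
    simp [Prog.wp, Function.iterate_succ_apply', ← hI, step_of_ne_zero h, other, owner, NExp.eval,
      h7, h8, h9]

theorem runs_displaceAll {s : State} {U : Set ℕ}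
    (hM : IsMatching (s.arr 7) (s.arr 8) (s.arr 9) (U \ {s.reg 9})) (hU : s.reg 9 ∈ U)
    (hl : s.reg 10 = s.arr 7 (s.reg 9) ∨ s.reg 10 = s.arr 8 (s.reg 9))
    (hfree : s.arr 9 ((step (s.arr 7) (s.arr 8) (s.arr 9))^[s.reg 0] (s.reg 10)) = 0) :
    Runs displaceAll s (s.reg 0 * 50 + 15) fun s' =>
      IsMatching (s.arr 7) (s.arr 8) (s'.arr 9) U := by
  -- Invariant: register 9 holds the only unmatched vertex of `U`, register 10 the neighbour it is
  -- to take, and from there an unmatched vertex is reached in the remaining `s.reg 0 - k` rounds.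
  -- Once register 10 is unmatched the loop idles.
  refine ((Runs.forLoop (T := 43) (by decide) (by decide) (by decide) (fun k s' =>
    IsMatching (s.arr 7) (s.arr 8) (s'.arr 9) (U \ {s'.reg 9}) ∧ s'.reg 9 ∈ U ∧
    (s'.reg 10 = s.arr 7 (s'.reg 9) ∨ s'.reg 10 = s.arr 8 (s'.reg 9)) ∧
    s'.arr 9 ((step (s.arr 7) (s.arr 8) (s'.arr 9))^[s.reg 0 - k] (s'.reg 10)) = 0)
    (by simpa using ⟨hM, hU, hl, hfree⟩) ?_).seq (T' := 10) ?_).mono (by omega) fun _ _ h => h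
  · rintro k hk s' hF _ ⟨hM, hU, hl, hfree⟩
    have h7 := hF.arr 7 (by decide)
    have h8 := hF.arr 8 (by decide)
    obtain ⟨d, hd⟩ : ∃ d, s.reg 0 - k = d + 1 := ⟨s.reg 0 - k - 1, by omega⟩
    have hd' : s.reg 0 - (k + 1) = d := by omega
    rw [hd] at hfree
    refine Runs.of_wp_le (by decide) ⟨fun h => ?_, fun h => ?_⟩
    · simp only [Test.Holds, NExp.eval] at h
      rw [iterate_step_of_eq_zero h] at hfree
      simp only [Prog.wp, State.putReg_arr, State.putReg_reg]
      exact ⟨hM, hU, hl, by simpa [iterate_step_of_eq_zero h] using h⟩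
    · simp only [Test.Holds, NExp.eval] at h
      have hoc : s'.arr 9 (s'.reg 10) = (s'.arr 9 (s'.reg 10) - 1) + 1 := by omega
      have h1 := hM.displace hU hl hoc
      have h2 := iterate_step_update (y := s'.reg 9 + 1) h hfree
      rw [step_of_ne_zero h] at h1 h2
      simpa [Prog.wp, NExp.eval, owner, h7, h8, hd', and_assoc] using And.intro h1 h2
  · rintro s' hF ⟨hM, hU, hl, hfree⟩
    refine Runs.of_wp_le (by decide) ?_
    simp only [Nat.sub_self, Function.iterate_zero, id_eq] at hfree
    simpa [Prog.wp, NExp.eval] using hM.place hU hl hfree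

theorem runs_augment {s : State} {U : Set ℕ} {V : Finset ℕ}
    (hM : IsMatching (s.arr 7) (s.arr 8) (s.arr 9) U) (hU : s.reg 4 ∉ U)
    (hV : ∀ w ∈ insert (s.reg 4) U, s.arr 7 w ∈ V ∧ s.arr 8 w ∈ V) (hn : V.card ≤ s.reg 0)
    (hok : s.reg 8 = 1) :
    Runs augment s (s.reg 0 * 150 + 100) fun s' =>
      (s'.reg 8 = 1 ∧ IsMatching (s.arr 7) (s.arr 8) (s'.arr 9) (insert (s.reg 4) U)) ∨
      (s'.reg 8 = 0 ∧ ∀ x : ℕ → ℕ,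
        (∀ w ∈ insert (s.reg 4) U, x w = s.arr 7 w ∨ x w = s.arr 8 w) →
        ¬ Set.InjOn x (insert (s.reg 4) U)) := by
  set a := s.arr 7 with ha
  set b := s.arr 8 with hb
  set occ := s.arr 9 with hocc
  set u := s.reg 4 with hu
  set n := s.reg 0 with hn'
  refine (Runs.seq (T := 5) (T' := (n * 50 + 5) + (14 + ((n * 50 + 5) + (n * 50 + 30))))
    (R := fun s' => s'.reg 15 = a u ∧ s'.reg 10 = a u)
    (Runs.of_wp_le (by decide) (by simp [Prog.wp, NExp.eval, ha, hu])) ?_).mono (by omega)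
    fun _ _ h => h
  rintro s₁ hF₁ ⟨h15, h10⟩
  have h7 : s₁.arr 7 = a := hF₁.arr 7 (by decide)
  have h8 : s₁.arr 8 = b := hF₁.arr 8 (by decide)
  have h9 : s₁.arr 9 = occ := hF₁.arr 9 (by decide)
  have h0 : s₁.reg 0 = n := hF₁.reg 0 (by decide)
  have h4 : s₁.reg 4 = u := hF₁.reg 4 (by decide)
  have hr8 : s₁.reg 8 = 1 := (hF₁.reg 8 (by decide)).trans hok
  have hw := runs_walk s₁
  rw [h0] at hw
  refine Runs.seq hw ?_
  intro s₂ hF₂ hs₂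
  have k7 : s₂.arr 7 = a := (hF₂.arr 7 (by decide)).trans h7
  have k8 : s₂.arr 8 = b := (hF₂.arr 8 (by decide)).trans h8
  have k9 : s₂.arr 9 = occ := (hF₂.arr 9 (by decide)).trans h9
  have k0 : s₂.reg 0 = n := (hF₂.reg 0 (by decide)).trans h0
  have k4 : s₂.reg 4 = u := (hF₂.reg 4 (by decide)).trans h4
  have k15 : s₂.reg 15 = a u := (hF₂.reg 15 (by decide)).trans h15
  have kr8 : s₂.reg 8 = 1 := (hF₂.reg 8 (by decide)).trans hr8
  rw [h7, h8, h9, h10] at hs₂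
  -- Register 15 is changed to b u only if the walk from a u has failed. Hence a failure of the
  -- second walk means that both neighbours fail.
  refine Runs.seq (R := fun s' => s'.reg 10 = s'.reg 15 ∧ (s'.reg 15 = a u ∨ s'.reg 15 = b u) ∧
    (occ ((step a b occ)^[n] (s'.reg 15)) ≠ 0 → occ ((step a b occ)^[n] (a u)) ≠ 0 ∧
      occ ((step a b occ)^[n] (b u)) ≠ 0)) (Runs.of_wp_le (by decide) ?_) ?_
  · refine ⟨fun h => ?_, fun h => ?_⟩ <;>
      simp only [Test.Holds, NExp.eval, k9, hs₂] at h <;>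
      simp [Prog.wp, NExp.eval, k15, k8, k4, h]
  rintro s₃ hF₃ ⟨m10, m15, mfail⟩
  have m7 : s₃.arr 7 = a := (hF₃.arr 7 (by decide)).trans k7
  have m8 : s₃.arr 8 = b := (hF₃.arr 8 (by decide)).trans k8
  have m9 : s₃.arr 9 = occ := (hF₃.arr 9 (by decide)).trans k9
  have m0 : s₃.reg 0 = n := (hF₃.reg 0 (by decide)).trans k0
  have m4 : s₃.reg 4 = u := (hF₃.reg 4 (by decide)).trans k4
  have mr8 : s₃.reg 8 = 1 := (hF₃.reg 8 (by decide)).trans kr8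
  have hw := runs_walk s₃
  rw [m0] at hw
  refine Runs.seq hw ?_
  intro s₄ hF₄ hs₄
  have l7 : s₄.arr 7 = a := (hF₄.arr 7 (by decide)).trans m7
  have l8 : s₄.arr 8 = b := (hF₄.arr 8 (by decide)).trans m8
  have l9 : s₄.arr 9 = occ := (hF₄.arr 9 (by decide)).trans m9
  have l0 : s₄.reg 0 = n := (hF₄.reg 0 (by decide)).trans m0
  have l4 : s₄.reg 4 = u := (hF₄.reg 4 (by decide)).trans m4
  have l15 : s₄.reg 15 = s₃.reg 15 := hF₄.reg 15 (by decide)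
  have lr8 : s₄.reg 8 = 1 := (hF₄.reg 8 (by decide)).trans mr8
  rw [m7, m8, m9, m10] at hs₄
  refine (Runs.cond (T := 5 + (n * 50 + 15)) (fun h => ?_) (fun h => ?_)).mono
    (by simp only [Test.cost, NExp.cost]; omega) fun _ _ h => h
  · simp only [Test.Holds, NExp.eval, l9, hs₄] at h
    refine Runs.seq (R := fun s' => s'.reg 9 = u ∧ s'.reg 10 = s₃.reg 15)
      (Runs.of_wp_le (by decide) (by simp [Prog.wp, NExp.eval, l4, l15])) ?_
    rintro s₅ hF₅ ⟨e9, e10⟩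
    have q7 : s₅.arr 7 = a := (hF₅.arr 7 (by decide)).trans l7
    have q8 : s₅.arr 8 = b := (hF₅.arr 8 (by decide)).trans l8
    have q9 : s₅.arr 9 = occ := (hF₅.arr 9 (by decide)).trans l9
    have q0 : s₅.reg 0 = n := (hF₅.reg 0 (by decide)).trans l0
    have qr8 : s₅.reg 8 = 1 := (hF₅.reg 8 (by decide)).trans lr8
    have hrun := runs_displaceAll (s := s₅) (U := insert u U)
      (by rw [q7, q8, q9, e9]; simpa [hU] using hM) (by simp [e9])
      (by rw [q7, q8, e9, e10]; exact m15) (by rw [q7, q8, q9, q0, e10]; exact h)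
    rw [q0] at hrun
    refine hrun.mono le_rfl fun s' hF hs' => Or.inl ⟨(hF.reg 8 (by decide)).trans qr8, ?_⟩
    rwa [q7, q8] at hs'
  · simp only [Test.Holds, NExp.eval, l9, hs₄] at h
    refine Runs.of_wp_le (by simp only [Prog.bound, NExp.cost]; omega) ?_
    simp only [Prog.wp, State.putReg_reg, if_true]
    right
    obtain ⟨f1, f2⟩ := mfail h
    exact ⟨rfl, fun x hx => hM.not_injOn hU hV hn f1 f2 x hx⟩

/-- The proposition `bad` stands for the absence of a solution. Register 8 becomes 0 only with a
reason for it: different sizes of the sides beforehand, a vertex without neighbours, or an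
obstruction to matching the vertices up to the current one, which persists for all of `V₁`. -/
theorem runs_augmentAll {s : State} {V₁ V₂ : Finset ℕ} {bad : Prop}
    (hV₁ : ∀ u, u ∈ V₁ ↔ u < s.reg 0 ∧ s.arr 0 u = 1)
    (hV : ∀ u ∈ V₁, s.arr 6 u = 1 → s.arr 7 u ∈ V₂ ∧ s.arr 8 u ∈ V₂) (hn : V₂.card ≤ s.reg 0)
    (hfree : ∀ v, s.arr 9 v = 0) (hok : s.reg 8 = 1 ∨ s.reg 8 = 0 ∧ bad)
    (hhas : ∀ u ∈ V₁, s.arr 6 u ≠ 1 → bad)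
    (hinj : (∀ x : ℕ → ℕ, (∀ u ∈ V₁, x u = s.arr 7 u ∨ x u = s.arr 8 u) → ¬ Set.InjOn x V₁) →
      bad) :
    Runs augmentAll s (s.reg 0 * (s.reg 0 * 150 + 150) + 5) fun s' =>
      (s'.reg 8 = 1 ∧ s.reg 8 = 1 ∧ IsMatching (s.arr 7) (s.arr 8) (s'.arr 9) V₁ ∧
        ∀ u ∈ V₁, s.arr 6 u = 1) ∨
      (s'.reg 8 = 0 ∧ bad) := by
  set U : ℕ → Set ℕ := fun k => {u | u ∈ V₁ ∧ u < k} with hU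
  refine (Runs.forLoop (T := s.reg 0 * 150 + 120) (by decide) (by decide) (by decide)
    (fun k s' => (s'.reg 8 = 1 ∧ s.reg 8 = 1 ∧ IsMatching (s.arr 7) (s.arr 8) (s'.arr 9) (U k) ∧
      ∀ u ∈ U k, s.arr 6 u = 1) ∨ (s'.reg 8 = 0 ∧ bad)) ?_ ?_).mono ?_ ?_
  · refine hok.imp (fun h => ⟨by simpa using h, h, ⟨?_, ?_, ?_, ?_⟩, ?_⟩) (fun h => by simpa using h)
    all_goals simp [hfree, hU]
  · intro k hk s' hF hk4 hI
    have h0 := hF.reg 0 (by decide)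
    have a0 := hF.arr 0 (by decide)
    have a6 := hF.arr 6 (by decide)
    have a7 := hF.arr 7 (by decide)
    have a8 := hF.arr 8 (by decide)
    rcases hI with ⟨h8, hok, hM, hone⟩ | ⟨h8, hbad⟩
    swap
    · refine (Runs.cond (T := 1) (fun h => ?_) (fun h => ?_)).mono
        (by simp only [Test.cost, NExp.cost]; omega) fun _ _ h => h
      · simp [Test.Holds, NExp.eval, h8] at h
      · exact Runs.skip (Or.inr ⟨by simpa using h8, hbad⟩) le_rfl
    refine (Runs.cond (T := s.reg 0 * 150 + 115) (fun h => ?_) (fun h => ?_)).mono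
      (by simp only [Test.cost, NExp.cost]; omega) fun _ _ h => h
    swap
    · simp [Test.Holds, NExp.eval, h8] at h
    refine (Runs.cond (T := s.reg 0 * 150 + 110) (fun h => ?_) (fun h => ?_)).mono
      (by simp only [Test.cost, NExp.cost]; omega) fun _ _ h => h
    · simp only [Test.Holds, NExp.eval, a0, hk4] at h
      have hkV : k ∈ V₁ := (hV₁ k).2 ⟨hk, h⟩
      have hUk : U (k + 1) = insert k (U k) := by
        ext u
        simp only [hU, Set.mem_ofPred_eq, Set.mem_insert_iff]
        constructor
        · rintro ⟨h1, h2⟩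
          by_cases huk : u = k
          · exact Or.inl huk
          · exact Or.inr ⟨h1, by omega⟩
        · rintro (rfl | ⟨h1, h2⟩)
          · exact ⟨hkV, by omega⟩
          · exact ⟨h1, by omega⟩
      refine (Runs.cond (T := s.reg 0 * 150 + 100) (fun h => ?_) (fun h => ?_)).mono
        (by simp only [Test.cost, NExp.cost]; omega) fun _ _ h => h
      · simp only [Test.Holds, NExp.eval, a6, hk4] at h
        have hone' : ∀ u ∈ insert k (U k), s.arr 6 u = 1 := by
          rintro u (rfl | hu)
          exacts [h, hone u hu]
        have hsub : insert k (U k) ⊆ V₁ := by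
          rintro u (rfl | hu)
          exacts [hkV, hu.1]
        have hrun := runs_augment (s := s') (U := U k) (V := V₂) (by rw [a7, a8]; exact hM)
          (by simp [hk4, hU]) (by
            rw [hk4, a7, a8]
            exact fun w hw => hV w (hsub hw) (hone' w hw)) (by rw [h0]; exact hn) h8
        rw [h0] at hrun
        refine hrun.mono le_rfl fun s'' hF'' hs => ?_
        rw [a7, a8, hk4] at hs
        simp only [State.putReg_reg, State.putReg_arr, hUk]
        refine hs.imp (fun h => ⟨by simpa using h.1, hok, h.2, hone'⟩) fun h => ⟨by simpa using h.1, ?_⟩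
        exact hinj fun x hx hxinj => h.2 x (fun w hw => hx w (hsub hw)) (hxinj.mono hsub)
      · simp only [Test.Holds, NExp.eval, a6, hk4] at h
        refine Runs.of_wp_le (by simp only [Prog.bound, NExp.cost]; omega) ?_
        right
        simpa [NExp.eval] using hhas k hkV h
    · simp only [Test.Holds, NExp.eval, a0, hk4] at h
      have hkV : k ∉ V₁ := fun hkV => h ((hV₁ k).1 hkV).2
      have hUk : U (k + 1) = U k := by
        ext u
        simp only [hU, Set.mem_ofPred_eq]
        refine and_congr_right fun hu => ⟨fun h => ?_, fun h => by omega⟩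
        have : u ≠ k := fun h => hkV (h ▸ hu)
        omega
      refine Runs.skip (Or.inl ?_) (by omega)
      rw [hUk]
      exact ⟨by simpa using h8, hok, by simpa using hM, hone⟩
  · exact Nat.add_le_add_right (Nat.mul_le_mul_left _ (by omega)) _
  · intro s' _ h
    have hUn : U (s.reg 0) = V₁ := by
      ext u
      simp only [hU, Set.mem_ofPred_eq, Finset.mem_coe]
      exact ⟨fun h => h.1, fun h => ⟨h, ((hV₁ u).1 h).1⟩⟩
    rwa [hUn] at h

end CBMProgram

/-! ### Examining one component: cycle test, weights and satisfied joins. -/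

namespace CBMProgram

open RAM TwoChoice

/-- The weight of the edge from `u` to `l ∈ {a u, b u}`. -/
noncomputable def edgeWeight (s : State) (u l : ℕ) : ℝ≥0∞ :=
  if l = s.arr 7 u then s.warr 1 u else s.warr 2 u

/-- The edge from `u` to `l` satisfies the join `j`. -/
def Sat (s : State) (u l j : ℕ) : Prop :=
  (s.arr 3 u = s.arr 4 j ∨ s.arr 3 l = s.arr 4 j) ∧ (s.arr 3 u = s.arr 5 j ∨ s.arr 3 l = s.arr 5 j)

/-- `A` holds the value `F` at the members of `P` and `0` elsewhere. -/
def Flags (F c : ℕ) (P : ℕ → Prop) (A : ℕ → ℕ) : Prop :=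
  ∀ j < c, (P j → A j = F) ∧ (¬ P j → A j = 0)

/-- The part of the memory that stays fixed while a component is processed. -/
structure SameInput (s s' : State) : Prop where
  reg : ∀ r ∈ [0, 3, 4, 7], s'.reg r = s.reg r
  arr : ∀ A ∈ [0, 3, 4, 5, 7, 8, 9], s'.arr A = s.arr A
  wreg : s'.wreg 0 = s.wreg 0
  warr : ∀ A ∈ [1, 2], s'.warr A = s.warr A

theorem SameInput.trans {s s' s'' : State} (h : SameInput s s') (h' : SameInput s' s'') :
    SameInput s s'' :=
  ⟨fun r hr => (h'.reg r hr).trans (h.reg r hr), fun r hr => (h'.arr r hr).trans (h.arr r hr),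
    h'.wreg.trans h.wreg, fun r hr => (h'.warr r hr).trans (h.warr r hr)⟩

/-- `P` does not write the part of the memory that is described by `SameInput`. -/
def KeepsInput (P : Prog) : Prop :=
  (∀ r ∈ [0, 3, 4, 7], r ∉ P.regs) ∧ (∀ A ∈ [0, 3, 4, 5, 7, 8, 9], A ∉ P.arrs) ∧ 0 ∉ P.wregs ∧
    ∀ A ∈ [1, 2], A ∉ P.warrs

/-- The write sets are explicit lists, so `decide` settles the condition for each concrete
subroutine. -/
instance (P : Prog) : Decidable (KeepsInput P) := by unfold KeepsInput; infer_instance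

theorem KeepsInput.sameInput {P : Prog} {s s' : State} (hP : KeepsInput P) (h : Frame P s s') :
    SameInput s s' :=
  ⟨fun r hr => h.reg r (hP.1 r hr), fun A hA => h.arr A (hP.2.1 A hA), h.wreg 0 hP.2.2.1,
    fun A hA => h.warr A (hP.2.2.2 A hA)⟩

theorem SameInput.sat {s s' : State} (h : SameInput s s') : Sat s' = Sat s := by
  ext
  simp only [Sat, h.arr 3 (by simp), h.arr 4 (by simp), h.arr 5 (by simp)]

theorem SameInput.edgeWeight {s s' : State} (h : SameInput s s') :
    edgeWeight s' = edgeWeight s := by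
  ext
  simp only [CBMProgram.edgeWeight, h.arr 7 (by simp), h.warr 1 (by simp), h.warr 2 (by simp)]

theorem SameInput.step {s s' : State} (h : SameInput s s') :
    step (s'.arr 7) (s'.arr 8) (s'.arr 9) = step (s.arr 7) (s.arr 8) (s.arr 9) := by
  rw [h.arr 7 (by simp), h.arr 8 (by simp), h.arr 9 (by simp)]

/-- Flag in the array `A` the joins that are satisfied by the edge from the vertex in register `9`
to the vertex in register `l`. -/
def markJoins (l A : ℕ) : Prog :=
  .forLoop 6 3
    (.cond (.eq (.arr 3 (.reg 9)) (.arr 4 (.reg 6)))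
      (.cond (.eq (.arr 3 (.reg 9)) (.arr 5 (.reg 6))) (.setArr A (.reg 6) (.reg 7))
        (.cond (.eq (.arr 3 (.reg l)) (.arr 5 (.reg 6))) (.setArr A (.reg 6) (.reg 7)) .skip))
      (.cond (.eq (.arr 3 (.reg l)) (.arr 4 (.reg 6)))
        (.cond (.eq (.arr 3 (.reg 9)) (.arr 5 (.reg 6))) (.setArr A (.reg 6) (.reg 7))
          (.cond (.eq (.arr 3 (.reg l)) (.arr 5 (.reg 6))) (.setArr A (.reg 6) (.reg 7)) .skip))
        .skip))

/-- Add the weight of the edge from the vertex in register `9` to the vertex in register `l` to the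
weight register `w`. -/
def addWeight (l w : ℕ) : Prog :=
  .cond (.eq (.reg l) (.arr 7 (.reg 9))) (.setWReg w (.add (.reg w) (.arr 1 (.reg 9))))
    (.setWReg w (.add (.reg w) (.arr 2 (.reg 9))))

/-- Account for the vertex in register `10` and go to the next vertex. -/
def visit : Prog :=
  .seq (.seq (.setReg 9 owner) (.setReg 11 other))
    (.seq (markJoins 10 11)
      (.seq (markJoins 11 12)
        (.seq (.seq (addWeight 10 1) (addWeight 11 2))
          (.seq (.setArr 10 (.reg 10) (.lit 1)) (.setReg 10 (.reg 11))))))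

/-- Account for the component of the vertex in register `10`, whose size is in register `12`. -/
def collect : Prog := .forLoop 5 12 visit

/-- Compute the component of the vertex in register `4`: its size in register `12`, and in register
`13` whether it is a cycle. -/
def detectCycle : Prog :=
  .seq (.seq (.setReg 10 (.reg 4)) (.seq (.setReg 10 other) (.setReg 12 (.lit 1))))
    (.seq (.forLoop 5 0 (.cond (.eq (.reg 10) (.reg 4)) .skip
        (.seq (.setReg 10 other) (.setReg 12 (.add (.reg 12) (.lit 1))))))
      (.cond (.eq (.reg 10) (.reg 4)) (.setReg 13 (.lit 1))
        (.seq (.setReg 13 (.lit 0)) (.setReg 12 (.lit 1)))))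

/-- Reset the flags and the weights. -/
def clear : Prog :=
  .seq (.forLoop 5 3 (.seq (.setArr 11 (.reg 5) (.lit 0)) (.setArr 12 (.reg 5) (.lit 0))))
    (.seq (.setWReg 1 .zero) (.seq (.setWReg 2 .zero) (.setReg 10 (.reg 4))))

/-- Tabulate in arrays `13` and `14` the removal of the flagged joins from every set of joins. -/
def buildDiffs : Prog :=
  .seq (.seq (.setReg 14 (.lit 1)) (.seq (.setArr 13 (.lit 0) (.lit 0)) (.setArr 14 (.lit 0) (.lit 0))))
    (.forLoop 5 3 (.seq
      (.forLoop 6 14 (.seq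
        (.setArr 13 (.add (.reg 6) (.reg 14))
          (.add (.arr 13 (.reg 6)) (.sub (.reg 14) (.arr 11 (.reg 5)))))
        (.setArr 14 (.add (.reg 6) (.reg 14))
          (.add (.arr 14 (.reg 6)) (.sub (.reg 14) (.arr 12 (.reg 5)))))))
      (.setReg 14 (.add (.reg 14) (.reg 14)))))

/-- Extend the table in the weight array `3` by a component. -/
def relax : Prog :=
  .forLoop 5 7 (.seq (.setReg 6 (.sub (.sub (.reg 7) (.lit 1)) (.reg 5)))
    (.cond (.wle (.add (.arr 3 (.arr 13 (.reg 6))) (.reg 1)) (.add (.arr 3 (.arr 14 (.reg 6))) (.reg 2)))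
      (.setWArr 3 (.reg 6) (.add (.arr 3 (.arr 13 (.reg 6))) (.reg 1)))
      (.setWArr 3 (.reg 6) (.add (.arr 3 (.arr 14 (.reg 6))) (.reg 2)))))

theorem runs_markJoins {l A : ℕ} (s : State) (hl : l ≠ 6) (h3 : A ≠ 3) (h4 : A ≠ 4) (h5 : A ≠ 5) :
    Runs (markJoins l A) s (s.reg 3 * 50 + 5) fun s' =>
      ∀ j < s.reg 3, (Sat s (s.reg 9) (s.reg l) j → s'.arr A j = s.reg 7) ∧
        (¬ Sat s (s.reg 9) (s.reg l) j → s'.arr A j = s.arr A j) := by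
  refine (Runs.forLoop (T := 43) (by simp [Prog.regs]) (by simp [Prog.regs]) (by decide) (fun k s' =>
    ∀ j, (Sat s (s.reg 9) (s.reg l) j ∧ j < k → s'.arr A j = s.reg 7) ∧
        (¬ (Sat s (s.reg 9) (s.reg l) j ∧ j < k) → s'.arr A j = s.arr A j)) (by simp) ?_).mono
    le_rfl fun s' _ h j hj => ?_
  · intro k _ s' hF hk hI
    have a3 := hF.arr 3 (by simpa [markJoins, Prog.arrs, Prog.forLoop] using h3.symm)
    have a4 := hF.arr 4 (by simpa [markJoins, Prog.arrs, Prog.forLoop] using h4.symm)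
    have a5 := hF.arr 5 (by simpa [markJoins, Prog.arrs, Prog.forLoop] using h5.symm)
    have r9 := hF.reg 9 (by simp [Prog.regs, Prog.forLoop])
    have r7 := hF.reg 7 (by simp [Prog.regs, Prog.forLoop])
    have rl := hF.reg l (by simpa [markJoins, Prog.regs, Prog.forLoop] using hl)
    -- Only the flag of join k can change in this round, so it suffices to compare each branch with
    -- the truth of `Sat` at k.
    have key : ∀ s'' : State,
        (Sat s (s.reg 9) (s.reg l) k → s''.arr A = Function.update (s'.arr A) k (s.reg 7)) ∧
          (¬ Sat s (s.reg 9) (s.reg l) k → s''.arr A = s'.arr A) →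
        ∀ j, (Sat s (s.reg 9) (s.reg l) j ∧ j < k + 1 → s''.arr A j = s.reg 7) ∧
        (¬ (Sat s (s.reg 9) (s.reg l) j ∧ j < k + 1) → s''.arr A j = s.arr A j) := by
      intro s'' hs j
      have hIj := hI j
      by_cases hjk : j = k
      · subst hjk
        by_cases h : Sat s (s.reg 9) (s.reg l) j
        · simp [h, hs.1 h]
        · simpa [h, hs.2 h] using hIj
      · have : j < k + 1 ↔ j < k := by omega
        rw [this]
        by_cases h : Sat s (s.reg 9) (s.reg l) k
        · rwa [hs.1 h, Function.update_of_ne hjk]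
        · rwa [hs.2 h]
    refine Runs.of_wp_le (by simp [Prog.bound, Test.cost, NExp.cost]) ?_
    simp only [Prog.wp, Test.Holds, NExp.eval, a3, a4, a5, r9, r7, rl, hk, Sat] at key ⊢
    refine ⟨fun h1 => ⟨fun h2 => ?_, fun h2 => ⟨fun h3 => ?_, fun h3 => ?_⟩⟩,
      fun h1 => ⟨fun h1' => ⟨fun h2 => ?_, fun h2 => ⟨fun h3 => ?_, fun h3 => ?_⟩⟩, fun h1' => ?_⟩⟩ <;>
    · apply key
      refine ⟨fun h => ?_, fun h => ?_⟩ <;> first | (exfalso; tauto) | simp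
  · exact ⟨fun hs => (h j).1 ⟨hs, hj⟩, fun hs => (h j).2 fun h => hs h.1⟩

theorem runs_visit {s : State} (hocc : s.arr 9 (s.reg 10) ≠ 0) :
    Runs visit s (s.reg 3 * 100 + 100) fun s' =>
      s'.reg 10 = step (s.arr 7) (s.arr 8) (s.arr 9) (s.reg 10) ∧
      s'.wreg 1 = s.wreg 1 + edgeWeight s (s.arr 9 (s.reg 10) - 1) (s.reg 10) ∧
      s'.wreg 2 = s.wreg 2 + edgeWeight s (s.arr 9 (s.reg 10) - 1)
        (step (s.arr 7) (s.arr 8) (s.arr 9) (s.reg 10)) ∧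
      (∀ j < s.reg 3, (Sat s (s.arr 9 (s.reg 10) - 1) (s.reg 10) j → s'.arr 11 j = s.reg 7) ∧
        (¬ Sat s (s.arr 9 (s.reg 10) - 1) (s.reg 10) j → s'.arr 11 j = s.arr 11 j)) ∧
      (∀ j < s.reg 3, (Sat s (s.arr 9 (s.reg 10) - 1)
          (step (s.arr 7) (s.arr 8) (s.arr 9) (s.reg 10)) j → s'.arr 12 j = s.reg 7) ∧
        (¬ Sat s (s.arr 9 (s.reg 10) - 1) (step (s.arr 7) (s.arr 8) (s.arr 9) (s.reg 10)) j →
          s'.arr 12 j = s.arr 12 j)) ∧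
      s'.arr 10 = Function.update (s.arr 10) (s.reg 10) 1 := by
  set u := s.arr 9 (s.reg 10) - 1 with hu
  set x := step (s.arr 7) (s.arr 8) (s.arr 9) (s.reg 10) with hx
  refine (Runs.seq (T := 20) (T' := (s.reg 3 * 50 + 5) + ((s.reg 3 * 50 + 5) + (30 + 10)))
    (R := fun s' => s'.reg 9 = u ∧ s'.reg 11 = x)
    (Runs.of_wp_le (by decide) ?_) ?_).mono (by omega) fun _ _ h => h
  · simp [Prog.wp, owner, other, NExp.eval, hu, hx, step_of_ne_zero hocc]
  rintro s₁ hF₁ ⟨h9, h11⟩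
  have hS₁ : SameInput s s₁ := KeepsInput.sameInput (by decide) hF₁
  have r10 := hF₁.reg 10 (by decide)
  have a10 := hF₁.arr 10 (by decide)
  have a11 := hF₁.arr 11 (by decide)
  have a12 := hF₁.arr 12 (by decide)
  have w1 := hF₁.wreg 1 (by decide)
  have w2 := hF₁.wreg 2 (by decide)
  have hm := runs_markJoins (l := 10) (A := 11) s₁ (by decide) (by decide) (by decide) (by decide)
  rw [hS₁.reg 3 (by simp)] at hm
  refine Runs.seq hm ?_
  intro s₂ hF₂ hs₂
  have hS₂ : SameInput s s₂ := hS₁.trans (KeepsInput.sameInput (by decide) hF₂)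
  rw [hS₁.sat, h9, r10, a11, hS₁.reg 7 (by simp)] at hs₂
  replace r10 := (hF₂.reg 10 (by decide)).trans r10
  replace a10 := (hF₂.arr 10 (by decide)).trans a10
  replace a12 := (hF₂.arr 12 (by decide)).trans a12
  replace w1 := (hF₂.wreg 1 (by decide)).trans w1
  replace w2 := (hF₂.wreg 2 (by decide)).trans w2
  replace h9 := (hF₂.reg 9 (by decide)).trans h9
  replace h11 := (hF₂.reg 11 (by decide)).trans h11
  have hm := runs_markJoins (l := 11) (A := 12) s₂ (by decide) (by decide) (by decide) (by decide)
  rw [hS₂.reg 3 (by simp)] at hm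
  refine Runs.seq hm ?_
  intro s₃ hF₃ hs₃
  have hS₃ : SameInput s s₃ := hS₂.trans (KeepsInput.sameInput (by decide) hF₃)
  rw [hS₂.sat, h9, h11, a12, hS₂.reg 7 (by simp)] at hs₃
  replace r10 := (hF₃.reg 10 (by decide)).trans r10
  replace a10 := (hF₃.arr 10 (by decide)).trans a10
  replace a11 := hF₃.arr 11 (by decide)
  replace w1 := (hF₃.wreg 1 (by decide)).trans w1
  replace w2 := (hF₃.wreg 2 (by decide)).trans w2
  replace h9 := (hF₃.reg 9 (by decide)).trans h9
  replace h11 := (hF₃.reg 11 (by decide)).trans h11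
  rw [← a11] at hs₂
  refine Runs.seq (R := fun s' => s'.wreg 1 = s.wreg 1 + edgeWeight s u (s.reg 10) ∧
    s'.wreg 2 = s.wreg 2 + edgeWeight s u x) (Runs.of_wp_le (by decide) ?_) ?_
  · have a7 := hS₃.arr 7 (by simp)
    have k1 := hS₃.warr 1 (by simp)
    have k2 := hS₃.warr 2 (by simp)
    refine ⟨fun h => ⟨fun h' => ?_, fun h' => ?_⟩, fun h => ⟨fun h' => ?_, fun h' => ?_⟩⟩ <;>
    · simp only [Test.Holds, NExp.eval, r10, a7, h9, h11, State.putWReg_reg,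
        State.putWReg_arr] at h h'
      simp [Prog.wp, WExp.eval, NExp.eval, w1, w2, h9, k1, k2, edgeWeight, h, h']
  rintro s₄ hF₄ ⟨e1, e2⟩
  refine Runs.of_wp_le (by decide) ?_
  replace r10 := (hF₄.reg 10 (by decide)).trans r10
  replace a10 := (hF₄.arr 10 (by decide)).trans a10
  replace a11 := hF₄.arr 11 (by decide)
  replace a12 := hF₄.arr 12 (by decide)
  replace h11 := (hF₄.reg 11 (by decide)).trans h11
  rw [← a11] at hs₂
  rw [← a12] at hs₃
  simp only [Prog.wp, NExp.eval, State.putReg_reg, State.putArr_reg, State.putReg_wreg,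
    State.putArr_wreg, State.putReg_arr, State.putArr_arr, r10, h11]
  exact ⟨rfl, e1, e2, hs₂, hs₃, by simp [a10]⟩

theorem runs_collect {s : State} {v : ℕ} (hv : s.reg 10 = v)
    (hocc : ∀ i, s.arr 9 ((step (s.arr 7) (s.arr 8) (s.arr 9))^[i] v) ≠ 0)
    (hw1 : s.wreg 1 = 0) (hw2 : s.wreg 2 = 0) (h11 : ∀ j < s.reg 3, s.arr 11 j = 0)
    (h12 : ∀ j < s.reg 3, s.arr 12 j = 0) :
    Runs collect s (s.reg 12 * (s.reg 3 * 100 + 107) + 5) fun s' =>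
      s'.wreg 1 = ∑ i ∈ Finset.range (s.reg 12),
        (fun y => edgeWeight s (s.arr 9 y - 1) y)
          ((step (s.arr 7) (s.arr 8) (s.arr 9))^[i] v) ∧
      s'.wreg 2 = ∑ i ∈ Finset.range (s.reg 12),
        (fun y => edgeWeight s (s.arr 9 y - 1) (step (s.arr 7) (s.arr 8) (s.arr 9) y))
          ((step (s.arr 7) (s.arr 8) (s.arr 9))^[i] v) ∧
      Flags (s.reg 7) (s.reg 3) (fun j =>
        ∃ y ∈ orbit (step (s.arr 7) (s.arr 8) (s.arr 9)) v (s.reg 12), Sat s (s.arr 9 y - 1) y j)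
          (s'.arr 11) ∧
      Flags (s.reg 7) (s.reg 3) (fun j =>
        ∃ y ∈ orbit (step (s.arr 7) (s.arr 8) (s.arr 9)) v (s.reg 12),
          Sat s (s.arr 9 y - 1) (step (s.arr 7) (s.arr 8) (s.arr 9) y) j) (s'.arr 12) ∧
      ∀ y, s'.arr 10 y =
        if y ∈ orbit (step (s.arr 7) (s.arr 8) (s.arr 9)) v (s.reg 12) then 1 else s.arr 10 y := by
  set g := step (s.arr 7) (s.arr 8) (s.arr 9) with hg
  refine (Runs.forLoop (T := s.reg 3 * 100 + 100) (by decide) (by decide) (by decide) (fun k s' =>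
    s'.reg 10 = g^[k] v ∧
    s'.wreg 1 = ∑ i ∈ Finset.range k, (fun y => edgeWeight s (s.arr 9 y - 1) y) (g^[i] v) ∧
    s'.wreg 2 = ∑ i ∈ Finset.range k, (fun y => edgeWeight s (s.arr 9 y - 1) (g y)) (g^[i] v) ∧
    Flags (s.reg 7) (s.reg 3) (fun j => ∃ y ∈ orbit g v k, Sat s (s.arr 9 y - 1) y j) (s'.arr 11) ∧
    Flags (s.reg 7) (s.reg 3) (fun j => ∃ y ∈ orbit g v k, Sat s (s.arr 9 y - 1) (g y) j)
      (s'.arr 12) ∧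
    ∀ y, s'.arr 10 y = if y ∈ orbit g v k then 1 else s.arr 10 y) ?_ ?_).mono le_rfl
    fun _ _ h => h.2
  · simpa [hv, hw1, hw2, orbit, Flags] using ⟨h11, h12⟩
  · rintro k _ s' hF - ⟨I1, I2, I3, I4, I5, I6⟩
    have hS : SameInput s s' := KeepsInput.sameInput (by decide) hF
    have a9 := hS.arr 9 (by simp)
    have hrun := runs_visit (s := s') (by rw [a9, I1]; exact hocc k)
    rw [hS.sat, hS.edgeWeight, hS.step, hS.reg 3 (by simp), hS.reg 7 (by simp), a9, I1, ← hg,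
      ← Function.iterate_succ_apply' g k v] at hrun
    refine hrun.mono le_rfl ?_
    rintro s'' - ⟨J1, J2, J3, J4, J5, J6⟩
    have horb : orbit g v (k + 1) = insert (g^[k] v) (orbit g v k) := by
      simp [orbit, Finset.range_add_one]
    have hflag : ∀ (m : ℕ → ℕ) (A A' : ℕ → ℕ),
        Flags (s.reg 7) (s.reg 3) (fun j => ∃ y ∈ orbit g v k, Sat s (s.arr 9 y - 1) (m y) j) A →
        (∀ j < s.reg 3, (Sat s (s.arr 9 (g^[k] v) - 1) (m (g^[k] v)) j → A' j = s.reg 7) ∧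
          (¬ Sat s (s.arr 9 (g^[k] v) - 1) (m (g^[k] v)) j → A' j = A j)) →
        Flags (s.reg 7) (s.reg 3)
          (fun j => ∃ y ∈ orbit g v (k + 1), Sat s (s.arr 9 y - 1) (m y) j) A' := by
      intro m A A' hA hA' j hj
      simp only [horb, Finset.exists_mem_insert]
      by_cases hs : Sat s (s.arr 9 (g^[k] v) - 1) (m (g^[k] v)) j
      · exact ⟨fun _ => (hA' j hj).1 hs, fun h => absurd (Or.inl hs) h⟩
      · rw [(hA' j hj).2 hs]
        exact ⟨fun h => (hA j hj).1 (h.resolve_left hs), fun h => (hA j hj).2 fun h' => h (Or.inr h')⟩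
    simp only [State.putReg_reg, State.putReg_wreg, State.putReg_arr]
    refine ⟨by simpa using J1, ?_, ?_, hflag id _ _ I4 J4, hflag g _ _ I5 ?_, ?_⟩
    · rw [Finset.sum_range_succ, J2, I2]
    · rw [Finset.sum_range_succ, J3, I3, Function.iterate_succ_apply']
    · simpa only [Function.iterate_succ_apply'] using J5
    · intro y
      rw [J6, Function.update_apply, I6, horb]
      by_cases hy : y = g^[k] v <;> simp [hy]

/-- A periodic vertex returns to itself within n steps, so a walk that has not returned after n + 1
steps proves that the vertex lies on no cycle; its component then counts as a single point. -/
theorem runs_detectCycle {s : State}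
    (hocc : ∀ i, s.arr 9 ((step (s.arr 7) (s.arr 8) (s.arr 9))^[i] (s.reg 4)) ≠ 0)
    (hper : Function.minimalPeriod (step (s.arr 7) (s.arr 8) (s.arr 9)) (s.reg 4) ≤ s.reg 0) :
    Runs detectCycle s (s.reg 0 * 50 + 50) fun s' =>
      (s'.reg 13 = 1 ∧
        s.reg 4 ∈ Function.periodicPts (step (s.arr 7) (s.arr 8) (s.arr 9)) ∧
        s'.reg 12 = Function.minimalPeriod (step (s.arr 7) (s.arr 8) (s.arr 9)) (s.reg 4)) ∨
      (s'.reg 13 = 0 ∧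
        s.reg 4 ∉ Function.periodicPts (step (s.arr 7) (s.arr 8) (s.arr 9)) ∧ s'.reg 12 = 1) := by
  set g := step (s.arr 7) (s.arr 8) (s.arr 9) with hg
  set v := s.reg 4 with hv
  set n := s.reg 0 with hn
  have hother : ∀ s' : State, SameInput s s' → ∀ i, s'.reg 10 = g^[i] v →
      other.eval s' = g^[i + 1] v := by
    intro s' hS i hi
    rw [Function.iterate_succ_apply', hg, step_of_ne_zero (hocc i)]
    simp only [other, owner, NExp.eval, hi, hS.arr 7 (by simp), hS.arr 8 (by simp),
      hS.arr 9 (by simp)]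
  refine (Runs.seq (T := 20) (T' := (n * 50 + 5) + 20)
    (R := fun s' => s'.reg 10 = g v ∧ s'.reg 12 = 1)
    (Runs.of_wp_le (by decide) ?_) ?_).mono (by omega) fun _ _ h => h
  · have := hother (s.putReg 10 (s.reg 4)) (KeepsInput.sameInput (P := .setReg 10 (.lit 0)) (by decide)
      ⟨by simp +contextual [Prog.regs], fun _ _ => rfl, fun _ _ => rfl, fun _ _ => rfl⟩) 0
      (by simp [hv])
    simpa [Prog.wp, NExp.eval] using this
  rintro s₁ hF₁ ⟨h10, h12⟩
  have hS₁ : SameInput s s₁ := KeepsInput.sameInput (by decide) hF₁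
  have h0 : s₁.reg 0 = n := hS₁.reg 0 (by simp)
  -- Register 12 counts the steps. The walk is either back at v for the first time, where it stops,
  -- or it has made k + 1 steps, one of them before the loop.
  have hloop := Runs.forLoop (r := 5) (N := 0) (s := s₁) (T := 43)
    (P := .cond (.eq (.reg 10) (.reg 4)) .skip
        (.seq (.setReg 10 other) (.setReg 12 (.add (.reg 12) (.lit 1))))) (by decide) (by decide)
    (by decide) (fun k s' => 1 ≤ s'.reg 12 ∧ s'.reg 10 = g^[s'.reg 12] v ∧
      (∀ i, 0 < i → i < s'.reg 12 → g^[i] v ≠ v) ∧ (s'.reg 10 = v ∨ s'.reg 12 = k + 1))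
    ?_ ?_
  · rw [h0] at hloop
    refine Runs.seq hloop ?_
    rintro s₂ hF₂ ⟨I1, I2, I3, I4⟩
    have h4 : s₂.reg 4 = v := (hF₂.reg 4 (by decide)).trans (hS₁.reg 4 (by simp))
    refine Runs.of_wp_le (by decide) ⟨fun h => ?_, fun h => ?_⟩
    · simp only [Test.Holds, NExp.eval, h4] at h
      have hp : Function.IsPeriodicPt g (s₂.reg 12) v := I2.symm.trans h
      simp only [Prog.wp, State.putReg_reg]
      refine Or.inl ⟨by simp [NExp.eval], ⟨_, I1, hp⟩, ?_⟩
      simp only [Nat.reduceEqDiff, if_false]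
      refine le_antisymm ?_ (hp.minimalPeriod_le I1)
      by_contra hlt
      exact I3 _ (hp.minimalPeriod_pos I1) (by omega) (Function.iterate_minimalPeriod)
    · simp only [Test.Holds, NExp.eval, h4] at h
      have h12' : s₂.reg 12 = n + 1 := I4.resolve_left h
      simp only [Prog.wp, State.putReg_reg]
      refine Or.inr ⟨by simp [NExp.eval], fun hmem => ?_, by simp [NExp.eval]⟩
      exact I3 _ (Function.minimalPeriod_pos_of_mem_periodicPts hmem) (by omega)
        Function.iterate_minimalPeriod
  · simp only [State.putReg_reg]
    simp only [Nat.reduceEqDiff, if_false, h10, h12]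
    exact ⟨le_rfl, rfl, fun i _ _ => by omega, Or.inr trivial⟩
  · rintro k _ s' hF - ⟨I1, I2, I3, I4⟩
    have hS : SameInput s s' := hS₁.trans (KeepsInput.sameInput (by decide) hF)
    have h4 : s'.reg 4 = v := hS.reg 4 (by simp)
    refine Runs.of_wp_le (by decide) ⟨fun h => ?_, fun h => ?_⟩
    · simp only [Test.Holds, NExp.eval, h4] at h
      simpa [Prog.wp, h] using ⟨I1, h ▸ I2, I3⟩
    · simp only [Test.Holds, NExp.eval, h4] at h
      have hk := I4.resolve_left h
      simp only [Prog.wp, State.putReg_reg, NExp.eval, hother s' hS _ I2]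
      simp only [Nat.reduceEqDiff, if_false, if_true]
      refine ⟨by omega, trivial, fun i hi hi' => ?_, Or.inr (by omega)⟩
      by_cases hik : i = s'.reg 12
      · rw [hik, ← I2]
        exact h
      · exact I3 i hi (by omega)

theorem runs_clear (s : State) : Runs clear s (s.reg 3 * 20 + 20) fun s' =>
    s'.reg 10 = s.reg 4 ∧ s'.wreg 1 = 0 ∧ s'.wreg 2 = 0 ∧ (∀ j < s.reg 3, s'.arr 11 j = 0) ∧
      ∀ j < s.reg 3, s'.arr 12 j = 0 := by
  refine ((Runs.forLoop (T := 13) (by decide) (by decide) (by decide) (fun k s' =>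
    ∀ j < k, s'.arr 11 j = 0 ∧ s'.arr 12 j = 0) (by simp) ?_).seq (T' := 15) ?_).mono (by omega)
    fun _ _ h => h
  · intro k _ s' hF hk hI
    refine Runs.of_wp_le (by decide) ?_
    intro j hj
    have := hI j
    simp only [NExp.eval, hk, State.putReg_arr, State.putArr_arr, State.putArr_reg]
    by_cases hjk : j = k
    · simp [hjk]
    · simpa [hjk] using this (by omega)
  · intro s' hF hs'
    have h4 := hF.reg 4 (by decide)
    refine Runs.of_wp_le (by decide) ?_
    simp only [Prog.wp, WExp.eval, NExp.eval]
    exact ⟨by simp [h4], by simp, by simp, fun j hj => (hs' j hj).1, fun j hj => (hs' j hj).2⟩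

end CBMProgram

/-! ### Removal of joins from sets coded by binary digits, and the table update. -/

namespace CBMProgram

open RAM TwoChoice

/-- Digits below k are treated by x and digit k by y; no carry occurs since S and x are below 2^k.
The recursion yields the whole table of set differences by doubling. -/
theorem _root_.TwoChoice.IsSDiff.succ {k : ℕ} {A : ℕ → Prop} {S x y : ℕ} (hS : S < 2 ^ k)
    (hx : x ≤ S ∧ ∀ j, x.testBit j = true ↔ S.testBit j = true ∧ ¬ A j)
    (hy : (A k → y = 0) ∧ (¬ A k → y = 2 ^ k)) :
    x + y ≤ S + 2 ^ k ∧
      ∀ j, (x + y).testBit j = true ↔ (S + 2 ^ k).testBit j = true ∧ ¬ A j := by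
  have hbit : ∀ z < 2 ^ k, ∀ j, (z + 2 ^ k).testBit j = true ↔ z.testBit j = true ∨ j = k := by
    intro z hz j
    rw [add_comm]
    rcases lt_trichotomy j k with hj | rfl | hj
    · rw [Nat.testBit_two_pow_add_gt hj]
      simp [hj.ne]
    · rw [Nat.testBit_two_pow_add_eq]
      simp [Nat.testBit_lt_two_pow hz]
    · have h1 : 2 ^ (k + 1) ≤ 2 ^ j := Nat.pow_le_pow_right (by norm_num) hj
      rw [Nat.testBit_lt_two_pow (by rw [pow_succ] at h1; omega),
        Nat.testBit_lt_two_pow (by rw [pow_succ] at h1; omega)]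
      simp [hj.ne']
  have hxk : x < 2 ^ k := hx.1.trans_lt hS
  have hSk : S.testBit k = false := Nat.testBit_lt_two_pow hS
  by_cases hA : A k
  · rw [hy.1 hA]
    refine ⟨by omega, fun j => ?_⟩
    rw [add_zero, hbit S hS, hx.2]
    constructor
    · exact fun h => ⟨Or.inl h.1, h.2⟩
    · rintro ⟨h | rfl, h'⟩
      exacts [⟨h, h'⟩, absurd hA h']
  · rw [hy.2 hA]
    refine ⟨by omega, fun j => ?_⟩
    rw [hbit S hS, hbit x hxk, hx.2]
    constructor
    · rintro (h | rfl)
      exacts [⟨Or.inl h.1, h.2⟩, ⟨Or.inr rfl, hA⟩]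
    · rintro ⟨h | rfl, h'⟩
      exacts [Or.inl ⟨h, h'⟩, Or.inr rfl]

theorem runs_buildDiffs {s : State} {P₀ P₁ : ℕ → Prop} (hfull : s.reg 7 = 2 ^ s.reg 3)
    (h₀ : Flags (s.reg 7) (s.reg 3) P₀ (s.arr 11)) (h₁ : Flags (s.reg 7) (s.reg 3) P₁ (s.arr 12)) :
    Runs buildDiffs s (s.reg 3 * (2 ^ s.reg 3 * 40 + 20) + 20) fun s' =>
      IsSDiff (s.reg 3) P₀ (s'.arr 13) ∧ IsSDiff (s.reg 3) P₁ (s'.arr 14) := by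
  set c := s.reg 3 with hc
  have hzero : ∀ (P : ℕ → Prop) (f : ℕ → ℕ), f 0 = 0 → IsSDiff 0 P f := by
    intro P f hf S hS
    obtain rfl : S = 0 := by simpa using hS
    simp [hf]
  refine (Runs.seq (T := 12) (T' := (c * (2 ^ c * 40 + 20) + 5))
    (R := fun s' => s'.reg 14 = 1 ∧ s'.arr 13 0 = 0 ∧ s'.arr 14 0 = 0)
    (Runs.of_wp_le (by decide) (by simp [Prog.wp, NExp.eval])) ?_).mono (by omega) fun _ _ h => h
  rintro s₁ hF₁ ⟨r14, z13, z14⟩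
  have hS₁ : SameInput s s₁ := KeepsInput.sameInput (by decide) hF₁
  have e11 := hF₁.arr 11 (by decide)
  have e12 := hF₁.arr 12 (by decide)
  have e3 : s₁.reg 3 = c := hS₁.reg 3 (by simp)
  have hloop := Runs.forLoop (r := 5) (N := 3) (s := s₁) (T := 2 ^ c * 40 + 13)
    (P := .seq (.forLoop 6 14 (.seq
        (.setArr 13 (.add (.reg 6) (.reg 14))
          (.add (.arr 13 (.reg 6)) (.sub (.reg 14) (.arr 11 (.reg 5)))))
        (.setArr 14 (.add (.reg 6) (.reg 14))
          (.add (.arr 14 (.reg 6)) (.sub (.reg 14) (.arr 12 (.reg 5)))))))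
      (.setReg 14 (.add (.reg 14) (.reg 14)))) (by decide) (by decide) (by decide)
    (fun k s' => s'.reg 14 = 2 ^ k ∧ IsSDiff k P₀ (s'.arr 13) ∧ IsSDiff k P₁ (s'.arr 14)) ?_ ?_
  · rw [e3] at hloop
    exact hloop.mono (by rw [add_assoc]) fun _ _ h => h.2
  · exact ⟨by simpa using r14, hzero _ _ z13, hzero _ _ z14⟩
  rintro k hk s₂ hF₂ hk5 ⟨I1, I2, I3⟩
  rw [e3] at hk
  have hle : 2 ^ k ≤ 2 ^ c := Nat.pow_le_pow_right (by norm_num) hk.le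
  have f11 := (hF₂.arr 11 (by decide)).trans e11
  have f12 := (hF₂.arr 12 (by decide)).trans e12
  have hinner := Runs.forLoop (r := 6) (N := 14) (s := s₂) (T := 30)
    (P := .seq (.setArr 13 (.add (.reg 6) (.reg 14))
          (.add (.arr 13 (.reg 6)) (.sub (.reg 14) (.arr 11 (.reg 5)))))
        (.setArr 14 (.add (.reg 6) (.reg 14))
          (.add (.arr 14 (.reg 6)) (.sub (.reg 14) (.arr 12 (.reg 5)))))) (by decide) (by decide)
    (by decide) (fun m s' => ∀ S < 2 ^ k + m,
      (s'.arr 13 S ≤ S ∧ ∀ j, (s'.arr 13 S).testBit j = true ↔ S.testBit j = true ∧ ¬ P₀ j) ∧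
      (s'.arr 14 S ≤ S ∧ ∀ j, (s'.arr 14 S).testBit j = true ↔ S.testBit j = true ∧ ¬ P₁ j)) ?_ ?_
  · rw [I1] at hinner
    refine (hinner.seq (T' := 5) fun s₃ hF₃ hs₃ => ?_).mono ?_ fun _ _ h => h
    · have g14 := (hF₃.reg 14 (by decide)).trans I1
      refine Runs.of_wp_le (by decide) ?_
      simp only [Prog.wp, NExp.eval, State.putReg_reg, State.putReg_arr, g14]
      have h2 : 2 ^ k + 2 ^ k = 2 ^ (k + 1) := by rw [pow_succ]; ring
      refine ⟨by simp [h2], ?_, ?_⟩ <;> intro S hS <;> rw [← h2] at hS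
      exacts [(hs₃ S hS).1, (hs₃ S hS).2]
    · have := Nat.mul_le_mul_right 40 hle
      omega
  · intro S hS
    exact ⟨I2 S (by simpa using hS), I3 S (by simpa using hS)⟩
  · rintro m hm s₃ hF₃ hm6 hI
    have g14 := (hF₃.reg 14 (by decide)).trans I1
    have g5 := (hF₃.reg 5 (by decide)).trans hk5
    have g11 := (hF₃.arr 11 (by decide)).trans f11
    have g12 := (hF₃.arr 12 (by decide)).trans f12
    rw [I1] at hm
    refine Runs.of_wp_le (by decide) ?_
    have hm' := hI m (by omega)
    -- A raised flag has the value 2^c ≥ 2^k, so the truncated subtraction gives 0; a lowered flag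
    -- leaves 2^k. This replaces a conditional.
    have hy : ∀ {P : ℕ → Prop} {A : ℕ → ℕ}, Flags (s.reg 7) c P A →
        (P k → 2 ^ k - A k = 0) ∧ (¬ P k → 2 ^ k - A k = 2 ^ k) := by
      intro P A hA
      refine ⟨fun h => ?_, fun h => ?_⟩
      · rw [(hA k hk).1 h, hfull]
        omega
      · rw [(hA k hk).2 h, Nat.sub_zero]
    have k₀ := IsSDiff.succ hm hm'.1 (hy h₀)
    have k₁ := IsSDiff.succ hm hm'.2 (hy h₁)
    intro S hS
    by_cases hSm : S = m + 2 ^ k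
    · subst hSm
      simpa [NExp.eval, g14, hm6, g5, g11, g12] using ⟨k₀, k₁⟩
    · simpa [NExp.eval, g14, hm6, g5, g11, g12, hSm] using hI S (by omega)

/-- The update works in place because it treats the sets in decreasing order of their codes:
removing joins does not increase the code, so the entries read at S still have their old values. -/
theorem runs_relax {s : State} (h₀ : ∀ S < s.reg 7, s.arr 13 S ≤ S)
    (h₁ : ∀ S < s.reg 7, s.arr 14 S ≤ S) :
    Runs relax s (s.reg 7 * 50 + 5) fun s' => ∀ S < s.reg 7, s'.warr 3 S =
      min (s.warr 3 (s.arr 13 S) + s.wreg 1) (s.warr 3 (s.arr 14 S) + s.wreg 2) := by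
  set F := s.reg 7 with hF7
  refine (Runs.forLoop (T := 43) (by decide) (by decide) (by decide) (fun k s' =>
    (∀ S < F, F - k ≤ S → s'.warr 3 S =
      min (s.warr 3 (s.arr 13 S) + s.wreg 1) (s.warr 3 (s.arr 14 S) + s.wreg 2)) ∧
    ∀ S < F - k, s'.warr 3 S = s.warr 3 S) ?_ ?_).mono le_rfl ?_
  · exact ⟨fun S h h' => by omega, fun S _ => rfl⟩
  · rintro k hk s' hF hk5 ⟨I1, I2⟩
    have r7 : s'.reg 7 = F := hF.reg 7 (by decide)
    have a13 := hF.arr 13 (by decide)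
    have a14 := hF.arr 14 (by decide)
    have w1 := hF.wreg 1 (by decide)
    have w2 := hF.wreg 2 (by decide)
    set m := F - 1 - k with hm
    have hmF : m < F := by omega
    have d₀ := I2 _ ((h₀ m hmF).trans_lt (by omega : m < F - k))
    have d₁ := I2 _ ((h₁ m hmF).trans_lt (by omega : m < F - k))
    have key : ∀ s'' : State, s''.warr 3 = Function.update (s'.warr 3) m
        (min (s.warr 3 (s.arr 13 m) + s.wreg 1) (s.warr 3 (s.arr 14 m) + s.wreg 2)) →
        (∀ S < F, F - (k + 1) ≤ S → s''.warr 3 S =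
          min (s.warr 3 (s.arr 13 S) + s.wreg 1) (s.warr 3 (s.arr 14 S) + s.wreg 2)) ∧
        ∀ S < F - (k + 1), s''.warr 3 S = s.warr 3 S := by
      intro s'' hs
      rw [hs]
      refine ⟨fun S hS hS' => ?_, fun S hS => ?_⟩
      · by_cases hSm : S = m
        · simp [hSm]
        · rw [Function.update_of_ne hSm]
          exact I1 S hS (by omega)
      · rw [Function.update_of_ne (by omega)]
        exact I2 S (by omega)
    refine Runs.of_wp_le (by decide) ⟨fun h => ?_, fun h => ?_⟩ <;>
    · apply key
      simp only [Test.Holds, WExp.eval, NExp.eval, State.putReg_reg, State.putReg_arr,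
        State.putReg_wreg, State.putReg_warr, r7, hk5, ← hm, if_true, a13, a14, w1, w2, d₀, d₁,
        State.putWArr_warr] at h ⊢
      first
        | rw [min_eq_left h]
        | rw [min_eq_right (not_le.1 h).le]
  · intro s' _ h S hS
    exact h.1 S hS (by omega)

/-! ### One component, and the complete dynamic program. -/

/-- Extend the table by the component of the vertex in register `4`. -/
def component : Prog :=
  .seq detectCycle (.seq clear (.seq collect
    (.seq (.cond (.eq (.reg 13) (.lit 1)) .skip (.setWReg 2 .infty)) (.seq buildDiffs relax))))

/-- Compute in the weight array `3` the least weights of perfect matchings that satisfy given sets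
of joins. -/
def solve : Prog :=
  .seq (.setReg 7 (.lit 1))
    (.seq (.forLoop 5 3 (.setReg 7 (.add (.reg 7) (.reg 7))))
      (.seq (.forLoop 5 7 (.setWArr 3 (.reg 5) .infty))
        (.seq (.setWArr 3 (.lit 0) .zero)
          (.forLoop 4 0 (.cond (.eq (.arr 0 (.reg 4)) (.lit 0))
            (.cond (.eq (.arr 10 (.reg 4)) (.lit 0)) component .skip) .skip)))))

theorem runs_component {s : State} {D V : Finset ℕ} (hfull : s.reg 7 = 2 ^ s.reg 3)
    (hVn : V.card ≤ s.reg 0) (hn : 1 ≤ s.reg 0)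
    (hg : ∀ v ∈ V, step (s.arr 7) (s.arr 8) (s.arr 9) v ∈ V) (hocc : ∀ v ∈ V, s.arr 9 v ≠ 0)
    (hv : s.reg 4 ∈ V) (hvD : s.reg 4 ∉ D) (hvis : ∀ y, s.arr 10 y = if y ∈ D then 1 else 0)
    (hDV : D ⊆ V) (hD : ∀ v ∈ D, v ∈ Function.periodicPts (step (s.arr 7) (s.arr 8) (s.arr 9)) →
      step (s.arr 7) (s.arr 8) (s.arr 9) v ∈ D)
    (hdp : IsTable (step (s.arr 7) (s.arr 8) (s.arr 9)) (fun v => edgeWeight s (s.arr 9 v - 1))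
      (fun v => Sat s (s.arr 9 v - 1)) (s.reg 3) D (s.warr 3)) :
    Runs component s (s.reg 0 * 50 + s.reg 3 * 20 + s.reg 0 * (s.reg 3 * 100 + 107) +
      s.reg 3 * (2 ^ s.reg 3 * 40 + 20) + 2 ^ s.reg 3 * 50 + 120) fun s' =>
      ∃ D' : Finset ℕ, D ⊆ D' ∧ D' ⊆ V ∧ s.reg 4 ∈ D' ∧
        (∀ y, s'.arr 10 y = if y ∈ D' then 1 else 0) ∧
        (∀ v ∈ D', v ∈ Function.periodicPts (step (s.arr 7) (s.arr 8) (s.arr 9)) →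
          step (s.arr 7) (s.arr 8) (s.arr 9) v ∈ D') ∧
        IsTable (step (s.arr 7) (s.arr 8) (s.arr 9)) (fun v => edgeWeight s (s.arr 9 v - 1))
          (fun v => Sat s (s.arr 9 v - 1)) (s.reg 3) D' (s'.warr 3) := by
  set g := step (s.arr 7) (s.arr 8) (s.arr 9) with hgdef
  set v := s.reg 4 with hvdef
  set n := s.reg 0 with hndef
  set c := s.reg 3 with hcdef
  have hit : ∀ i, g^[i] v ∈ V := by
    intro i
    induction i with
    | zero => exact hv
    | succ i ih => rw [Function.iterate_succ_apply']; exact hg _ ih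
  refine ((runs_detectCycle (s := s) (fun i => hocc _ (hit i))
    ((minimalPeriod_le_card hg hv).trans hVn)).seq (T' := c * 20 + 20 +
      ((n * (c * 100 + 107) + 5) + (7 + ((c * (2 ^ c * 40 + 20) + 20) + (2 ^ c * 50 + 5)))))
    ?_).mono (by omega) fun _ _ h => h
  intro s₁ hF₁ hs₁
  have hS₁ : SameInput s s₁ := KeepsInput.sameInput (by decide) hF₁
  have v₁ := hF₁.arr 10 (by decide)
  have d₁ := hF₁.warr 3 (by decide)
  have hclear := runs_clear s₁
  rw [hS₁.reg 3 (by simp), hS₁.reg 4 (by simp)] at hclear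
  refine hclear.seq ?_
  rintro s₂ hF₂ ⟨r10, w1, w2, h11, h12⟩
  have hS₂ : SameInput s s₂ := hS₁.trans (KeepsInput.sameInput (by decide) hF₂)
  have v₂ := (hF₂.arr 10 (by decide)).trans v₁
  have d₂ := (hF₂.warr 3 (by decide)).trans d₁
  have r12 := hF₂.reg 12 (by decide)
  have r13 := hF₂.reg 13 (by decide)
  rw [← r12, ← r13] at hs₁
  have hcol := runs_collect (s := s₂) (v := v) r10
    (by rw [hS₂.step, hS₂.arr 9 (by simp)]; exact fun i => hocc _ (hit i)) w1 w2
    (by rw [hS₂.reg 3 (by simp)]; exact h11) (by rw [hS₂.reg 3 (by simp)]; exact h12)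
  rw [hS₂.step, hS₂.sat, hS₂.edgeWeight, hS₂.arr 9 (by simp), hS₂.reg 3 (by simp),
    hS₂.reg 7 (by simp), ← hgdef, ← hcdef, v₂] at hcol
  set p := s₂.reg 12 with hp
  set C := orbit g v p with hC
  have hpp : p = 1 ∨ p = Function.minimalPeriod g v := by
    rcases hs₁ with h | h
    exacts [Or.inr h.2.2, Or.inl h.2.2]
  have hpn : p ≤ n := by
    rcases hpp with h | h
    · omega
    · rw [h]
      exact (minimalPeriod_le_card hg hv).trans hVn
  rw [← sum_orbit hpp (fun y => edgeWeight s (s.arr 9 y - 1) y),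
    ← sum_orbit hpp (fun y => edgeWeight s (s.arr 9 y - 1) (g y)), ← hC] at hcol
  refine Runs.seq (hcol.mono (Nat.add_le_add_right (Nat.mul_le_mul_right _ hpn) _)
    fun _ _ h => h) ?_
  rintro s₃ hF₃ ⟨w1, w2, h11, h12, v₃⟩
  have hS₃ : SameInput s s₃ := hS₂.trans (KeepsInput.sameInput (by decide) hF₃)
  have d₃ := (hF₃.warr 3 (by decide)).trans d₂
  rw [← hF₃.reg 13 (by decide)] at hs₁
  -- Off the cycles the switched weight is made infinite, which excludes switching from the minimum.
  refine Runs.seq (R := fun s' => s'.wreg 2 = if s₃.reg 13 = 1 then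
    ∑ y ∈ C, edgeWeight s (s.arr 9 y - 1) (g y) else ∞) (Runs.of_wp_le (by decide) ?_) ?_
  · refine ⟨fun h => ?_, fun h => ?_⟩ <;> simp only [Test.Holds, NExp.eval] at h
    · simp [Prog.wp, h, w2]
    · simp [Prog.wp, h, WExp.eval]
  intro s₄ hF₄ w2
  have hS₄ : SameInput s s₄ := hS₃.trans (KeepsInput.sameInput (by decide) hF₄)
  have d₄ := (hF₄.warr 3 (by decide)).trans d₃
  have v₄ := hF₄.arr 10 (by decide)
  rw [← hF₄.arr 11 (by decide)] at h11
  rw [← hF₄.arr 12 (by decide)] at h12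
  rw [← hF₄.wreg 1 (by decide)] at w1
  have r3 : s₄.reg 3 = c := hS₄.reg 3 (by simp)
  have r7 : s₄.reg 7 = s.reg 7 := hS₄.reg 7 (by simp)
  have hbuild := runs_buildDiffs (s := s₄) (by rw [r7, r3]; exact hfull)
    (by rw [r7, r3]; exact h11) (by rw [r7, r3]; exact h12)
  rw [r3] at hbuild
  refine hbuild.seq ?_
  rintro s₅ hF₅ ⟨f₀, f₁⟩
  have hS₅ : SameInput s s₅ := hS₄.trans (KeepsInput.sameInput (by decide) hF₅)
  have d₅ := (hF₅.warr 3 (by decide)).trans d₄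
  have v₅ := (hF₅.arr 10 (by decide)).trans v₄
  rw [← hF₅.wreg 1 (by decide)] at w1
  rw [← hF₅.wreg 2 (by decide)] at w2
  have r7 : s₅.reg 7 = 2 ^ c := (hS₅.reg 7 (by simp)).trans hfull
  have hrel := runs_relax (s := s₅) (fun S hS => (f₀ S (by rwa [r7] at hS)).1)
    (fun S hS => (f₁ S (by rwa [r7] at hS)).1)
  rw [r7, d₅] at hrel
  refine hrel.mono le_rfl fun s₆ hF₆ hs₆ => ?_
  have v₆ := (hF₆.arr 10 (by decide)).trans v₅
  have hp1 : 1 ≤ p := by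
    rcases hs₁ with h | h
    · rw [h.2.2]
      exact Function.minimalPeriod_pos_of_mem_periodicPts h.2.1
    · exact h.2.2.ge
  refine ⟨D ∪ C, Finset.subset_union_left, Finset.union_subset hDV ?_,
    Finset.mem_union_right _ (mem_orbit.2 ⟨0, hp1, rfl⟩), ?_, ?_, ?_⟩
  · intro x hx
    obtain ⟨i, -, rfl⟩ := mem_orbit.1 hx
    exact hit i
  · intro y
    rw [v₆, v₃, hvis]
    by_cases h1 : y ∈ C <;> by_cases h2 : y ∈ D <;> simp [h1, h2]
  -- A cycle is closed under g; a single point off the cycles satisfies the condition vacuously.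
  · intro x hx hper
    rcases Finset.mem_union.1 hx with hx | hx
    · exact Finset.mem_union_left _ (hD x hx hper)
    · refine Finset.mem_union_right _ ?_
      rcases hs₁ with ⟨-, hvp, hpe⟩ | ⟨-, hvp, hpe⟩
      · rw [hC, hpe] at hx ⊢
        exact (isSwitch_cycle hvp).map x hx
      · rw [hC, hpe, orbit_one, Finset.mem_singleton] at hx
        rw [hx] at hper
        exact absurd hper hvp
  · have hcases : Disjoint D C ∧ ((s₅.wreg 2 = ∑ y ∈ C, edgeWeight s (s.arr 9 y - 1) (g y) ∧
        IsSwitch g C C ∧ ∀ T, IsSwitch g (D ∪ C) T → Disjoint T C ∨ C ⊆ T) ∨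
        (s₅.wreg 2 = ∞ ∧ ∀ T, IsSwitch g (D ∪ C) T → Disjoint T C)) := by
      rcases hs₁ with ⟨hcy, hvp, hpe⟩ | ⟨hcy, hvp, hpe⟩
      · rw [hcy, if_pos rfl] at w2
        rw [hpe] at hC
        exact ⟨hC ▸ disjoint_cycle hvp hD hvD, Or.inl ⟨w2, hC ▸ isSwitch_cycle hvp,
          fun T hT => hC ▸ hT.cycle_subset⟩⟩
      · rw [hcy, if_neg (by norm_num)] at w2
        rw [hpe, orbit_one] at hC
        refine ⟨by simpa [hC] using hvD, Or.inr ⟨w2, fun T hT => ?_⟩⟩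
        rw [hC, Finset.disjoint_singleton_right]
        exact fun h => hvp (hT.periodic v h)
    exact hdp.extend hcases.1 hD w1 hcases.2 f₀ f₁ hs₆

theorem runs_solve {s : State} {V : Finset ℕ} (hn : 1 ≤ s.reg 0)
    (hV : ∀ v, v ∈ V ↔ v < s.reg 0 ∧ s.arr 0 v = 0)
    (hg : ∀ v ∈ V, step (s.arr 7) (s.arr 8) (s.arr 9) v ∈ V) (hocc : ∀ v ∈ V, s.arr 9 v ≠ 0)
    (hvis : ∀ y, s.arr 10 y = 0) :
    Runs solve s (s.reg 0 * (s.reg 0 * 50 + s.reg 3 * 20 + s.reg 0 * (s.reg 3 * 100 + 107) +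
      s.reg 3 * (2 ^ s.reg 3 * 40 + 20) + 2 ^ s.reg 3 * 50 + 140) + s.reg 3 * 20 +
      2 ^ s.reg 3 * 20 + 30) fun s' =>
      s'.reg 7 = 2 ^ s.reg 3 ∧
      IsTable (step (s.arr 7) (s.arr 8) (s.arr 9)) (fun v => edgeWeight s (s.arr 9 v - 1))
        (fun v => Sat s (s.arr 9 v - 1)) (s.reg 3) V (s'.warr 3) := by
  have hVn : V.card ≤ s.reg 0 := by
    have : V ⊆ Finset.range (s.reg 0) := fun v hv => Finset.mem_range.2 ((hV v).1 hv).1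
    simpa using Finset.card_le_card this
  set g := step (s.arr 7) (s.arr 8) (s.arr 9) with hgdef
  set n := s.reg 0 with hndef
  set c := s.reg 3 with hcdef
  set B := n * 50 + c * 20 + n * (c * 100 + 107) + c * (2 ^ c * 40 + 20) + 2 ^ c * 50 + 120 with hB
  refine (Runs.seq (T := 2) (T' := (c * 20 + 5) + ((2 ^ c * 20 + 5) + (3 + (n * (B + 20) + 5))))
    (R := fun s' => s'.reg 7 = 1)
    (Runs.of_wp_le (by decide) (by simp [Prog.wp, NExp.eval])) ?_).mono ?_ fun _ _ h => h
  swap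
  · have : n * (n * 50 + c * 20 + n * (c * 100 + 107) + c * (2 ^ c * 40 + 20) + 2 ^ c * 50 + 140) =
      n * (B + 20) := by rw [hB]
    omega
  intro s₁ hF₁ r7
  have r3 := hF₁.reg 3 (by decide)
  have hpow := Runs.forLoop (r := 5) (N := 3) (s := s₁) (T := 13)
    (P := .setReg 7 (.add (.reg 7) (.reg 7))) (by decide) (by decide) (by decide)
    (fun k s' => s'.reg 7 = 2 ^ k) (by simpa using r7) ?_
  swap
  · intro k _ s' _ _ h
    refine Runs.of_wp_le (by decide) ?_
    simp only [Prog.wp, NExp.eval, State.putReg_reg, h]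
    simp [pow_succ, mul_two]
  rw [r3] at hpow
  refine hpow.seq ?_
  intro s₂ hF₂ r7
  have hinf := Runs.forLoop (r := 5) (N := 7) (s := s₂) (T := 13)
    (P := .setWArr 3 (.reg 5) .infty) (by decide) (by decide) (by decide)
    (fun k s' => ∀ S < k, s'.warr 3 S = ∞) (by simp) ?_
  swap
  · intro k _ s' _ hk hI
    refine Runs.of_wp_le (by decide) ?_
    intro S hS
    by_cases hSk : S = k
    · simp [WExp.eval, NExp.eval, hk, hSk]
    · simpa [WExp.eval, NExp.eval, hk, hSk] using hI S (by omega)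
  rw [r7] at hinf
  refine hinf.seq ?_
  intro s₃ hF₃ hs₃
  refine Runs.seq (T := 3) (R := fun s' => s'.warr 3 0 = 0 ∧ ∀ S < 2 ^ c, S ≠ 0 → s'.warr 3 S = ∞)
    (Runs.of_wp_le (by decide) ?_) ?_
  · refine ⟨by simp [NExp.eval, WExp.eval], fun S hS hS0 => ?_⟩
    simpa [NExp.eval, hS0] using hs₃ S hS
  rintro s₄ hF₄ ⟨z0, zi⟩
  have e7 : s₄.reg 7 = 2 ^ c :=
    ((hF₄.reg 7 (by decide)).trans (hF₃.reg 7 (by decide))).trans r7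
  have ereg : ∀ r ∈ [0, 3], s₄.reg r = s.reg r := by
    intro r hr
    refine ((hF₄.reg r ?_).trans (hF₃.reg r ?_)).trans ((hF₂.reg r ?_).trans (hF₁.reg r ?_)) <;>
    · revert r
      decide
  have earr : s₄.arr = s.arr := by
    ext1 A
    exact ((hF₄.arr A (by simp [Prog.arrs])).trans
      (hF₃.arr A (by simp [Prog.arrs, Prog.forLoop]))).trans
      ((hF₂.arr A (by simp [Prog.arrs, Prog.forLoop])).trans (hF₁.arr A (by simp [Prog.arrs])))
  have ewarr : ∀ A ∈ [1, 2], s₄.warr A = s.warr A := by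
    intro r hr
    refine ((hF₄.warr r ?_).trans (hF₃.warr r ?_)).trans
      ((hF₂.warr r ?_).trans (hF₁.warr r ?_)) <;>
    · revert r
      decide
  -- The processed set `D` contains all vertices of `V` below k, and possibly larger ones, since a
  -- cycle is treated as a whole at its first vertex.
  have hloop := Runs.forLoop (r := 4) (N := 0) (s := s₄) (T := B + 13)
    (P := .cond (.eq (.arr 0 (.reg 4)) (.lit 0))
            (.cond (.eq (.arr 10 (.reg 4)) (.lit 0)) component .skip) .skip)
    (by decide) (by decide) (by decide) (fun k s' => ∃ D : Finset ℕ, D ⊆ V ∧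
      (∀ v ∈ V, v < k → v ∈ D) ∧ (∀ y, s'.arr 10 y = if y ∈ D then 1 else 0) ∧
      (∀ v ∈ D, v ∈ Function.periodicPts g → g v ∈ D) ∧
      IsTable g (fun v => edgeWeight s (s.arr 9 v - 1)) (fun v => Sat s (s.arr 9 v - 1)) c D
        (s'.warr 3)) ?_ ?_
  · rw [ereg 0 (by simp)] at hloop
    refine hloop.mono (by rw [add_assoc]) ?_
    rintro s' hF ⟨D, hDV, hVD, -, -, hT⟩
    have : D = V := Finset.Subset.antisymm hDV fun v hv => hVD v hv ((hV v).1 hv).1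
    exact ⟨(hF.reg 7 (by decide)).trans e7, this ▸ hT⟩
  · refine ⟨∅, by simp, by simp, ?_, by simp, isTable_empty z0 zi⟩
    simpa [earr] using hvis
  · rintro k hk s' hF hk4 ⟨D, hDV, hVD, hvis', hD, hT⟩
    rw [ereg 0 (by simp)] at hk
    have k0 : s'.reg 0 = n := (hF.reg 0 (by decide)).trans (ereg 0 (by simp))
    have k3 : s'.reg 3 = c := (hF.reg 3 (by decide)).trans (ereg 3 (by simp))
    have k7 : s'.reg 7 = 2 ^ c := (hF.reg 7 (by decide)).trans e7
    have karr : ∀ A ∈ [0, 3, 4, 5, 7, 8, 9], s'.arr A = s.arr A := by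
      intro A hA
      rw [← earr]
      refine hF.arr A ?_
      revert A
      decide
    have kwarr : ∀ A ∈ [1, 2], s'.warr A = s.warr A := by
      intro A hA
      rw [← ewarr A hA]
      refine hF.warr A ?_
      revert A
      decide
    have kstep : step (s'.arr 7) (s'.arr 8) (s'.arr 9) = g := by
      rw [karr 7 (by simp), karr 8 (by simp), karr 9 (by simp)]
    have kw : edgeWeight s' = edgeWeight s := by
      ext
      simp only [edgeWeight, karr 7 (by simp), kwarr 1 (by simp), kwarr 2 (by simp)]
    have ks : Sat s' = Sat s := by
      ext
      simp only [Sat, karr 3 (by simp), karr 4 (by simp), karr 5 (by simp)]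
    refine (Runs.cond (T := B + 5) (fun h => ?_) (fun h => ?_)).mono
      (by simp only [Test.cost, NExp.cost]; omega) fun _ _ h => h
    · simp only [Test.Holds, NExp.eval, karr 0 (by simp), hk4] at h
      have hkV : k ∈ V := (hV k).2 ⟨hk, h⟩
      refine (Runs.cond (T := B) (fun h => ?_) (fun h => ?_)).mono
        (by simp only [Test.cost, NExp.cost]; omega) fun _ _ h => h
      · simp only [Test.Holds, NExp.eval, hk4, hvis'] at h
        have hkD : k ∉ D := fun hD => by simp [hD] at h
        have hrun := runs_component (s := s') (D := D) (V := V) (by rw [k7, k3])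
          (by rw [k0]; exact hVn) (by rw [k0]; exact hn) (by rw [kstep]; exact hg)
          (by rw [karr 9 (by simp)]; exact hocc) (by rw [hk4]; exact hkV) (by rw [hk4]; exact hkD)
          hvis' hDV (by rw [kstep]; exact hD)
          (by rw [kstep, kw, ks, karr 9 (by simp), k3]; exact hT)
        rw [kstep, kw, ks, karr 9 (by simp), k3, k0, hk4, ← hB] at hrun
        refine hrun.mono le_rfl ?_
        rintro s'' - ⟨D', h1, h2, h3, h4, h5, h6⟩
        refine ⟨D', h2, fun v hv hvk => ?_, by simpa using h4, h5, by simpa using h6⟩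
        by_cases hvk' : v = k
        · rwa [hvk']
        · exact h1 (hVD v hv (by omega))
      · simp only [Test.Holds, NExp.eval, hk4, hvis'] at h
        have hkD : k ∈ D := by
          by_contra hD
          simp [hD] at h
        refine Runs.skip ⟨D, hDV, fun v hv hvk => ?_, by simpa using hvis', hD, by simpa using hT⟩
          (by omega)
        by_cases hvk' : v = k
        · rwa [hvk']
        · exact hVD v hv (by omega)
    · simp only [Test.Holds, NExp.eval, karr 0 (by simp), hk4] at h
      refine Runs.skip ⟨D, hDV, fun v hv hvk => ?_, by simpa using hvis', hD, by simpa using hT⟩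
        (by omega)
      have : v ≠ k := fun he => h (he ▸ ((hV v).1 hv).2)
      exact hVD v hv (by omega)

end CBMProgram

/-! ### Reading the input and assembling the decision procedure. -/

namespace CBMProgram

open RAM TwoChoice

/-- The end on the first side of the edge with index `i`. -/
def leftEnd (s : State) (i : ℕ) : ℕ :=
  if s.arr 0 (s.arr 1 i) = 1 then s.arr 1 i else s.arr 2 i

/-- The end on the second side of the edge with index `i`. -/
def rightEnd (s : State) (i : ℕ) : ℕ :=
  if s.arr 0 (s.arr 1 i) = 1 then s.arr 2 i else s.arr 1 i

/-- Test in register `8` whether both sides have the same size. -/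
def compareSides : Prog :=
  .seq (.forLoop 4 0 (.setReg 12 (.add (.reg 12) (.arr 0 (.reg 4)))))
    (.cond (.eq (.add (.reg 12) (.reg 12)) (.reg 0)) (.setReg 8 (.lit 1)) (.setReg 8 (.lit 0)))

/-- Store the at most two neighbours of every vertex `u` of the first side, and the weights of the
edges to them, in the entries with index `u` of the arrays `7` and `8` and the weight arrays `1` and
`2`; mark in array `6` the vertices that have a neighbour. -/
def listNeighbours : Prog :=
  .forLoop 4 1 (.seq
    (.cond (.eq (.arr 0 (.arr 1 (.reg 4))) (.lit 1))
      (.seq (.setReg 9 (.arr 1 (.reg 4))) (.setReg 10 (.arr 2 (.reg 4))))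
      (.seq (.setReg 9 (.arr 2 (.reg 4))) (.setReg 10 (.arr 1 (.reg 4)))))
    (.seq
      (.cond (.eq (.arr 6 (.reg 9)) (.lit 0))
        (.seq (.setArr 6 (.reg 9) (.lit 1))
          (.seq (.setArr 7 (.reg 9) (.reg 10)) (.setWArr 1 (.reg 9) (.arr 0 (.reg 4))))) .skip)
      (.seq (.setArr 8 (.reg 9) (.reg 10)) (.setWArr 2 (.reg 9) (.arr 0 (.reg 4))))))

/-- Output a truth value. -/
def output (b : Test) : Prog := .cond b (.setReg 0 (.lit 1)) (.setReg 0 (.lit 0))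

/-- The decision procedure for nonempty graphs. -/
def decideNonempty : Prog :=
  .seq compareSides (.seq listNeighbours (.seq augmentAll
    (.cond (.eq (.reg 8) (.lit 1))
      (.seq solve (output (.wle (.arr 3 (.sub (.reg 7) (.lit 1))) (.reg 0))))
      (.setReg 0 (.lit 0)))))

/-- The decision procedure for Conjoining Bipartite Matching. -/
def decideCBM : Prog :=
  .cond (.eq (.reg 0) (.lit 0)) (output (.eq (.reg 3) (.lit 0))) decideNonempty

theorem runs_compareSides {s : State} (h12 : s.reg 12 = 0) :
    Runs compareSides s (s.reg 0 * 20 + 20) fun s' =>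
      (s'.reg 8 = 1 ∧ 2 * ∑ i ∈ Finset.range (s.reg 0), s.arr 0 i = s.reg 0) ∨
      (s'.reg 8 = 0 ∧ 2 * ∑ i ∈ Finset.range (s.reg 0), s.arr 0 i ≠ s.reg 0) := by
  refine ((Runs.forLoop (T := 13) (by decide) (by decide) (by decide) (fun k s' =>
    s'.reg 12 = ∑ i ∈ Finset.range k, s.arr 0 i) (by simpa using h12) ?_).seq (T' := 10) ?_).mono
    (by omega) fun _ _ h => h
  · intro k _ s' hF hk hI
    have a0 := hF.arr 0 (by decide)
    refine Runs.of_wp_le (by decide) ?_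
    simp [Prog.wp, NExp.eval, hk, hI, a0, Finset.sum_range_succ]
  · intro s' hF hI
    have r0 := hF.reg 0 (by decide)
    refine Runs.of_wp_le (by decide) ⟨fun h => ?_, fun h => ?_⟩ <;>
      simp only [Test.Holds, NExp.eval, hI, r0, ← two_mul] at h
    · left
      simpa [Prog.wp, NExp.eval] using h
    · right
      simpa [Prog.wp, NExp.eval] using h

/-- The neighbours of `u` along the edges with index below `k` are listed in `s'`. -/
def Listed (s s' : State) (k u : ℕ) : Prop :=
  (s'.arr 6 u = 0 ∧ ∀ i < k, leftEnd s i ≠ u) ∨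
  (s'.arr 6 u = 1 ∧ ∃ i < k, ∃ j < k, leftEnd s i = u ∧ leftEnd s j = u ∧
    s'.arr 7 u = rightEnd s i ∧ s'.warr 1 u = s.warr 0 i ∧
    s'.arr 8 u = rightEnd s j ∧ s'.warr 2 u = s.warr 0 j ∧
    ∀ l < k, leftEnd s l = u → l = i ∨ l = j)

/-- The first edge at u fills both slots and a later edge overwrites the second one. A vertex of
degree one thus has two equal neighbours, and the degree bound ensures that nothing is lost. -/
theorem runs_listNeighbours {s : State} (h6 : ∀ u, s.arr 6 u = 0)
    (hdeg : ∀ i < s.reg 1, ∀ j < i, ∀ l < j, leftEnd s i = leftEnd s j →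
      leftEnd s j ≠ leftEnd s l) :
    Runs listNeighbours s (s.reg 1 * 50 + 5) fun s' => ∀ u, Listed s s' (s.reg 1) u := by
  refine (Runs.forLoop (T := 43) (by decide) (by decide) (by decide) (fun k s' =>
    ∀ u, Listed s s' k u) (fun u => Or.inl ⟨by simpa using h6 u, by simp⟩) ?_).mono le_rfl
    fun _ _ h => h
  intro k hk s₁ hF hk4 hI
  have a0 := hF.arr 0 (by decide)
  have a1 := hF.arr 1 (by decide)
  have a2 := hF.arr 2 (by decide)
  have w0 := hF.warr 0 (by decide)
  have h1 : Runs (.cond (.eq (.arr 0 (.arr 1 (.reg 4))) (.lit 1))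
      (.seq (.setReg 9 (.arr 1 (.reg 4))) (.setReg 10 (.arr 2 (.reg 4))))
      (.seq (.setReg 9 (.arr 2 (.reg 4))) (.setReg 10 (.arr 1 (.reg 4))))) s₁ 15 fun s' =>
      s'.reg 9 = leftEnd s k ∧ s'.reg 10 = rightEnd s k ∧ s'.reg 4 = k := by
    refine Runs.of_wp_le (by decide) ⟨fun h => ?_, fun h => ?_⟩ <;>
    · simp only [Test.Holds, NExp.eval, a0, a1, hk4] at h
      simp [Prog.wp, NExp.eval, a1, a2, hk4, leftEnd, rightEnd, h]
  refine (h1.seq (T' := 28) ?_).mono le_rfl fun _ _ h => h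
  rintro s₂ hF₂ ⟨r9, r10, r4⟩
  rw [← hF₂.warr 0 (by decide)] at w0
  replace hI : ∀ u, Listed s s₂ k u := by
    intro u
    have := hI u
    rwa [Listed, ← hF₂.arr 6 (by decide), ← hF₂.arr 7 (by decide), ← hF₂.arr 8 (by decide),
      ← hF₂.warr 1 (by decide), ← hF₂.warr 2 (by decide)] at this
  have other : ∀ (s' : State) (u : ℕ), u ≠ leftEnd s k → s'.arr 6 u = s₂.arr 6 u →
      s'.arr 7 u = s₂.arr 7 u → s'.arr 8 u = s₂.arr 8 u → s'.warr 1 u = s₂.warr 1 u →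
      s'.warr 2 u = s₂.warr 2 u → Listed s s' (k + 1) u := by
    intro s' u hu e6 e7 e8 e1 e2
    rw [Listed, e6, e7, e8, e1, e2]
    rcases hI u with ⟨h, h'⟩ | ⟨h, i, hi, j, hj, hli, hlj, h7, h1, h8, h2, hall⟩
    · refine Or.inl ⟨h, fun i hi => ?_⟩
      by_cases hik : i = k
      · rw [hik]
        exact hu.symm
      · exact h' i (by omega)
    · refine Or.inr ⟨h, i, by omega, j, by omega, hli, hlj, h7, h1, h8, h2, fun l hl hlu => ?_⟩
      by_cases hlk : l = k
      · rw [hlk] at hlu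
        exact absurd hlu.symm hu
      · exact hall l (by omega) hlu
  refine Runs.of_wp_le (by decide) ⟨fun h => ?_, fun h => ?_⟩ <;>
    simp only [Test.Holds, NExp.eval, r9] at h <;> intro u <;> by_cases hu : u = leftEnd s k
  · rcases hI u with ⟨-, h'⟩ | ⟨h', -⟩
    · refine Or.inr ⟨by simp [NExp.eval, r9, hu], k, by omega, k, by omega, hu.symm, hu.symm, ?_, ?_,
        ?_, ?_, ?_⟩
      · simp [NExp.eval, r9, r10, hu]
      · simp [NExp.eval, WExp.eval, r9, r4, hu, w0]
      · simp [NExp.eval, r9, r10, hu]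
      · simp [NExp.eval, WExp.eval, r9, r4, hu, w0]
      · intro l hl hlu
        by_contra hlk
        exact h' l (by omega) hlu
    · rw [hu, h] at h'
      simp at h'
  · apply other _ u hu <;> simp [NExp.eval, r9, hu]
  · rcases hI u with ⟨h', -⟩ | ⟨h', i, hi, j, hj, hli, hlj, h7, h1, h8, h2, hall⟩
    · rw [hu] at h'
      exact absurd h' h
    · have hij : i = j := by
        by_contra hne
        rcases lt_or_gt_of_ne hne with hlt | hlt
        · exact hdeg k hk j hj i hlt (by rw [← hu, hlj]) (by rw [hlj, hli])
        · exact hdeg k hk i hi j hlt (by rw [← hu, hli]) (by rw [hlj, hli])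
      refine Or.inr ⟨by simpa [Prog.wp] using h', i, by omega, k, by omega, hli, hu.symm,
        by simpa [Prog.wp] using h7, by simpa [Prog.wp] using h1, ?_, ?_, ?_⟩
      · simp [NExp.eval, r9, r10, hu]
      · simp [NExp.eval, WExp.eval, r9, r4, hu, w0]
      · intro l hl hlu
        by_cases hlk : l = k
        · exact Or.inr hlk
        · have := hall l (by omega) hlu
          rw [← hij, or_self] at this
          exact Or.inl this
  · apply other _ u hu <;> simp [NExp.eval, r9, hu]

/-- There is a perfect matching of weight at most the weight in register `0` that satisfies all
joins. -/
def HasSolution (s : State) (V₁ V₂ : Finset ℕ) (W : ℕ → ℕ → ℝ≥0∞) : Prop :=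
  V₁.card = V₂.card ∧ ∃ x : ℕ → ℕ, (∀ u ∈ V₁, ∃ i < s.reg 1, leftEnd s i = u ∧ rightEnd s i = x u) ∧
    Set.InjOn x V₁ ∧ (∀ j < s.reg 3, ∃ u ∈ V₁, Sat s u (x u) j) ∧
    ∑ u ∈ V₁, W u (x u) ≤ s.wreg 0

theorem runs_output {s : State} {b : Test} {P : Prop} (h : b.Holds s ↔ P) :
    Runs (output b) s (b.cost + 2) fun s' => (P → s'.reg 0 = 1) ∧ (¬ P → s'.reg 0 = 0) := by
  refine Runs.of_wp_le (by simp [output, Prog.bound, NExp.cost]) ⟨fun hb => ?_, fun hb => ?_⟩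
  · simpa [Prog.wp, NExp.eval] using h.1 hb
  · simpa [Prog.wp, NExp.eval] using fun hP => hb (h.2 hP)

theorem runs_decideNonempty {s : State} {V₁ V₂ : Finset ℕ} {W : ℕ → ℕ → ℝ≥0∞} (hn : 1 ≤ s.reg 0)
    (hV₁ : ∀ v, v ∈ V₁ ↔ v < s.reg 0 ∧ s.arr 0 v = 1)
    (hV₂ : ∀ v, v ∈ V₂ ↔ v < s.reg 0 ∧ s.arr 0 v = 0) (hmark : ∀ v, s.arr 0 v ≤ 1)
    (h6 : ∀ u, s.arr 6 u = 0) (h9 : ∀ u, s.arr 9 u = 0) (h10 : ∀ u, s.arr 10 u = 0)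
    (h12 : s.reg 12 = 0) (hω : s.wreg 0 ≠ ∞)
    (hedge : ∀ i < s.reg 1, leftEnd s i ∈ V₁ ∧ rightEnd s i ∈ V₂)
    (hdeg : ∀ i < s.reg 1, ∀ j < i, ∀ l < j, leftEnd s i = leftEnd s j →
      leftEnd s j ≠ leftEnd s l)
    (hW : ∀ i < s.reg 1, W (leftEnd s i) (rightEnd s i) = s.warr 0 i) :
    Runs decideNonempty s (s.reg 0 * 20 + s.reg 1 * 50 + s.reg 0 * (s.reg 0 * 150 + 150) +
      (s.reg 0 * (s.reg 0 * 50 + s.reg 3 * 20 + s.reg 0 * (s.reg 3 * 100 + 107) +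
      s.reg 3 * (2 ^ s.reg 3 * 40 + 20) + 2 ^ s.reg 3 * 50 + 140) + s.reg 3 * 20 +
      2 ^ s.reg 3 * 20) + 100) fun s' =>
      (HasSolution s V₁ V₂ W → s'.reg 0 = 1) ∧ (¬ HasSolution s V₁ V₂ W → s'.reg 0 = 0) := by
  set n := s.reg 0 with hndef
  set m := s.reg 1 with hmdef
  set c := s.reg 3 with hcdef
  set Y := HasSolution s V₁ V₂ W with hY
  set Tsol := n * (n * 50 + c * 20 + n * (c * 100 + 107) + c * (2 ^ c * 40 + 20) + 2 ^ c * 50 + 140) +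
    c * 20 + 2 ^ c * 20 with hTsol
  have hcards : V₁.card + V₂.card = n ∧ ∑ i ∈ Finset.range n, s.arr 0 i = V₁.card := by
    have e1 : V₁ = (Finset.range n).filter fun v => s.arr 0 v = 1 := by
      ext v
      simp [hV₁]
    have e2 : V₂ = (Finset.range n).filter fun v => ¬ s.arr 0 v = 1 := by
      ext v
      have := hmark v
      simp only [hV₂, Finset.mem_filter, Finset.mem_range]
      refine and_congr_right fun _ => by omega
    refine ⟨?_, ?_⟩
    · rw [e1, e2, Finset.card_filter_add_card_filter_not, Finset.card_range]
    · rw [e1, Finset.card_filter]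
      refine Finset.sum_congr rfl fun v _ => ?_
      have := hmark v
      split_ifs <;> omega
  refine ((runs_compareSides h12).seq (T' := (m * 50 + 5) + ((n * (n * 150 + 150) + 5) +
    (4 + ((Tsol + 30) + 10)))) ?_).mono (by omega) fun _ _ h => h
  intro s₁ hF₁ hs₁
  have hok : (s₁.reg 8 = 1 ∧ V₁.card = V₂.card) ∨ (s₁.reg 8 = 0 ∧ ¬ Y) := by
    rw [hcards.2] at hs₁
    refine hs₁.imp (fun h => ⟨h.1, by omega⟩) fun h => ⟨h.1, fun hY => h.2 ?_⟩
    have := hY.1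
    omega
  have hle : ∀ i, leftEnd s₁ i = leftEnd s i ∧ rightEnd s₁ i = rightEnd s i := by
    intro i
    simp only [leftEnd, rightEnd, hF₁.arr 0 (by decide), hF₁.arr 1 (by decide),
      hF₁.arr 2 (by decide), and_self]
  have hlist := runs_listNeighbours (s := s₁)
    (by rw [hF₁.arr 6 (by decide)]; exact h6)
    (by simpa only [hle, hF₁.reg 1 (by decide)] using hdeg)
  rw [hF₁.reg 1 (by decide)] at hlist
  refine hlist.seq ?_
  intro s₂ hF₂ hs₂
  simp only [Listed, hle, hF₁.warr 0 (by decide)] at hs₂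
  rw [← hF₂.reg 8 (by decide)] at hok
  have g0 : s₂.reg 0 = n := (hF₂.reg 0 (by decide)).trans (hF₁.reg 0 (by decide))
  have b0 : s₂.arr 0 = s.arr 0 := (hF₂.arr 0 (by decide)).trans (hF₁.arr 0 (by decide))
  have b9 : s₂.arr 9 = s.arr 9 := (hF₂.arr 9 (by decide)).trans (hF₁.arr 9 (by decide))
  -- From here on, being joined to u by a listed edge means being one of its two stored neighbours.
  have hone : ∀ u, s₂.arr 6 u = 1 → ∀ l,
      (∃ i < m, leftEnd s i = u ∧ rightEnd s i = l) ↔ (l = s₂.arr 7 u ∨ l = s₂.arr 8 u) := by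
    intro u hu l
    rcases hs₂ u with ⟨h, -⟩ | ⟨-, i, hi, j, hj, hli, hlj, k7, -, k8, -, hall⟩
    · omega
    rw [k7, k8]
    constructor
    · rintro ⟨i', hi', hl, rfl⟩
      rcases hall i' hi' hl with rfl | rfl <;> simp
    · rintro (rfl | rfl)
      exacts [⟨i, hi, hli, rfl⟩, ⟨j, hj, hlj, rfl⟩]
  have hfound : Y → ∀ u ∈ V₁, s₂.arr 6 u = 1 := by
    rintro ⟨-, x, hx, -⟩ u hu
    obtain ⟨i, hi, hl, -⟩ := hx u hu
    rcases hs₂ u with ⟨-, h⟩ | ⟨h, -⟩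
    · exact absurd hl (h i hi)
    · exact h
  have hVm : ∀ u ∈ V₁, s₂.arr 6 u = 1 → s₂.arr 7 u ∈ V₂ ∧ s₂.arr 8 u ∈ V₂ := by
    intro u _ hu
    obtain ⟨i, hi, -, hr⟩ := (hone u hu (s₂.arr 7 u)).2 (Or.inl rfl)
    obtain ⟨j, hj, -, hr'⟩ := (hone u hu (s₂.arr 8 u)).2 (Or.inr rfl)
    exact ⟨hr ▸ (hedge i hi).2, hr' ▸ (hedge j hj).2⟩
  have haug := runs_augmentAll (s := s₂) (V₁ := V₁) (V₂ := V₂) (bad := ¬ Y)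
    (by rw [g0, b0]; exact hV₁) hVm (by rw [g0]; omega) (by rw [b9]; exact h9)
    (hok.imp (fun h => h.1) id) (fun u hu h hY => h (hfound hY u hu))
    (fun h hY => by
      obtain ⟨-, x, hx, hinj, -⟩ := id hY
      exact h x (fun u hu => (hone u (hfound hY u hu) _).1 (hx u hu)) hinj)
  rw [g0] at haug
  refine haug.seq ?_
  intro s₃ hF₃ hs₃
  have earr : ∀ A ∈ [0, 3, 4, 5, 10], s₃.arr A = s.arr A := by
    intro A hA
    refine (hF₃.arr A ?_).trans ((hF₂.arr A ?_).trans (hF₁.arr A ?_)) <;>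
    · revert A
      decide
  have ereg : ∀ r ∈ [0, 3], s₃.reg r = s.reg r := by
    intro r hr
    refine (hF₃.reg r ?_).trans ((hF₂.reg r ?_).trans (hF₁.reg r ?_)) <;>
    · revert r
      decide
  have ewreg : s₃.wreg 0 = s.wreg 0 :=
    (hF₃.wreg 0 (by decide)).trans ((hF₂.wreg 0 (by decide)).trans (hF₁.wreg 0 (by decide)))
  have e7 : s₃.arr 7 = s₂.arr 7 := hF₃.arr 7 (by decide)
  have e8 : s₃.arr 8 = s₂.arr 8 := hF₃.arr 8 (by decide)
  refine (Runs.cond (T := (Tsol + 30) + 10) (fun h => ?_) (fun h => ?_)).mono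
    (by simp only [Test.cost, NExp.cost]; omega) fun _ _ h => h
  swap
  · simp only [Test.Holds, NExp.eval] at h
    refine Runs.of_wp_le (by simp only [Prog.bound, NExp.cost]; omega) ?_
    have hnot : ¬ Y := (hs₃.resolve_left fun h' => h h'.1).2
    simp [Prog.wp, NExp.eval, hnot]
  simp only [Test.Holds, NExp.eval] at h
  obtain ⟨-, hok', hM, hhas⟩ := hs₃.resolve_right fun h' => by omega
  have hcard : V₁.card = V₂.card := (hok.resolve_right fun h' => by omega).2
  have hVab : ∀ u ∈ V₁, s₃.arr 7 u ∈ V₂ ∧ s₃.arr 8 u ∈ V₂ := by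
    rw [e7, e8]
    exact fun u hu => hVm u hu (hhas u hu)
  rw [← e7, ← e8] at hM
  have hsolve := runs_solve (s := s₃) (V := V₂) (by rw [ereg 0 (by simp)]; exact hn)
    (by rw [ereg 0 (by simp), earr 0 (by simp)]; exact hV₂)
    (fun v hv => hM.step_mem hVab hv) (fun v hv => hM.occ_ne_zero hVab hcard hv)
    (by rw [earr 10 (by simp)]; exact h10)
  rw [ereg 0 (by simp), ereg 3 (by simp), ← hndef, ← hcdef, ← hTsol] at hsolve
  refine hsolve.seq ?_
  rintro s₄ hF₄ ⟨r7, hT⟩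
  refine (runs_output ?_).mono (by decide) fun _ _ h => h
  simp only [Test.Holds, WExp.eval, NExp.eval, r7]
  have w4 : s₄.wreg 0 = s.wreg 0 := (hF₄.wreg 0 (by decide)).trans ewreg
  rw [w4, hT.le_iff (by have := Nat.two_pow_pos c; omega) hω,
    ← exists_solution_iff hM hVab hcard (edgeWeight s₃) (Sat s₃) c (s.wreg 0)]
  have hsat : Sat s₃ = Sat s := by
    ext
    simp only [Sat, earr 3 (by simp), earr 4 (by simp), earr 5 (by simp)]
  rw [hsat, hY, HasSolution, e7, e8]
  have hchoice : ∀ x : ℕ → ℕ, (∀ u ∈ V₁, x u = s₂.arr 7 u ∨ x u = s₂.arr 8 u) ↔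
      ∀ u ∈ V₁, ∃ i < s.reg 1, leftEnd s i = u ∧ rightEnd s i = x u := fun x =>
    forall₂_congr fun u hu => (hone u (hhas u hu) (x u)).symm
  have hsum : ∀ x : ℕ → ℕ, (∀ u ∈ V₁, x u = s₂.arr 7 u ∨ x u = s₂.arr 8 u) →
      ∑ u ∈ V₁, edgeWeight s₃ u (x u) = ∑ u ∈ V₁, W u (x u) := by
    intro x hx
    refine Finset.sum_congr rfl fun u hu => ?_
    rcases hs₂ u with ⟨h, -⟩ | ⟨-, i, hi, j, hj, hli, hlj, k7, k1, k8, k2, -⟩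
    · have := hhas u hu
      omega
    rw [edgeWeight, e7, hF₃.warr 1 (by decide), hF₃.warr 2 (by decide), k1, k2]
    split_ifs with hxa
    · rw [hxa, k7, ← hW i hi, hli]
    · rw [(hx u hu).resolve_left hxa, k8, ← hW j hj, hlj]
  constructor
  · rintro ⟨x, hx, h1, h2, h3⟩
    exact ⟨hcard, x, (hchoice x).1 hx, h1, h2, hsum x hx ▸ h3⟩
  · rintro ⟨-, x, hx, h1, h2, h3⟩
    exact ⟨x, (hchoice x).2 hx, h1, h2, (hsum x ((hchoice x).2 hx)).trans_le h3⟩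

end CBMProgram

/-! ## Perfect matchings as functions -/

namespace CBMInstance

variable {I : CBMInstance}

theorem notMem_of_adj {u v : Fin I.n} (hu : u ∈ I.V₁) (h : I.G.Adj u v) : v ∉ I.V₁ := by
  rcases I.bipartite.mem_of_adj h with h | h
  · simpa using h.2
  · exact absurd hu (by simpa using h.1)

theorem mem_of_adj {u v : Fin I.n} (hu : u ∉ I.V₁) (h : I.G.Adj u v) : v ∈ I.V₁ := by
  rcases I.bipartite.mem_of_adj h with h | h
  · exact absurd (by simpa using h.1) hu
  · simpa using h.2

/-- Each matching edge has exactly one end in `V₁`, so u ↦ s(u, x u) is a bijection from `V₁` to the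
edges, and the infinite sum becomes a finite one. -/
theorem weight_eq_sum {M : I.G.Subgraph} {x : Fin I.n → Fin I.n}
    (hM : ∀ y z, M.Adj y z ↔ (y ∈ I.V₁ ∧ x y = z) ∨ (z ∈ I.V₁ ∧ x z = y)) :
    I.weight M = ∑ u ∈ I.V₁, I.ω s(u, x u) := by
  have hadj : ∀ u ∈ I.V₁, M.Adj u (x u) := fun u hu => (hM _ _).2 (Or.inl ⟨hu, rfl⟩)
  let f : I.V₁ → M.edgeSet := fun u => ⟨s(u, x u), hadj u u.2⟩
  have hf : Function.Bijective f := by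
    constructor
    · intro u u' h
      have h' : s(u.1, x u) = s(u'.1, x u') := congrArg Subtype.val h
      rcases Sym2.eq_iff.1 h' with h' | h'
      · exact Subtype.ext h'.1
      · exact absurd (h'.1 ▸ u.2) (notMem_of_adj u'.2 (hadj u' u'.2).adj_sub)
    · rintro ⟨e, he⟩
      induction e using Sym2.ind with
      | _ y z =>
        rcases (hM y z).1 he with ⟨h, rfl⟩ | ⟨h, rfl⟩
        · exact ⟨⟨y, h⟩, rfl⟩
        · exact ⟨⟨z, h⟩, Subtype.ext Sym2.eq_swap⟩
  rw [weight, ← (Equiv.ofBijective f hf).tsum_eq, tsum_fintype,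
    ← Finset.sum_coe_sort I.V₁ fun u => I.ω s(u, x u)]
  rfl

theorem satisfies_iff {M : I.G.Subgraph} {x : Fin I.n → Fin I.n}
    (hM : ∀ y z, M.Adj y z ↔ (y ∈ I.V₁ ∧ x y = z) ∨ (z ∈ I.V₁ ∧ x z = y)) (j : Sym2 (Fin I.k)) :
    I.Satisfies M j ↔ ∃ u ∈ I.V₁, ∀ i ∈ j, I.cellOf u = i ∨ I.cellOf (x u) = i := by
  constructor
  · rintro ⟨e, he, h⟩
    induction e using Sym2.ind with
    | _ y z =>
      simp only [Sym2.mem_iff, exists_eq_or_imp, exists_eq_left, cell, Set.mem_ofPred_eq] at h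
      rcases (hM y z).1 he with ⟨hy, rfl⟩ | ⟨hz, rfl⟩
      · exact ⟨y, hy, h⟩
      · exact ⟨z, hz, fun i hi => (h i hi).symm⟩
  · rintro ⟨u, hu, h⟩
    refine ⟨s(u, x u), (hM _ _).2 (Or.inl ⟨hu, rfl⟩), ?_⟩
    simpa only [Sym2.mem_iff, exists_eq_or_imp, exists_eq_left, cell, Set.mem_ofPred_eq] using h

/-- A perfect matching of a bipartite graph is the graph of a bijection from `V₁` to its complement
along edges; only the values of x on `V₁` matter. -/
theorem isYes_iff : I.IsYes ↔ ∃ x : Fin I.n → Fin I.n, (∀ u ∈ I.V₁, I.G.Adj u (x u)) ∧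
    Set.InjOn x I.V₁ ∧ (∀ v ∉ I.V₁, ∃ u ∈ I.V₁, x u = v) ∧
    (∀ j ∈ I.J, ∃ u ∈ I.V₁, ∀ i ∈ j, I.cellOf u = i ∨ I.cellOf (x u) = i) ∧
    ∑ u ∈ I.V₁, I.ω s(u, x u) ≤ I.ωmax := by
  constructor
  · rintro ⟨M, hM, hJ, hw⟩
    rw [SimpleGraph.Subgraph.isPerfectMatching_iff] at hM
    choose x hx hx' using hM
    have hadj : ∀ y z, M.Adj y z ↔ (y ∈ I.V₁ ∧ x y = z) ∨ (z ∈ I.V₁ ∧ x z = y) := by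
      intro y z
      constructor
      · intro h
        by_cases hy : y ∈ I.V₁
        · exact Or.inl ⟨hy, (hx' y z h).symm⟩
        · exact Or.inr ⟨mem_of_adj hy h.adj_sub, (hx' z y h.symm).symm⟩
      · rintro (⟨-, rfl⟩ | ⟨-, rfl⟩)
        exacts [hx y, (hx z).symm]
    refine ⟨x, fun u _ => (hx u).adj_sub, ?_, ?_, fun j hj => (satisfies_iff hadj j).1 (hJ j hj),
      weight_eq_sum hadj ▸ hw⟩
    · intro u _ u' _ h
      have h1 := hx' _ _ (hx u).symm
      have h2 := hx' _ _ (hx u').symm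
      rw [h1, h, ← h2]
    · intro v hv
      exact ⟨x v, mem_of_adj hv (hx v).adj_sub, (hx' _ _ (hx v).symm).symm⟩
  · rintro ⟨x, hx, hinj, hsurj, hJ, hw⟩
    let M : I.G.Subgraph :=
      { verts := Set.univ
        Adj := fun y z => (y ∈ I.V₁ ∧ x y = z) ∨ (z ∈ I.V₁ ∧ x z = y)
        adj_sub := by
          rintro y z (⟨h, rfl⟩ | ⟨h, rfl⟩)
          exacts [hx y h, (hx z h).symm]
        edge_vert := fun _ => Set.mem_univ _
        symm := ⟨fun y z h => Or.symm h⟩ }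
    have hadj : ∀ y z, M.Adj y z ↔ (y ∈ I.V₁ ∧ x y = z) ∨ (z ∈ I.V₁ ∧ x z = y) :=
      fun _ _ => Iff.rfl
    refine ⟨M, ?_, fun j hj => (satisfies_iff hadj j).2 (hJ j hj), (weight_eq_sum hadj).trans_le hw⟩
    rw [SimpleGraph.Subgraph.isPerfectMatching_iff]
    intro v
    by_cases hv : v ∈ I.V₁
    · refine ⟨x v, Or.inl ⟨hv, rfl⟩, ?_⟩
      rintro z (⟨-, h⟩ | ⟨hz, rfl⟩)
      · exact h.symm
      · exact absurd hv (notMem_of_adj hz (hx z hz))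
    · obtain ⟨u, hu, rfl⟩ := hsurj v hv
      refine ⟨u, Or.inr ⟨hu, rfl⟩, ?_⟩
      rintro z (⟨h, -⟩ | ⟨hz, h⟩)
      · exact absurd h hv
      · exact hinj hz hu h

end CBMInstance

/-! ## The initial memory -/

namespace CBMInstance.Listing

open RAM CBMProgram

variable {I : CBMInstance} (L : I.Listing)

theorem initialState_mark (v : Fin I.n) :
    L.initialState.arr 0 v = if v ∈ I.V₁ then 1 else 0 := by
  simp [initialState]

theorem initialState_cell (v : Fin I.n) : L.initialState.arr 3 v = I.cellOf v := by
  simp [initialState]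

theorem exists_ends {i : ℕ} (hi : i < L.edges.length) : ∃ u ∈ I.V₁, ∃ v, I.G.Adj u v ∧
    leftEnd L.initialState i = u ∧ rightEnd L.initialState i = v ∧
    s(L.edges[i].1, L.edges[i].2) = s(u, v) := by
  have h1 : L.initialState.arr 1 i = L.edges[i].1 := by simp [initialState, hi]
  have h2 : L.initialState.arr 2 i = L.edges[i].2 := by simp [initialState, hi]
  have hadj : I.G.Adj L.edges[i].1 L.edges[i].2 :=
    (L.mem_edges _).1 (List.mem_map.2 ⟨L.edges[i], List.getElem_mem hi, rfl⟩)
  rw [leftEnd, rightEnd, h1, h2, L.initialState_mark]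
  by_cases hm : L.edges[i].1 ∈ I.V₁
  · exact ⟨_, hm, _, hadj, by simp [hm], by simp [hm], rfl⟩
  · exact ⟨_, mem_of_adj hm hadj, _, hadj.symm, by simp [hm], by simp [hm], Sym2.eq_swap⟩

theorem exists_index {u v : Fin I.n} (hu : u ∈ I.V₁) (h : I.G.Adj u v) :
    ∃ i < L.edges.length, leftEnd L.initialState i = u ∧ rightEnd L.initialState i = v := by
  obtain ⟨p, hp, hpe⟩ := List.mem_map.1 ((L.mem_edges s(u, v)).2 h)
  obtain ⟨i, hi, rfl⟩ := List.mem_iff_getElem.1 hp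
  obtain ⟨u', hu', v', hadj, hl, hr, he⟩ := L.exists_ends hi
  refine ⟨i, hi, ?_⟩
  rw [hl, hr]
  rcases Sym2.eq_iff.1 (he.symm.trans hpe) with ⟨rfl, rfl⟩ | ⟨rfl, rfl⟩
  · exact ⟨rfl, rfl⟩
  · exact absurd hu' (notMem_of_adj hu h)

theorem index_injective {i j : ℕ} (hi : i < L.edges.length) (hj : j < L.edges.length)
    (hl : leftEnd L.initialState i = leftEnd L.initialState j)
    (hr : rightEnd L.initialState i = rightEnd L.initialState j) : i = j := by
  obtain ⟨u, -, v, -, hl₁, hr₁, h₁⟩ := L.exists_ends hi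
  obtain ⟨u', -, v', -, hl₂, hr₂, h₂⟩ := L.exists_ends hj
  rw [hl₁, hl₂, Fin.val_inj] at hl
  rw [hr₁, hr₂, Fin.val_inj] at hr
  have := List.nodup_iff_injective_get.1 L.edges_nodup
    (a₁ := ⟨i, by simpa using hi⟩) (a₂ := ⟨j, by simpa using hj⟩)
    (by simp [h₁, h₂, hl, hr])
  simpa using this

theorem length_edges_le : L.edges.length ≤ I.n * I.n := by
  simpa using (List.Nodup.of_map _ L.edges_nodup).length_le_card

theorem length_joins : L.joins.length = I.J.card := by
  rw [← List.length_map (fun p : Fin I.k × Fin I.k => s(p.1, p.2)),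
    ← List.toFinset_card_of_nodup L.joins_nodup]
  congr 1
  ext j
  rw [List.mem_toFinset, L.mem_joins]

theorem sat_iff {u v : Fin I.n} {j : ℕ} (hj : j < L.joins.length) :
    Sat L.initialState u v j ↔
      ∀ i ∈ s(L.joins[j].1, L.joins[j].2), I.cellOf u = i ∨ I.cellOf v = i := by
  have h1 : L.initialState.arr 4 j = L.joins[j].1 := by simp [initialState, hj]
  have h2 : L.initialState.arr 5 j = L.joins[j].2 := by simp [initialState, hj]
  simp only [Sat, initialState_cell, h1, h2, Fin.val_inj, Sym2.mem_iff, forall_eq_or_imp,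
    forall_eq]

/-- Distinct listed edges with the same end in `V₁` have distinct other ends, so three of them would
give three neighbours. -/
theorem degree_le {i j l : ℕ} (hdeg : ∀ v ∈ I.V₁, (I.G.neighborSet v).ncard ≤ 2)
    (hi : i < L.edges.length) (hj : j < i) (hl : l < j)
    (hij : leftEnd L.initialState i = leftEnd L.initialState j) :
    leftEnd L.initialState j ≠ leftEnd L.initialState l := by
  intro hjl
  obtain ⟨u, hu, v, hadj, hl₁, hr₁, -⟩ := L.exists_ends hi
  obtain ⟨u', -, v', hadj', hl₂, hr₂, -⟩ := L.exists_ends (hj.trans hi)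
  obtain ⟨u'', -, v'', hadj'', hl₃, hr₃, -⟩ := L.exists_ends (hl.trans (hj.trans hi))
  have h1 : v ≠ v' := fun h => hj.ne' (L.index_injective hi (hj.trans hi) hij (by rw [hr₁, hr₂, h]))
  have h2 : v' ≠ v'' := fun h =>
    hl.ne' (L.index_injective (hj.trans hi) (hl.trans (hj.trans hi)) hjl (by rw [hr₂, hr₃, h]))
  have h3 : v ≠ v'' := fun h => (hl.trans hj).ne'
    (L.index_injective hi (hl.trans (hj.trans hi)) (hij.trans hjl) (by rw [hr₁, hr₃, h]))
  rw [hl₂, hl₃, Fin.val_inj] at hjl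
  rw [hl₁, hl₂, Fin.val_inj] at hij
  subst hjl hij
  have hsub : (({v, v', v''} : Finset (Fin I.n)) : Set (Fin I.n)) ⊆ I.G.neighborSet u := by
    intro y hy
    simp only [Finset.coe_insert, Finset.coe_singleton, Set.mem_insert_iff,
      Set.mem_singleton_iff] at hy
    rcases hy with rfl | rfl | rfl <;> assumption
  have hle := Set.ncard_le_ncard hsub (Set.toFinite _)
  rw [Set.ncard_coe_finset, Finset.card_eq_three.2 ⟨v, v', v'', h1, h3, h2, rfl⟩] at hle
  have := hdeg u hu
  omega

theorem hasSolution_iff {W : ℕ → ℕ → ℝ≥0∞} (hW : ∀ u v : Fin I.n, W u v = I.ω s(u, v)) :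
    HasSolution L.initialState (I.V₁.map Fin.valEmbedding) (I.V₁ᶜ.map Fin.valEmbedding) W ↔
      I.IsYes := by
  rw [isYes_iff]
  have hJ : ∀ x : Fin I.n → Fin I.n,
      (∀ j ∈ I.J, ∃ u ∈ I.V₁, ∀ i ∈ j, I.cellOf u = i ∨ I.cellOf (x u) = i) ↔
      ∀ j < L.joins.length, ∃ u ∈ I.V₁, Sat L.initialState u (x u) j := by
    intro x
    constructor
    · intro h j hj
      simp only [L.sat_iff hj]
      exact h _ ((L.mem_joins _).1 (List.mem_map.2 ⟨_, List.getElem_mem hj, rfl⟩))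
    · intro h j hj
      obtain ⟨p, hp, rfl⟩ := List.mem_map.1 ((L.mem_joins j).2 hj)
      obtain ⟨i, hi, rfl⟩ := List.mem_iff_getElem.1 hp
      have := h i hi
      simpa only [L.sat_iff hi] using this
  simp only [HasSolution, Finset.card_map, Finset.sum_map, Finset.mem_map, forall_exists_index,
    and_imp, forall_apply_eq_imp_iff₂, Fin.valEmbedding_apply, Finset.coe_map, exists_exists_and_eq_and]
  constructor
  · rintro ⟨hcard, x, hx, hinj, hcov, hsum⟩
    -- The machine-level choice has natural numbers as values; on `V₁` they are ends of listed edges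
    -- and hence vertices.
    have hxF : ∀ u, ∃ v : Fin I.n, u ∈ I.V₁ → I.G.Adj u v ∧ x u = v := by
      intro u
      by_cases hu : u ∈ I.V₁
      · obtain ⟨i, hi, hl, hr⟩ := hx u hu
        obtain ⟨u', -, v, hadj, hl', hr', -⟩ := L.exists_ends hi
        rw [hl', Fin.val_inj] at hl
        subst hl
        exact ⟨v, fun _ => ⟨hadj, by rw [← hr, hr']⟩⟩
      · exact ⟨u, fun h => absurd h hu⟩
    choose y hy using hxF
    have hyinj : Set.InjOn y I.V₁ := by
      intro u hu u' hu' h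
      have := hinj (Set.mem_image_of_mem _ hu) (Set.mem_image_of_mem _ hu')
        (by simp only [(hy u hu).2, (hy u' hu').2, h])
      simpa [Fin.val_inj] using this
    refine ⟨y, fun u hu => (hy u hu).1, hyinj, ?_, (hJ y).2 ?_, ?_⟩
    · intro v hv
      -- Equal sizes turn the injective choice into a bijection, so the second side is covered.
      obtain ⟨u, hu, rfl⟩ := Finset.surj_on_of_inj_on_of_card_le (s := I.V₁) (t := I.V₁ᶜ)
        (fun u _ => y u) (fun u hu => Finset.mem_compl.2 (notMem_of_adj hu (hy u hu).1))
        (fun u u' hu hu' h => hyinj hu hu' h) hcard.ge v (Finset.mem_compl.2 hv)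
      exact ⟨u, hu, rfl⟩
    · intro j hj
      obtain ⟨u, hu, hs⟩ := hcov j hj
      exact ⟨u, hu, by rwa [← (hy u hu).2]⟩
    · refine le_of_eq_of_le (Finset.sum_congr rfl fun u hu => ?_) hsum
      rw [(hy u hu).2, hW]
  · rintro ⟨x, hx, hinj, hsurj, hcov, hsum⟩
    refine ⟨?_, fun u => if h : u < I.n then x ⟨u, h⟩ else 0, ?_, ?_, ?_, ?_⟩
    · refine Finset.card_nbij x (fun u hu => Finset.mem_compl.2 (notMem_of_adj hu (hx u hu))) hinj ?_
      intro v hv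
      obtain ⟨u, hu, rfl⟩ := hsurj v (by simpa using hv)
      exact ⟨u, hu, rfl⟩
    · intro u hu
      simp only [Fin.is_lt, dite_true, Fin.eta]
      exact L.exists_index hu (hx u hu)
    · rintro _ ⟨u, hu, rfl⟩ _ ⟨u', hu', rfl⟩ h
      simp only [Fin.is_lt, dite_true, Fin.eta, Fin.val_inj] at h ⊢
      exact hinj hu hu' h
    · intro j hj
      obtain ⟨u, hu, hs⟩ := (hJ x).1 hcov j hj
      exact ⟨u, hu, by simpa using hs⟩
    · simp only [Fin.is_lt, dite_true, Fin.eta, hW]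
      exact hsum

end CBMInstance.Listing

/-! ## The running time -/

theorem CBMProgram.time_le {n m c : ℕ} (hn : 1 ≤ n) (hm : m ≤ n * n) :
    n * 20 + m * 50 + n * (n * 150 + 150) + (n * (n * 50 + c * 20 + n * (c * 100 + 107) +
      c * (2 ^ c * 40 + 20) + 2 ^ c * 50 + 140) + c * 20 + 2 ^ c * 20) + 100 ≤
    1000 * (2 ^ (c * (c + 1)) * n + n ^ 3 + 1) := by
  have hc : c ≤ 2 ^ c := Nat.lt_two_pow_self.le
  -- For c ≥ 1 one has c + c ≤ c(c + 1); for c = 0 the left side vanishes.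
  have h1 : c * 2 ^ c ≤ 2 ^ (c * (c + 1)) := by
    rcases Nat.eq_zero_or_pos c with rfl | hpos
    · simp
    calc c * 2 ^ c ≤ 2 ^ c * 2 ^ c := Nat.mul_le_mul_right _ hc
      _ = 2 ^ (c + c) := (pow_add 2 c c).symm
      _ ≤ 2 ^ (c * (c + 1)) := Nat.pow_le_pow_right (by norm_num) (by nlinarith)
  have h2 : 2 ^ c ≤ 2 ^ (c * (c + 1)) := Nat.pow_le_pow_right (by norm_num) (by nlinarith)
  have h3 : c * c ≤ c * 2 ^ c := Nat.mul_le_mul_left _ hc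
  generalize 2 ^ (c * (c + 1)) = X at *
  generalize 2 ^ c = E at *
  have k1 : n * (c * E) ≤ n * X := Nat.mul_le_mul_left _ h1
  have k2 : n * E ≤ n * X := Nat.mul_le_mul_left _ h2
  have k3 : n * c ≤ n * E := Nat.mul_le_mul_left _ hc
  have k4 : E ≤ n * E := Nat.le_mul_of_pos_left _ hn
  have k5 : c ≤ n * c := Nat.le_mul_of_pos_left _ hn
  have k6 : n ≤ n * n := Nat.le_mul_of_pos_left _ hn
  have k7 : n * n ≤ n * (n * n) := Nat.le_mul_of_pos_left _ hn
  -- The mixed term n²c from accounting for the joins along the cycles is split between n³ and nc².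
  have k8 : n * (n * c) ≤ n * (n * n + c * c) :=
    Nat.mul_le_mul_left _ (by rcases le_total n c with h | h <;> nlinarith)
  have k9 : n * (c * c) ≤ n * (c * E) := Nat.mul_le_mul_left _ h3
  have e : n ^ 3 = n * (n * n) := by ring
  rw [e]
  linarith

theorem mainTheorem8 :
    ∃ (P : RAM.Prog) (K : ℕ), ∀ I : CBMInstance,
      (∀ v ∈ I.V₁, (I.G.neighborSet v).ncard ≤ 2) →
        P.DecidesWithin I (K * (2 ^ (I.J.card * (I.J.card + 1)) * I.n + I.n ^ 3 + 1)) := by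
  refine ⟨CBMProgram.decideCBM, 2000, fun I hdeg L => ?_⟩
  suffices h : RAM.Runs CBMProgram.decideCBM L.initialState
      (2000 * (2 ^ (I.J.card * (I.J.card + 1)) * I.n + I.n ^ 3 + 1))
      fun s' => (I.IsYes → s'.reg 0 = 1) ∧ (¬ I.IsYes → s'.reg 0 = 0) by
    obtain ⟨t, s', he, ht, hs⟩ := h
    exact ⟨t, s', he, ht, hs⟩
  have r0 : L.initialState.reg 0 = I.n := rfl
  have r1 : L.initialState.reg 1 = L.edges.length := rfl
  have r3 : L.initialState.reg 3 = I.J.card := L.length_joins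
  -- Doubling the constant pays for the initial test; the summand 1 covers the empty graph.
  refine (RAM.Runs.cond (T := 1000 * (2 ^ (I.J.card * (I.J.card + 1)) * I.n + I.n ^ 3 + 1))
    (fun h => ?_) (fun h => ?_)).mono (by simp only [RAM.Test.cost, RAM.NExp.cost]; omega)
    fun _ _ h => h
  · have hn : I.n = 0 := h
    have : IsEmpty (Fin I.n) := by rw [hn]; infer_instance
    refine (CBMProgram.runs_output (P := I.IsYes) ?_).mono
      (by simp only [RAM.Test.cost, RAM.NExp.cost]; omega) fun _ _ h => h
    -- The only matching of the empty graph is empty and has weight 0, so the answer is yes exactly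
    -- if there are no joins.
    simp only [RAM.Test.Holds, RAM.NExp.eval, r3, Finset.card_eq_zero]
    rw [CBMInstance.isYes_iff]
    have hV : I.V₁ = ∅ := Finset.eq_empty_of_isEmpty _
    constructor
    · intro hJ
      exact ⟨isEmptyElim, by simp [hV], by simp [hV], isEmptyElim, by simp [hJ], by simp [hV]⟩
    · rintro ⟨x, -, -, -, hJ, -⟩
      refine Finset.eq_empty_of_forall_notMem fun j hj => ?_
      obtain ⟨u, -⟩ := hJ j hj
      exact isEmptyElim u
  · have hn : 1 ≤ I.n := Nat.one_le_iff_ne_zero.2 h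
    let W : ℕ → ℕ → ℝ≥0∞ := fun u v =>
      if h : u < I.n ∧ v < I.n then I.ω s(⟨u, h.1⟩, ⟨v, h.2⟩) else 0
    have hW : ∀ u v : Fin I.n, W u v = I.ω s(u, v) := fun u v => by simp [W]
    have hrun := CBMProgram.runs_decideNonempty (s := L.initialState)
      (V₁ := I.V₁.map Fin.valEmbedding) (V₂ := I.V₁ᶜ.map Fin.valEmbedding) (W := W) hn ?_ ?_ ?_
      (fun _ => rfl) (fun _ => rfl) (fun _ => rfl) rfl ENNReal.coe_ne_top ?_
      (fun i hi j hj l hl => L.degree_le hdeg hi hj hl) ?_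
    · rw [L.hasSolution_iff hW, r0, r1, r3] at hrun
      exact hrun.mono (CBMProgram.time_le hn L.length_edges_le) fun _ _ h => h
    · intro v
      rw [r0]
      constructor
      · intro hv
        obtain ⟨u, hu, rfl⟩ := Finset.mem_map.1 hv
        exact ⟨u.2, by simp [L.initialState_mark, hu]⟩
      · rintro ⟨hv, hm⟩
        refine Finset.mem_map.2 ⟨⟨v, hv⟩, ?_, rfl⟩
        have := L.initialState_mark ⟨v, hv⟩
        by_contra hV
        simp [hV, hm] at this
    · intro v
      rw [r0]
      constructor
      · intro hv
        obtain ⟨u, hu, rfl⟩ := Finset.mem_map.1 hv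
        exact ⟨u.2, by simpa [L.initialState_mark] using hu⟩
      · rintro ⟨hv, hm⟩
        refine Finset.mem_map.2 ⟨⟨v, hv⟩, ?_, rfl⟩
        have := L.initialState_mark ⟨v, hv⟩
        rw [Finset.mem_compl]
        intro hV
        simp [hV, hm] at this
    · intro v
      simp only [CBMInstance.Listing.initialState]
      split_ifs <;> simp
    · intro i hi
      obtain ⟨u, hu, v, hadj, hl, hr, -⟩ := L.exists_ends hi
      rw [hl, hr]
      exact ⟨Finset.mem_map_of_mem _ hu,
        Finset.mem_map_of_mem _ (Finset.mem_compl.2 (CBMInstance.notMem_of_adj hu hadj))⟩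
    · intro i hi
      obtain ⟨u, hu, v, hadj, hl, hr, he⟩ := L.exists_ends hi
      have hi' : i < L.edges.length := hi
      rw [hl, hr, hW, ← he]
      simp only [CBMInstance.Listing.initialState, hi', dite_true]
      rfl
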